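/- Let $\Gamma$ be a torsionless grading monoid, that is, a commutative cancellative monoid (written additively) whose quotient group $\langle\Gamma\rangle$ is torsion-free. Let $R=\bigoplus_{\alpha\in\Gamma}R_\alpha$ be a $\Gamma$-graded integral domain with quotient field $K$, and suppose that $R$ has a unit of nonzero degree, i.e. some $R_\alpha$ with $\alpha\neq 0$ contains a unit of $R$. Notation. For a domain $D$ with quotient field $K$ and a nonzero $D$-submodule $E$ of $K$, put $E^{-1}=\{x\in K\mid xE\subseteq D\}$, $E^v=(E^{-1})^{-1}$, $E^t=\bigcup\{F^v\mid F\subseteq E$ a nonzero finitely generated submodule$\}$, and $E^w=\{x\in K\mid xJ\subseteq E$ for some nonzero finitely generated ideal $J$ of $D$ with $J^v=D\}$. For a nonzero finitely generated submodule $F$ of $K$, put $F^{w_a}=\bigcup_G\,((FG)^w:G^w)$, where $G$ runs over the nonzero finitely generated submodules of $K$ and $(A:B)=\{x\in K\mid xB\subseteq A\}$. The domain $D$ is a P$v$MD if $(II^{-1})^t=D$ for each nonzero finitely generated fractional ideal $I$ of $D$. It is a Prüfer domain if $II^{-1}=D$ for all such $I$. Let $H$ be the set of nonzero homogeneous elements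 of $R$, and let $R_H=\bigoplus_{\gamma\in\langle\Gamma\rangle}(R_H)_\gamma$ be the homogeneous quotient field. For $f\in R_H$ let $C(f)$ be the $R$-submodule of $R_H$ generated by the homogeneous components of $f$. The ring $R$ is a graded P$v$MD if $(II^{-1})^t=R$ for each nonzero finitely generated homogeneous ideal $I$ of $R$. A ring $T$ with $R\subseteq T\subseteq R_H$ is a homogeneous overring of $R$ if $T=\bigoplus_\gamma(T\cap(R_H)_\gamma)$. Such a $T$ is a graded Prüfer domain if each nonzero finitely generated homogeneous ideal of $T$ is invertible, and it is homogeneously $t$-linked over $R$ if, for each nonzero finitely generated homogeneous ideal $F$ of $R$, $F^t=R$ implies $(FT)^t=T$, where the second $t$ is the $t$-operation of $T$. Let $h\text{-}\mathrm{QMax}^t(R)$ be the set of ideals of $R$ that are maximal among the proper nonzero homogeneous ideals $I$ with $I^t\cap R=I$. Let $N_v(H)=\{0\ne f\in R\mid C(f)^v=R\}$, a multiplicative set, and $$\mathrm{Kr}(R,w)=\Big\{\tfrac fg\ \Big|\ f,g\in R,\ g\neq 0,\ C(f)C(h)\subseteq (C(g)C(h))^w\text{ for some }0\neq h\in R\Big\}.$$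 Then the following statements are equivalent. 1. $R$ is a P$v$MD (equivalently, a graded P$v$MD). 2. Each $P\in h\text{-}\mathrm{QMax}^t(R)$ is prime and $R_{H\setminus P}$ is a graded Prüfer domain. 3. Each $P\in h\text{-}\mathrm{QMax}^t(R)$ is prime and $R_P$ is a valuation domain. 4. Every ideal of $R_{N_v(H)}$ is extended from a homogeneous ideal of $R$. 5. $R_{N_v(H)}$ is a Prüfer domain. 6. $R_{N_v(H)}$ is a Bézout domain. 7. $R_{N_v(H)}=\mathrm{Kr}(R,w)$. 8. $\mathrm{Kr}(R,w)$ is a quotient ring of $R$, i.e. $\mathrm{Kr}(R,w)=R_S$ for some multiplicative set $S\subseteq R\setminus\{0\}$. 9. $\mathrm{Kr}(R,w)$ is a subring of $K$ containing $R$, and it is flat as an $R$-module. 10. Each homogeneously $t$-linked homogeneous overring of $R$ is a P$v$MD. 11. Each homogeneously $t$-linked homogeneous overring of $R$ is integrally closed. 12. $(C(f)C(g))^w=C(fg)^w$ for all $f,g\in R_H$ (where $0^w=0$). 13. $I^w=I^{w_a}$ for each nonzero finitely generated homogeneous ideal $I$ of $R$. -/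

import Mathlib

noncomputable section

namespace GradedDomain

/-! ### Star operations on an integral domain `D` with quotient field `K`

Nonzero `D`-submodules of `K` are the elements of `Submodule D K` other than `⊥`; the submodule
`1` is `D` itself, and `1 / E` is `E⁻¹ = (D : E) = {x ∈ K | x E ⊆ D}`. -/

section StarOperations

variable {D K : Type*} [CommRing D] [Field K] [Algebra D K]

/-- The `v`-operation, `E ↦ (E⁻¹)⁻¹`. -/
def vOp (E : Submodule D K) : Submodule D K := 1 / (1 / E)

/-- The `t`-operation: the union of the `F^v`, for `F` a finitely generated submodule of `E`.
The union is directed, so that it is also the supremum; see `mem_tOp_iff`. -/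
def tOp (E : Submodule D K) : Submodule D K :=
  ⨆ F : {F : Submodule D K // F.FG ∧ F ≤ E}, vOp F.1

theorem one_div_anti {E F : Submodule D K} (h : E ≤ F) : 1 / F ≤ 1 / E := by
  intro x hx
  rw [Submodule.mem_div_iff_forall_mul_mem] at hx ⊢
  exact fun y hy => hx y (h hy)

theorem vOp_mono {E F : Submodule D K} (h : E ≤ F) : vOp E ≤ vOp F :=
  one_div_anti (one_div_anti h)

theorem le_vOp (E : Submodule D K) : E ≤ vOp E := by
  intro x hx
  rw [vOp, Submodule.mem_div_iff_forall_mul_mem]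
  intro y hy
  rw [mul_comm]
  exact Submodule.mem_div_iff_forall_mul_mem.1 hy x hx

theorem mem_tOp_iff {E : Submodule D K} {x : K} :
    x ∈ tOp E ↔ ∃ F : Submodule D K, F.FG ∧ F ≤ E ∧ x ∈ vOp F := by
  unfold tOp
  have : Nonempty {F : Submodule D K // F.FG ∧ F ≤ E} := ⟨⟨⊥, Submodule.fg_bot, bot_le⟩⟩
  rw [Submodule.mem_iSup_of_directed]
  · constructor
    · rintro ⟨⟨F, h1, h2⟩, h3⟩
      exact ⟨F, h1, h2, h3⟩
    · rintro ⟨F, h1, h2, h3⟩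
      exact ⟨⟨F, h1, h2⟩, h3⟩
  · rintro ⟨F, h1, h2⟩ ⟨G, h3, h4⟩
    exact ⟨⟨F ⊔ G, h1.sup h3, sup_le h2 h4⟩, vOp_mono le_sup_left, vOp_mono le_sup_right⟩

theorem one_div_one : (1 : Submodule D K) / 1 = 1 := by
  ext x
  rw [Submodule.mem_div_iff_forall_mul_mem]
  constructor
  · intro h
    simpa using h 1 (Submodule.one_le.1 le_rfl)
  · intro hx y hy
    simpa using Submodule.mul_mem_mul hx hy

theorem vOp_eq_one_iff {E : Submodule D K} : vOp E = 1 ↔ 1 / E = 1 := by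
  constructor
  · intro h
    refine le_antisymm (le_vOp (1 / E)) ?_ |>.trans ?_ |> fun h' => h'
    · exact one_div_anti (le_vOp E)
    · change 1 / (vOp E) = 1
      rw [h, one_div_one]
  · intro h
    rw [vOp, h, one_div_one]

theorem one_div_mul_eq_one {E F : Submodule D K} (hE : 1 / E = 1) (hF : 1 / F = 1) :
    1 / (E * F) = 1 := by
  apply le_antisymm
  · intro x hx
    rw [Submodule.mem_div_iff_forall_mul_mem] at hx
    rw [← hF, Submodule.mem_div_iff_forall_mul_mem]
    intro f hf
    rw [← hE, Submodule.mem_div_iff_forall_mul_mem]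
    intro e he
    have := hx (e * f) (Submodule.mul_mem_mul he hf)
    rwa [show x * f * e = x * (e * f) by ring]
  · intro x hx
    have hE1 : E ≤ 1 := by
      have := le_vOp E
      rwa [vOp_eq_one_iff.2 hE] at this
    have hF1 : F ≤ 1 := by
      have := le_vOp F
      rwa [vOp_eq_one_iff.2 hF] at this
    rw [Submodule.mem_div_iff_forall_mul_mem]
    intro y hy
    have h1 : y ∈ (1 : Submodule D K) := by
      simpa using mul_le_mul' hE1 hF1 hy
    simpa using Submodule.mul_mem_mul hx h1

/-- The `w`-operation: `E^w = {x ∈ K | x J ⊆ E for some nonzero finitely generated ideal J of D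
with J^v = D}`. -/
def wOp [IsDomain D] (E : Submodule D K) : Submodule D K where
  carrier := {x | ∃ J : Ideal D, J ≠ ⊥ ∧ J.FG ∧ vOp (IsLocalization.coeSubmodule K J) = 1 ∧
    ∀ j ∈ J, j • x ∈ E}
  zero_mem' := ⟨⊤, top_ne_bot, Ideal.fg_top D, by
    rw [IsLocalization.coeSubmodule_top, vOp, one_div_one, one_div_one], by simp⟩
  add_mem' := by
    rintro x y ⟨I, hI0, hI1, hI2, hI3⟩ ⟨J, hJ0, hJ1, hJ2, hJ3⟩
    refine ⟨I * J, mul_ne_zero hI0 hJ0, hI1.mul hJ1, ?_, ?_⟩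
    · rw [IsLocalization.coeSubmodule_mul]
      rw [vOp_eq_one_iff] at hI2 hJ2 ⊢
      exact one_div_mul_eq_one hI2 hJ2
    · intro j hj
      rw [smul_add]
      exact E.add_mem (hI3 j (Ideal.mul_le_left hj)) (hJ3 j (Ideal.mul_le_right hj))
  smul_mem' := by
    rintro c x ⟨I, hI0, hI1, hI2, hI3⟩
    refine ⟨I, hI0, hI1, hI2, fun j hj => ?_⟩
    rw [smul_comm]
    exact E.smul_mem c (hI3 j hj)

/-- The value at a nonzero finitely generated submodule `F` of the e.a.b. operation associated
to `⋆`: `F^{⋆_a} = ⋃ ((F G)^⋆ : G^⋆)`, over all nonzero finitely generated submodules `G`. -/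
def eabOp (star : Submodule D K → Submodule D K) (F : Submodule D K) : Set K :=
  ⋃ G ∈ {G : Submodule D K | G.FG ∧ G ≠ ⊥}, ((star (F * G) / star G : Submodule D K) : Set K)

variable (D K)

/-- `D` is a Prüfer `v`-multiplication domain: `(I I⁻¹)^t = D` for each nonzero finitely
generated fractional ideal `I`. -/
def IsPvMD : Prop :=
  ∀ I : Submodule D K, I.FG → I ≠ ⊥ → tOp (I * (1 / I)) = 1

/-- `D` is a Prüfer domain: each nonzero finitely generated fractional ideal is invertible. -/
def IsPruferDomain : Prop :=
  ∀ I : Submodule D K, I.FG → I ≠ ⊥ → I * (1 / I) = 1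

end StarOperations

/-! ### Graded integral domains -/

section Graded

variable {Γ R : Type*} [AddCancelCommMonoid Γ] [DecidableEq Γ] [CommRing R]
  (𝒜 : Γ → AddSubgroup R) [GradedRing 𝒜]

/-- The multiplicative set `H` of nonzero homogeneous elements. -/
def homSubmonoid : Submonoid R := SetLike.homogeneousSubmonoid 𝒜 ⊓ nonZeroDivisors R

/-- The content `C(f)` of `f ∈ R`: the ideal generated by the homogeneous components of `f`. -/
def contentIdeal (f : R) : Ideal R :=
  Ideal.span (Set.range fun α : Γ => (DirectSum.decompose 𝒜 f α : R))

theorem contentIdeal_fg (f : R) : (contentIdeal 𝒜 f).FG := by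
  classical
  have hfin : (Set.range fun α : Γ => (DirectSum.decompose 𝒜 f α : R)).Finite := by
    refine (((DirectSum.decompose 𝒜 f).support.image
      (fun α => (DirectSum.decompose 𝒜 f α : R))).finite_toSet.union
      (Set.finite_singleton (0 : R))).subset ?_
    rintro _ ⟨α, rfl⟩
    by_cases h : DirectSum.decompose 𝒜 f α = 0
    · right
      simp [h]
    · left
      simp only [Finset.coe_image, Set.mem_image, Finset.mem_coe, DFinsupp.mem_support_iff]
      exact ⟨α, h, rfl⟩
  exact ⟨hfin.toFinset, by rw [Set.Finite.coe_toFinset]; rfl⟩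

theorem exists_uniqueAdd [IsAddTorsionFree Γ] {A B : Finset Γ} (hA : A.Nonempty) (hB : B.Nonempty) :
    ∃ a ∈ A, ∃ b ∈ B, UniqueAdd A B a b := by
  classical
  let M : AddSubmonoid Γ := AddSubmonoid.closure (A ∪ B : Finset Γ)
  have : AddMonoid.FG M := (AddMonoid.fg_iff_addSubmonoid_fg M).2 ⟨A ∪ B, rfl⟩
  have : IsAddTorsionFree M := ⟨fun n hn x y h => Subtype.ext
    (IsAddTorsionFree.nsmul_right_injective hn (congrArg Subtype.val h))⟩
  have hAM : ∀ a ∈ A, a ∈ M := fun a ha => AddSubmonoid.subset_closure (by simp [ha])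
  have hBM : ∀ b ∈ B, b ∈ M := fun b hb => AddSubmonoid.subset_closure (by simp [hb])
  let _ : AddCancelCommMonoid M :=
    { (inferInstance : AddCommMonoid M) with
      add_left_cancel := fun x y z h => Subtype.ext (add_left_cancel (congrArg Subtype.val h)) }
  have : TwoUniqueSums M := AffineAddMonoid.to_twoUniqueSums
  obtain ⟨a0, ha0⟩ := hA
  obtain ⟨b0, hb0⟩ := hB
  obtain ⟨a, ha, b, hb, h⟩ := UniqueSums.uniqueAdd_of_nonempty
    (A := A.subtype (· ∈ M)) (B := B.subtype (· ∈ M))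
    ⟨⟨a0, hAM _ ha0⟩, by simpa using ha0⟩ ⟨⟨b0, hBM _ hb0⟩, by simpa using hb0⟩
  refine ⟨a, by simpa using ha, b, by simpa using hb, fun x y hx hy hxy => ?_⟩
  have := h (a := ⟨x, hAM _ hx⟩) (b := ⟨y, hBM _ hy⟩) (by simpa using hx) (by simpa using hy)
    (Subtype.ext hxy)
  exact ⟨congrArg Subtype.val this.1, congrArg Subtype.val this.2⟩

theorem contentIdeal_le_or_le_of_mul_le [IsAddTorsionFree Γ] {P : Ideal R} [P.IsPrime] {f g : R}
    (h : contentIdeal 𝒜 (f * g) ≤ P) : contentIdeal 𝒜 f ≤ P ∨ contentIdeal 𝒜 g ≤ P := by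
  classical
  by_contra! hcon
  obtain ⟨hf, hg⟩ := hcon
  have key : ∀ f : R, ¬ contentIdeal 𝒜 f ≤ P →
      ((DirectSum.decompose 𝒜 f).support.filter
        (fun α => (DirectSum.decompose 𝒜 f α : R) ∉ P)).Nonempty := by
    intro f hf
    by_contra hne
    apply hf
    rw [contentIdeal, Ideal.span_le]
    rintro _ ⟨α, rfl⟩
    by_contra hα
    apply hne
    refine ⟨α, ?_⟩
    rw [Finset.mem_filter, DFinsupp.mem_support_iff]
    refine ⟨fun h0 => hα ?_, hα⟩
    simp [h0]
  obtain ⟨a, ha, b, hb, hu⟩ := exists_uniqueAdd (key f hf) (key g hg)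
  rw [Finset.mem_filter] at ha hb
  have hmem : (DirectSum.decompose 𝒜 (f * g) (a + b) : R) ∈ P :=
    h (Ideal.subset_span ⟨a + b, rfl⟩)
  rw [DirectSum.decompose_mul, DirectSum.coe_mul_apply] at hmem
  have hab : (a, b) ∈ ((DirectSum.decompose 𝒜 f).support ×ˢ
      (DirectSum.decompose 𝒜 g).support).filter (fun ij : Γ × Γ => ij.1 + ij.2 = a + b) := by
    simp only [Finset.mem_filter, Finset.mem_product]
    exact ⟨⟨ha.1, hb.1⟩, trivial⟩
  rw [← Finset.add_sum_erase _ _ hab] at hmem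
  have hrest := P.sum_mem (t := (((DirectSum.decompose 𝒜 f).support ×ˢ
      (DirectSum.decompose 𝒜 g).support).filter
        (fun ij : Γ × Γ => ij.1 + ij.2 = a + b)).erase (a, b))
      (f := fun ij => (DirectSum.decompose 𝒜 f ij.1 * DirectSum.decompose 𝒜 g ij.2 : R)) ?_
  · have := (P.add_mem_iff_left hrest).1 hmem
    rcases Ideal.IsPrime.mem_or_mem inferInstance this with h1 | h1
    · exact ha.2 h1
    · exact hb.2 h1
  · rintro ⟨i, j⟩ hij
    simp only [Finset.mem_erase, Finset.mem_filter, Finset.mem_product] at hij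
    by_contra hnot
    have h1 : (DirectSum.decompose 𝒜 f i : R) ∉ P := fun h1 => hnot (P.mul_mem_right _ h1)
    have h2 : (DirectSum.decompose 𝒜 g j : R) ∉ P := fun h2 => hnot (P.mul_mem_left _ h2)
    have := hu (a := i) (b := j) (by simpa using ⟨by simpa using hij.2.1.1, h1⟩)
      (by simpa using ⟨by simpa using hij.2.1.2, h2⟩) hij.2.2
    exact hij.1 (by rw [this.1, this.2])

variable [IsDomain R] (K : Type*) [Field K] [Algebra R K] [IsFractionRing R K]

/-- The homogeneous quotient field `R_H`, inside the quotient field `K` of `R`. -/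
def homQuotientField : Subalgebra R K :=
  Localization.subalgebra.ofField K (homSubmonoid 𝒜) inf_le_right

/-- The component `(R_H)_γ` of `R_H`, for `γ` in the quotient group of `Γ`: the fractions `a / s`
with `a` homogeneous of degree `α`, `s ∈ H` of degree `β`, and `γ = α - β`. -/
def homPiece (γ : Algebra.GrothendieckAddGroup Γ) : AddSubgroup K :=
  AddSubgroup.closure {x | ∃ α β : Γ, ∃ a ∈ 𝒜 α, ∃ s ∈ 𝒜 β, s ≠ 0 ∧
    γ = Algebra.GrothendieckAddGroup.of α - Algebra.GrothendieckAddGroup.of β ∧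
    x = algebraMap R K a / algebraMap R K s}

/-- A subgroup `A` of `K` is homogeneous if `A = ⨁_γ (A ∩ (R_H)_γ)`; in particular `A ⊆ R_H`.
(The sum of the `(R_H)_γ` is direct.) -/
def IsHomogeneousSubgroup (A : AddSubgroup K) : Prop :=
  A = ⨆ γ : Algebra.GrothendieckAddGroup Γ, A ⊓ homPiece 𝒜 K γ

/-- `T` is a homogeneous overring of `R`: `R ⊆ T ⊆ R_H` and `T = ⨁_γ (T ∩ (R_H)_γ)`. -/
def IsHomogeneousOverring (T : Subalgebra R K) : Prop :=
  T ≤ homQuotientField 𝒜 K ∧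
    IsHomogeneousSubgroup 𝒜 K (Subalgebra.toSubmodule T).toAddSubgroup

/-- The homogeneous overring `T` is a graded Prüfer domain: each nonzero finitely generated
homogeneous ideal of `T` is invertible. -/
def IsGradedPruferDomain (T : Subalgebra R K) : Prop :=
  ∀ I : Submodule T K, I ≤ 1 → I.FG → I ≠ ⊥ → IsHomogeneousSubgroup 𝒜 K I.toAddSubgroup →
    I * (1 / I) = 1

/-- `R` is a graded Prüfer `v`-multiplication domain: `(I I⁻¹)^t = R` for each nonzero finitely
generated homogeneous ideal `I` of `R`. -/
def IsGradedPvMD : Prop :=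
  ∀ I : Ideal R, I.FG → I ≠ ⊥ → I.IsHomogeneous 𝒜 →
    tOp (IsLocalization.coeSubmodule K I * (1 / IsLocalization.coeSubmodule K I)) = 1

/-- `I` is a proper homogeneous quasi-`t`-ideal of `R`: `I ≠ 0`, `I ≠ R`, `I` is homogeneous and
`I^t ∩ R = I`. -/
def IsProperHomQuasiTIdeal (I : Ideal R) : Prop :=
  I ≠ ⊥ ∧ I ≠ ⊤ ∧ I.IsHomogeneous 𝒜 ∧
    ∀ r : R, algebraMap R K r ∈ tOp (IsLocalization.coeSubmodule K I) → r ∈ I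

/-- The set `h-QMax^t(R)` of the ideals of `R` that are maximal among the proper homogeneous
quasi-`t`-ideals. -/
def hQMaxT : Set (Ideal R) := {P | Maximal (IsProperHomQuasiTIdeal 𝒜 K) P}

/-- `T` is homogeneously `t`-linked over `R`: `F^t = R` implies `(FT)^t = T` for each nonzero
finitely generated homogeneous ideal `F` of `R` (the second `t` is that of `T`). -/
def IsHomogeneouslyTLinked (T : Subalgebra R K) : Prop :=
  ∀ F : Ideal R, F ≠ ⊥ → F.FG → F.IsHomogeneous 𝒜 →
    tOp (IsLocalization.coeSubmodule K F) = 1 →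
    tOp (Submodule.span T (algebraMap R K '' (F : Set R))) = 1

/-- The ring of fractions `R_{H \ P}`, inside `K`. -/
def homLocalization (P : Ideal R) [P.IsPrime] : Subalgebra R K :=
  Localization.subalgebra.ofField K (homSubmonoid 𝒜 ⊓ P.primeCompl)
    (inf_le_left.trans inf_le_right)

/-- The local ring `R_P`, inside `K`. -/
def localizationAt (P : Ideal R) [P.IsPrime] : Subalgebra R K :=
  Localization.subalgebra.ofField K P.primeCompl P.primeCompl_le_nonZeroDivisors

/-- The content `C(f)` of `f ∈ R_H`: the fractional ideal generated by the homogeneous components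
of `f`. If `f = a / s` with `a ∈ R` and `s ∈ H`, then these are the `a_α / s`, where the `a_α` are
the homogeneous components of `a`; they do not depend on the choice of `a` and `s`, see
`fracContent_div`. -/
def fracContent (f : K) : Submodule R K :=
  Submodule.span R {x | ∃ a : R, ∃ s ∈ homSubmonoid 𝒜, f = algebraMap R K a / algebraMap R K s ∧
    ∃ α : Γ, x = algebraMap R K (DirectSum.decompose 𝒜 a α) / algebraMap R K s}

theorem fracContent_div (a : R) {s : R} (hs : s ∈ homSubmonoid 𝒜) :
    fracContent 𝒜 K (algebraMap R K a / algebraMap R K s) =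
      Submodule.span R (Set.range fun α : Γ =>
        algebraMap R K (DirectSum.decompose 𝒜 a α) / algebraMap R K s) := by
  apply le_antisymm
  · rw [fracContent, Submodule.span_le]
    rintro _ ⟨b, t, ht, hab, α, rfl⟩
    have hs0 : algebraMap R K s ≠ 0 := by simpa using nonZeroDivisors.ne_zero hs.2
    have ht0 : algebraMap R K t ≠ 0 := by simpa using nonZeroDivisors.ne_zero ht.2
    obtain ⟨β, hβ⟩ := hs.1
    obtain ⟨δ, hδ⟩ := ht.1
    rw [div_eq_div_iff hs0 ht0, ← map_mul, ← map_mul] at hab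
    have hab' : a * t = b * s := IsFractionRing.injective R K hab
    have h1 : (DirectSum.decompose 𝒜 b α : R) * s = DirectSum.decompose 𝒜 (a * t) (α + β) := by
      rw [hab', DirectSum.coe_decompose_mul_add_of_right_mem 𝒜 hβ]
    by_cases hex : ∃ ε, ε + δ = α + β
    · obtain ⟨ε, hε⟩ := hex
      rw [← hε, DirectSum.coe_decompose_mul_add_of_right_mem 𝒜 hδ] at h1
      refine Submodule.subset_span ⟨ε, ?_⟩
      change algebraMap R K _ / algebraMap R K s = _
      rw [div_eq_div_iff hs0 ht0, ← map_mul, ← map_mul, h1]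
    · have hz : (DirectSum.decompose 𝒜 (a * t) (α + β) : R) = 0 := by
        classical
        rw [DirectSum.decompose_mul, DirectSum.coe_mul_apply]
        refine Finset.sum_eq_zero fun ij hij => ?_
        rw [Finset.mem_filter, Finset.mem_product] at hij
        by_contra hne
        apply hex
        refine ⟨ij.1, ?_⟩
        rw [← hij.2]
        congr 1
        by_contra hd
        apply hne
        rw [DirectSum.decompose_of_mem_ne 𝒜 hδ hd, mul_zero]
      rw [hz] at h1
      have : (DirectSum.decompose 𝒜 b α : R) = 0 :=
        (mul_eq_zero.1 h1).resolve_right (nonZeroDivisors.ne_zero hs.2)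
      rw [this, map_zero, zero_div]
      exact zero_mem _
  · rw [Submodule.span_le]
    rintro _ ⟨α, rfl⟩
    exact Submodule.subset_span ⟨a, s, hs, rfl, α, rfl⟩

/-- The Kronecker function ring `Kr(R, w)`: the set of the fractions `f / g` with `f, g ∈ R`,
`g ≠ 0`, such that `C(f) C(h) ⊆ (C(g) C(h))^w` for some nonzero `h ∈ R`. -/
def Kr : Set K :=
  {x | ∃ f g : R, g ≠ 0 ∧ x = algebraMap R K f / algebraMap R K g ∧ ∃ h : R, h ≠ 0 ∧
    IsLocalization.coeSubmodule K (contentIdeal 𝒜 f * contentIdeal 𝒜 h) ≤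
      wOp (IsLocalization.coeSubmodule K (contentIdeal 𝒜 g * contentIdeal 𝒜 h))}

section Nagata

variable [IsAddTorsionFree Γ]

/-- The multiplicative set `N_v(H) = {f ∈ R | C(f)^v = R}` (with `f ≠ 0`). -/
def nagataSubmonoid : Submonoid R where
  carrier := {f | f ≠ 0 ∧ vOp (IsLocalization.coeSubmodule K (contentIdeal 𝒜 f)) = 1}
  one_mem' := by
    refine ⟨one_ne_zero, ?_⟩
    have : contentIdeal 𝒜 (1 : R) = ⊤ := by
      rw [Ideal.eq_top_iff_one]
      exact Ideal.subset_span ⟨0, DirectSum.decompose_of_mem_same 𝒜 SetLike.GradedOne.one_mem⟩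
    rw [this, IsLocalization.coeSubmodule_top, vOp, one_div_one, one_div_one]
  mul_mem' := by
    rintro f g ⟨hf0, hf⟩ ⟨hg0, hg⟩
    refine ⟨mul_ne_zero hf0 hg0, ?_⟩
    rw [vOp_eq_one_iff] at hf hg ⊢
    have hrad : contentIdeal 𝒜 f * contentIdeal 𝒜 g ≤ (contentIdeal 𝒜 (f * g)).radical := by
      rw [Ideal.radical_eq_sInf]
      refine le_sInf fun P hP => ?_
      have := hP.2
      rcases contentIdeal_le_or_le_of_mul_le 𝒜 hP.1 with h | h
      · exact Ideal.mul_le_left.trans h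
      · exact Ideal.mul_le_right.trans h
    obtain ⟨n, hn⟩ := Ideal.exists_pow_le_of_le_radical_of_fg hrad
      ((contentIdeal_fg 𝒜 f).mul (contentIdeal_fg 𝒜 g))
    have hpow : ∀ m : ℕ, (1 : Submodule R K) / IsLocalization.coeSubmodule K
        ((contentIdeal 𝒜 f * contentIdeal 𝒜 g) ^ m) = 1 := by
      intro m
      induction m with
      | zero => rw [pow_zero, Ideal.one_eq_top, IsLocalization.coeSubmodule_top, one_div_one]
      | succ m ih =>
        rw [pow_succ, IsLocalization.coeSubmodule_mul, IsLocalization.coeSubmodule_mul]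
        exact one_div_mul_eq_one ih (one_div_mul_eq_one hf hg)
    apply le_antisymm
    · exact (one_div_anti (IsLocalization.coeSubmodule_mono K hn)).trans (hpow n).le
    · have := one_div_anti (IsLocalization.coeSubmodule_mono K
        (le_top : contentIdeal 𝒜 (f * g) ≤ ⊤))
      rwa [IsLocalization.coeSubmodule_top, one_div_one] at this

/-- The ring of fractions `R_{N_v(H)}`, inside `K`. -/
def nagataRing : Subalgebra R K :=
  Localization.subalgebra.ofField K (nagataSubmonoid 𝒜 K)
    (fun _ h => mem_nonZeroDivisors_of_ne_zero h.1)

end Nagata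

end Graded
end GradedDomain

namespace GradedDomain

set_option linter.unusedSectionVars false

/-! ### Glaz–Vasconcelos submodules, the `w`-operation and `t`-invertibility over a domain. -/

section Star

variable {D K : Type*} [CommRing D] [Field K] [Algebra D K]

/-! The common currency is the Glaz–Vasconcelos (GV) ideal: a finitely generated F with F⁻¹ = R.
Such ideals are closed under products, they are the denominators of the `w`-operation, and a nonzero
finitely generated I satisfies (I I⁻¹)^t = R exactly when I I⁻¹ contains one of them.

The grading enters through a weak Dedekind–Mertens lemma: C(x) C(f)^m ⊆ C(xf) for some m
(`exists_contentIdeal_mul_pow_le`). The unit u of nonzero degree plays the role of an indeterminate: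
C(f + u^k g) = C(f) + C(g) for all large k, so every finitely generated homogeneous ideal is a
content. Together they show that the members of h-QMax^t(R) are prime: an element outside P can be
moved by P into the multiplicative set N_v(H), which misses P.

The hub of the equivalence is the graded P`v`MD property. If C(y) is `t`-invertible, the radical of
(C(xy) : C(x) C(y)) contains C(y) C(y)⁻¹, hence a GV ideal, and contents become multiplicative up to
`w` (`IsGradedPvMD.fracContent_mul_le`). So f/g lies in R_{N_v(H)} as soon as C(f) ⊆ C(g)^w.
Divisibility in this ring is thus read off contents, which yields the extended ideals, the Bézout
property, the valuation rings R_P and the equality with Kr(R, w).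

For the way back it suffices to invert ideals with two homogeneous generators, because
(A+B+C)(AB+BC+CA) = (A+B)(B+C)(C+A). An ideal that becomes invertible in a ring of fractions R_S has
S meeting I I⁻¹, which settles the Prüfer, valuation and graded Prüfer conditions. The content
formula and I^w = I^{w_a} both give xy ∈ (x², y²)^w and the needed integral closedness, which make
(x, y) `t`-invertible (`isTInvertible_pair`). Integrally closed overrings are used for R_{H∖P} and
R_{H∖P}[(y/x)²]. Flatness of Kr(R, w) is exploited by the equational criterion followed by the
determinant trick.

The passage from graded P`v`MD to P`v`MD (`IsGradedPvMD.isPvMD`) uses that R_H is, up to homogeneous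
units, built from polynomial rings over a field. Finitely many of its elements therefore have a gcd;
dividing by it makes an arbitrary finitely generated ideal comparable with the homogeneous ideal of
its contents. -/

theorem mem_one_div {E : Submodule D K} {x : K} :
    x ∈ 1 / E ↔ ∀ y ∈ E, x * y ∈ (1 : Submodule D K) :=
  Submodule.mem_div_iff_forall_mul_mem

theorem mul_one_div_le_one (I : Submodule D K) : I * (1 / I) ≤ 1 := by
  rw [Submodule.mul_le]
  intro x hx y hy
  rw [mul_comm]
  exact mem_one_div.1 hy x hx

theorem le_one_div_iff {I J : Submodule D K} : J ≤ 1 / I ↔ I * J ≤ 1 := by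
  rw [Submodule.le_div_iff_mul_le, mul_comm]

/-- A Glaz–Vasconcelos submodule: nonzero, finitely generated and with trivial inverse. -/
def IsGV (F : Submodule D K) : Prop := F.FG ∧ F ≠ ⊥ ∧ 1 / F = 1

theorem le_one_of_one_div {F : Submodule D K} (h : 1 / F = 1) : F ≤ 1 :=
  (le_vOp F).trans (vOp_eq_one_iff.2 h).le

theorem IsGV.le_one {F : Submodule D K} (h : IsGV F) : F ≤ 1 := le_one_of_one_div h.2.2

theorem mul_ne_bot {E F : Submodule D K} (hE : E ≠ ⊥) (hF : F ≠ ⊥) : E * F ≠ ⊥ := by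
  obtain ⟨x, hx, hx0⟩ := Submodule.exists_mem_ne_zero_of_ne_bot hE
  obtain ⟨y, hy, hy0⟩ := Submodule.exists_mem_ne_zero_of_ne_bot hF
  intro h
  have := Submodule.mul_mem_mul hx hy
  rw [h, Submodule.mem_bot] at this
  exact mul_ne_zero hx0 hy0 this

theorem one_ne_bot : (1 : Submodule D K) ≠ ⊥ := by
  intro h
  have : (1 : K) ∈ (1 : Submodule D K) := Submodule.one_le.1 le_rfl
  rw [h, Submodule.mem_bot] at this
  exact one_ne_zero this

theorem isGV_one : IsGV (1 : Submodule D K) :=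
  ⟨by rw [Submodule.one_eq_span]; exact Submodule.fg_span_singleton _, one_ne_bot, one_div_one⟩

theorem IsGV.mul {E F : Submodule D K} (hE : IsGV E) (hF : IsGV F) : IsGV (E * F) :=
  ⟨hE.1.mul hF.1, mul_ne_bot hE.2.1 hF.2.1, one_div_mul_eq_one hE.2.2 hF.2.2⟩

theorem IsGV.pow {E : Submodule D K} (hE : IsGV E) (n : ℕ) : IsGV (E ^ n) := by
  induction n with
  | zero => rw [pow_zero]; exact isGV_one
  | succ n ih => rw [pow_succ]; exact ih.mul hE

theorem one_div_eq_one_mono {E F : Submodule D K} (hE : 1 / E = 1) (h : E ≤ F) (hF : F ≤ 1) :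
    1 / F = 1 :=
  le_antisymm ((one_div_anti h).trans hE.le) (by simpa [one_div_one] using one_div_anti hF)

theorem IsGV.mono {E F : Submodule D K} (hE : IsGV E) (h : E ≤ F) (hF : F ≤ 1) (hfg : F.FG) :
    IsGV F :=
  ⟨hfg, fun h0 => hE.2.1 (le_bot_iff.1 (h0 ▸ h)), one_div_eq_one_mono hE.2.2 h hF⟩

theorem IsGV.mem_one {F : Submodule D K} (hF : IsGV F) {x : K}
    (h : ∀ j ∈ F, x * j ∈ (1 : Submodule D K)) : x ∈ (1 : Submodule D K) := by
  rw [← hF.2.2, mem_one_div]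
  exact h

theorem IsGV.le_one_of_mul_le {E F : Submodule D K} (hF : IsGV F) (h : E * F ≤ 1) : E ≤ 1 :=
  fun _ hx => hF.mem_one fun _ hj => h (Submodule.mul_mem_mul hx hj)

/-- The witness of 1 ∈ E^t may be zero, since ⊥^v = K when D = K; adjoining a nonzero element of E
turns it into a GV submodule without leaving E. -/
theorem tOp_eq_one_iff {E : Submodule D K} (hE : E ≠ ⊥) (h1 : E ≤ 1) :
    tOp E = 1 ↔ ∃ F : Submodule D K, IsGV F ∧ F ≤ E := by
  constructor
  · intro h
    have h1' : (1 : K) ∈ tOp E := by rw [h]; exact Submodule.one_le.1 le_rfl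
    obtain ⟨F, hF, hFE, hF1⟩ := mem_tOp_iff.1 h1'
    obtain ⟨x, hx, hx0⟩ := Submodule.exists_mem_ne_zero_of_ne_bot hE
    have hle : F ⊔ Submodule.span D {x} ≤ E :=
      sup_le hFE ((Submodule.span_singleton_le_iff_mem _ _).2 hx)
    refine ⟨F ⊔ Submodule.span D {x}, ⟨hF.sup (Submodule.fg_span_singleton _), ?_, ?_⟩, hle⟩
    · intro h0
      have : x ∈ F ⊔ Submodule.span D {x} :=
        Submodule.mem_sup_right (Submodule.mem_span_singleton_self x)
      rw [h0] at this
      exact hx0 (by simpa using this)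
    · refine one_div_eq_one_mono (le_antisymm ?_ ?_) le_sup_left (hle.trans h1)
      · intro y hy
        rw [vOp, mem_one_div] at hF1
        simpa using hF1 y hy
      · simpa [one_div_one] using one_div_anti (hFE.trans h1)
  · rintro ⟨F, hF, hFE⟩
    apply le_antisymm
    · intro x hx
      obtain ⟨G, -, hG, hx⟩ := mem_tOp_iff.1 hx
      have := vOp_mono (hG.trans h1) hx
      rwa [vOp, one_div_one, one_div_one] at this
    · intro x hx
      refine mem_tOp_iff.2 ⟨F, hF.1, hFE, ?_⟩
      rwa [vOp_eq_one_iff.2 hF.2.2]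

theorem coeSubmodule_comap {F : Submodule D K} (h : F ≤ 1) :
    IsLocalization.coeSubmodule K (F.comap (Algebra.linearMap D K) : Ideal D) = F := by
  apply le_antisymm
  · rintro _ ⟨x, hx, rfl⟩
    exact hx
  · intro x hx
    obtain ⟨d, rfl⟩ := Submodule.mem_one.1 (h hx)
    exact ⟨d, hx, rfl⟩

theorem coeSubmodule_le_one (I : Ideal D) : IsLocalization.coeSubmodule K I ≤ 1 := by
  rintro _ ⟨x, -, rfl⟩
  exact Submodule.mem_one.2 ⟨x, rfl⟩

theorem coeSubmodule_fg {I : Ideal D} (h : I.FG) : (IsLocalization.coeSubmodule K I).FG :=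
  Submodule.FG.map _ h

section Fraction

variable [IsFractionRing D K]

theorem comap_fg {F : Submodule D K} (h : F ≤ 1) (hF : F.FG) :
    (F.comap (Algebra.linearMap D K) : Ideal D).FG := by
  refine Submodule.fg_of_fg_map_injective (Algebra.linearMap D K)
    (IsFractionRing.injective D K) ?_
  have := coeSubmodule_comap h
  rw [IsLocalization.coeSubmodule] at this
  rwa [this]

theorem coeSubmodule_eq_bot {I : Ideal D} : IsLocalization.coeSubmodule K I = ⊥ ↔ I = ⊥ := by
  constructor
  · intro h
    rw [eq_bot_iff]
    intro x hx
    have : algebraMap D K x ∈ IsLocalization.coeSubmodule K I := ⟨x, hx, rfl⟩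
    rw [h] at this
    simpa using this
  · rintro rfl
    exact IsLocalization.coeSubmodule_bot K

variable [IsDomain D]

theorem mem_wOp_iff {E : Submodule D K} {x : K} :
    x ∈ wOp E ↔ ∃ F : Submodule D K, IsGV F ∧ ∀ j ∈ F, x * j ∈ E := by
  constructor
  · rintro ⟨J, hJ0, hJ, hJ1, h⟩
    refine ⟨IsLocalization.coeSubmodule K J, ⟨coeSubmodule_fg hJ,
      mt (coeSubmodule_eq_bot (K := K)).1 hJ0, vOp_eq_one_iff.1 hJ1⟩, fun y hy => ?_⟩
    obtain ⟨j, hj, rfl⟩ := hy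
    rw [mul_comm]
    simpa [Algebra.smul_def] using h j hj
  · rintro ⟨F, hF, h⟩
    refine ⟨F.comap (Algebra.linearMap D K), fun h0 => hF.2.1 ?_, comap_fg hF.le_one hF.1, ?_, ?_⟩
    · rw [← coeSubmodule_comap hF.le_one, h0, IsLocalization.coeSubmodule_bot]
    · rw [coeSubmodule_comap hF.le_one, vOp_eq_one_iff, hF.2.2]
    · intro j hj
      rw [Algebra.smul_def, mul_comm]
      exact h _ hj

theorem wOp_mono {E F : Submodule D K} (h : E ≤ F) : wOp E ≤ wOp F := by
  intro x hx
  obtain ⟨J, hJ, hx⟩ := mem_wOp_iff.1 hx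
  exact mem_wOp_iff.2 ⟨J, hJ, fun j hj => h (hx j hj)⟩

theorem le_wOp (E : Submodule D K) : E ≤ wOp E := by
  intro x hx
  refine mem_wOp_iff.2 ⟨1, isGV_one, fun j hj => ?_⟩
  simpa using Submodule.mul_mem_mul hx hj

theorem le_wOp_of_mul_le {E M J : Submodule D K} (hJ : IsGV J) (h : M * J ≤ E) : M ≤ wOp E :=
  fun _ hx => mem_wOp_iff.2 ⟨J, hJ, fun _ hj => h (Submodule.mul_mem_mul hx hj)⟩

/-- Finitely many GV denominators can be multiplied into a common one, because each of them lies in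
D. Idempotence of `wOp` follows. -/
theorem exists_isGV_mul_le {E M : Submodule D K} (hM : M.FG) (h : M ≤ wOp E) :
    ∃ J : Submodule D K, IsGV J ∧ M * J ≤ E := by
  induction M, hM using Submodule.fg_induction with
  | singleton x =>
    obtain ⟨J, hJ, hx⟩ := mem_wOp_iff.1 (h (Submodule.mem_span_singleton_self x))
    refine ⟨J, hJ, ?_⟩
    rw [Submodule.mul_le]
    intro m hm n hn
    obtain ⟨c, rfl⟩ := Submodule.mem_span_singleton.1 hm
    rw [smul_mul_assoc]
    exact E.smul_mem c (hx n hn)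
  | sup M₁ M₂ _ _ h₁ h₂ =>
    obtain ⟨J₁, hJ₁, h₁⟩ := h₁ (le_sup_left.trans h)
    obtain ⟨J₂, hJ₂, h₂⟩ := h₂ (le_sup_right.trans h)
    refine ⟨J₁ * J₂, hJ₁.mul hJ₂, ?_⟩
    rw [Submodule.sup_mul]
    refine sup_le ?_ ?_
    · calc M₁ * (J₁ * J₂) ≤ M₁ * (J₁ * 1) := by gcongr; exact hJ₂.le_one
        _ ≤ E := by rwa [mul_one]
    · calc M₂ * (J₁ * J₂) ≤ M₂ * (1 * J₂) := by gcongr; exact hJ₁.le_one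
        _ ≤ E := by rwa [one_mul]

theorem wOp_wOp (E : Submodule D K) : wOp (wOp E) = wOp E := by
  refine le_antisymm (fun x hx => ?_) (le_wOp _)
  obtain ⟨J, hJ, hx⟩ := mem_wOp_iff.1 hx
  have h : Submodule.span D {x} * J ≤ wOp E := by
    rw [Submodule.mul_le]
    intro m hm n hn
    obtain ⟨c, rfl⟩ := Submodule.mem_span_singleton.1 hm
    rw [smul_mul_assoc]
    exact (wOp E).smul_mem c (hx n hn)
  obtain ⟨J', hJ', h'⟩ := exists_isGV_mul_le ((Submodule.fg_span_singleton x).mul hJ.1) h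
  rw [mul_assoc] at h'
  exact le_wOp_of_mul_le (hJ.mul hJ') h' (Submodule.mem_span_singleton_self x)

theorem wOp_le_wOp_iff {E F : Submodule D K} : wOp E ≤ wOp F ↔ E ≤ wOp F :=
  ⟨(le_wOp E).trans, fun h => (wOp_mono h).trans (wOp_wOp F).le⟩

theorem mul_wOp_le (E F : Submodule D K) : E * wOp F ≤ wOp (E * F) := by
  rw [Submodule.mul_le]
  intro x hx y hy
  obtain ⟨J, hJ, hy⟩ := mem_wOp_iff.1 hy
  refine mem_wOp_iff.2 ⟨J, hJ, fun j hj => ?_⟩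
  rw [mul_assoc]
  exact Submodule.mul_mem_mul hx (hy j hj)

theorem wOp_one : wOp (1 : Submodule D K) = 1 := by
  refine le_antisymm (fun x hx => ?_) (le_wOp _)
  obtain ⟨J, hJ, hx⟩ := mem_wOp_iff.1 hx
  exact hJ.mem_one hx

end Fraction

/-- `I` is `t`-invertible: `I I⁻¹` contains a Glaz–Vasconcelos submodule. -/
def IsTInvertible (I : Submodule D K) : Prop := ∃ F, IsGV F ∧ F ≤ I * (1 / I)

theorem IsTInvertible.ne_bot {I : Submodule D K} (h : IsTInvertible I) : I ≠ ⊥ := by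
  rintro rfl
  obtain ⟨F, hF, h⟩ := h
  rw [Submodule.bot_mul, le_bot_iff] at h
  exact hF.2.1 h

theorem isTInvertible_of_le_mul {I J F : Submodule D K} (hF : IsGV F) (h : F ≤ I * J)
    (h1 : I * J ≤ 1) : IsTInvertible I :=
  ⟨F, hF, h.trans (mul_le_mul' le_rfl (le_one_div_iff.2 h1))⟩

/-- J (IJ)⁻¹ serves as the inverse of I. With J principal, this removes a denominator that was
cleared. -/
theorem IsTInvertible.of_mul {I J : Submodule D K} (h : IsTInvertible (I * J)) :
    IsTInvertible I := by
  obtain ⟨F, hF, h⟩ := h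
  have := mul_one_div_le_one (I * J)
  rw [mul_assoc] at h this
  exact isTInvertible_of_le_mul hF h this

theorem IsTInvertible.mul {I J : Submodule D K} (hI : IsTInvertible I) (hJ : IsTInvertible J) :
    IsTInvertible (I * J) := by
  obtain ⟨F, hF, hFI⟩ := hI
  obtain ⟨G, hG, hGJ⟩ := hJ
  have e : I * J * (1 / I * (1 / J)) = I * (1 / I) * (J * (1 / J)) := by ring
  refine isTInvertible_of_le_mul (J := 1 / I * (1 / J)) (hF.mul hG) ?_ ?_
  · rw [e]
    exact mul_le_mul' hFI hGJ
  · rw [e]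
    exact (mul_le_mul' (mul_one_div_le_one I) (mul_one_div_le_one J)).trans (mul_one 1).le

/-- By the identity (A+B+C)(AB+BC+AC) = (A+B)(B+C)(A+C), valid since addition of submodules is
idempotent, A+B+C is a factor of a `t`-invertible module. -/
theorem IsTInvertible.sup_sup {A B C : Submodule D K} (h₁ : IsTInvertible (A ⊔ B))
    (h₂ : IsTInvertible (B ⊔ C)) (h₃ : IsTInvertible (A ⊔ C)) : IsTInvertible (A ⊔ B ⊔ C) := by
  have e : (A ⊔ B ⊔ C) * (A * B + B * C + A * C) = (A ⊔ B) * (B ⊔ C) * (A ⊔ C) := by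
    simp only [← Submodule.add_eq_sup]
    have idem : A * B * C + A * B * C = A * B * C := by simp
    calc (A + B + C) * (A * B + B * C + A * C)
        = A * A * B + A * A * C + A * B * B + B * B * C + A * C * C + B * C * C
          + (A * B * C + A * B * C) + A * B * C := by ring
      _ = A * A * B + A * A * C + A * B * B + B * B * C + A * C * C + B * C * C
          + (A * B * C + A * B * C) := by rw [idem, add_assoc _ (A * B * C), idem]
      _ = _ := by ring
  have := (h₁.mul h₂).mul h₃
  rw [← e] at this
  exact this.of_mul

/-- If the submodules generated by two elements of a set are `t`-invertible, then so are those
generated by finitely many elements of the set. -/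
theorem isTInvertible_span_finset {S : Set K}
    (h : ∀ a ∈ S, ∀ b ∈ S, IsTInvertible (Submodule.span D {a, b})) (s : Finset K)
    (hs : s.Nonempty) (hsS : (s : Set K) ⊆ S) :
    IsTInvertible (Submodule.span D (s : Set K)) := by
  classical
  induction s using Finset.strongInduction with
  | H s ih =>
    obtain ⟨a, ha⟩ := hs
    by_cases h1 : (s.erase a).Nonempty
    · obtain ⟨b, hb⟩ := h1
      by_cases h2 : ((s.erase a).erase b).Nonempty
      · have key : ∀ t : Finset K, t ⊂ s → t.Nonempty →
            IsTInvertible (Submodule.span D (t : Set K)) := fun t ht hne =>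
          ih t ht hne (subset_trans (by exact_mod_cast ht.1) hsS)
        have hab := Finset.ne_of_mem_erase hb
        have hbs := Finset.mem_of_mem_erase hb
        have e₁ : insert a ((s.erase a).erase b) = s.erase b := by
          ext x
          simp only [Finset.mem_insert, Finset.mem_erase]
          grind
        have e₂ : insert b ((s.erase a).erase b) = s.erase a := Finset.insert_erase hb
        -- Take A = (a), C = (b) and B generated by the remaining elements: A + B and B + C have
        -- fewer generators, and A + C has two.
        have := IsTInvertible.sup_sup (A := Submodule.span D {a})
          (B := Submodule.span D (((s.erase a).erase b : Finset K) : Set K))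
          (C := Submodule.span D {b}) ?_ ?_ ?_
        · rw [← Submodule.span_union, ← Submodule.span_union] at this
          convert this using 2
          ext x
          simp only [Finset.coe_erase, Set.mem_union, Set.mem_sdiff, Finset.mem_coe,
            Set.mem_singleton_iff]
          grind
        · rw [← Submodule.span_union, Set.singleton_union, ← Finset.coe_insert, e₁]
          exact key _ (Finset.erase_ssubset hbs) ⟨a, Finset.mem_erase.2 ⟨hab.symm, ha⟩⟩
        · rw [sup_comm, ← Submodule.span_union, Set.singleton_union, ← Finset.coe_insert, e₂]
          exact key _ (Finset.erase_ssubset ha) ⟨b, hb⟩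
        · rw [← Submodule.span_union, Set.singleton_union]
          exact h a (hsS ha) b (hsS hbs)
      · rw [Finset.not_nonempty_iff_eq_empty] at h2
        have : (s : Set K) = {a, b} := by
          rw [← Finset.insert_erase ha, ← Finset.insert_erase hb, h2]
          simp
        rw [this]
        exact h a (hsS ha) b (hsS (Finset.mem_of_mem_erase hb))
    · rw [Finset.not_nonempty_iff_eq_empty] at h1
      have : (s : Set K) = {a, a} := by
        rw [← Finset.insert_erase ha, h1]
        simp
      rw [this]
      exact h a (hsS ha) a (hsS ha)

section Fraction

variable [IsDomain D] [IsFractionRing D K]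

theorem exists_smul_le_one {I : Submodule D K} (hI : I.FG) :
    ∃ d : D, d ≠ 0 ∧ ∀ x ∈ I, algebraMap D K d * x ∈ (1 : Submodule D K) := by
  induction I, hI using Submodule.fg_induction with
  | singleton x =>
    obtain ⟨a, b, hb, rfl⟩ := IsFractionRing.div_surjective D x
    have hb0 : algebraMap D K b ≠ 0 := by simpa using nonZeroDivisors.ne_zero hb
    refine ⟨b, nonZeroDivisors.ne_zero hb, fun y hy => ?_⟩
    obtain ⟨c, rfl⟩ := Submodule.mem_span_singleton.1 hy
    refine Submodule.mem_one.2 ⟨c * a, ?_⟩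
    rw [Algebra.smul_def, map_mul]
    field_simp
  | sup M N _ _ hM hN =>
    obtain ⟨d, hd, hM⟩ := hM
    obtain ⟨e, he, hN⟩ := hN
    refine ⟨d * e, mul_ne_zero hd he, fun x hx => ?_⟩
    obtain ⟨m, hm, n, hn, rfl⟩ := Submodule.mem_sup.1 hx
    have : algebraMap D K (d * e) * (m + n) =
        e • (algebraMap D K d * m) + d • (algebraMap D K e * n) := by
      rw [Algebra.smul_def, Algebra.smul_def, map_mul]
      ring
    rw [this]
    exact Submodule.add_mem _ (Submodule.smul_mem _ _ (hM m hm)) (Submodule.smul_mem _ _ (hN n hn))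

theorem one_div_ne_bot {I : Submodule D K} (hI : I.FG) : 1 / I ≠ ⊥ := by
  obtain ⟨d, hd, h⟩ := exists_smul_le_one hI
  intro h0
  have : algebraMap D K d ∈ 1 / I := mem_one_div.2 h
  rw [h0] at this
  exact hd (by simpa using this)

theorem tOp_mul_one_div_eq_one_iff {I : Submodule D K} (hI : I.FG) (h0 : I ≠ ⊥) :
    tOp (I * (1 / I)) = 1 ↔ IsTInvertible I :=
  tOp_eq_one_iff (mul_ne_bot h0 (one_div_ne_bot hI)) (mul_one_div_le_one I)

theorem isPvMD_iff : IsPvMD D K ↔ ∀ I : Submodule D K, I.FG → I ≠ ⊥ → IsTInvertible I :=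
  forall₃_congr fun _ hI h0 => tOp_mul_one_div_eq_one_iff hI h0

/-- Cancellation of a `t`-invertible submodule modulo the `w`-operation. -/
theorem IsTInvertible.le_wOp_of_mul_le {E F I : Submodule D K} (hI : IsTInvertible I)
    (h : E * I ≤ wOp (F * I)) : E ≤ wOp F := by
  obtain ⟨J, hJ, hJI⟩ := hI
  have h1 : E * J ≤ wOp F := by
    calc E * J ≤ E * (I * (1 / I)) := by gcongr
      _ = (1 / I) * (E * I) := by ring
      _ ≤ (1 / I) * wOp (F * I) := by gcongr
      _ ≤ wOp ((1 / I) * (F * I)) := mul_wOp_le _ _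
      _ = wOp (F * (I * (1 / I))) := by congr 1; ring
      _ ≤ wOp (F * 1) := wOp_mono (by gcongr; exact mul_one_div_le_one I)
      _ = wOp F := by rw [mul_one]
  rw [← wOp_wOp F]
  exact GradedDomain.le_wOp_of_mul_le hJ h1

/-- For x integral, I = D[x] is finitely generated with xI ⊆ I, so x carries I I⁻¹, and with it a GV
submodule, into D. -/
theorem IsPvMD.isIntegrallyClosed (h : IsPvMD D K) : IsIntegrallyClosed D := by
  rw [isIntegrallyClosed_iff K]
  intro x hx
  have hfg := hx.fg_adjoin_singleton
  have h0 : (Algebra.adjoin D {x}).toSubmodule ≠ ⊥ := by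
    intro h0
    have : (1 : K) ∈ (Algebra.adjoin D {x}).toSubmodule := one_mem (Algebra.adjoin D {x})
    rw [h0] at this
    exact one_ne_zero ((Submodule.mem_bot D).1 this)
  set I := (Algebra.adjoin D {x}).toSubmodule
  obtain ⟨F, hF, hFI⟩ := isPvMD_iff.1 h I hfg h0
  have hxI : Submodule.span D {x} * I ≤ I := by
    rw [Submodule.mul_le]
    intro m hm n hn
    refine mul_mem (S := Subalgebra D K) (s := Algebra.adjoin D {x}) ?_ hn
    exact (Submodule.span_singleton_le_iff_mem x I).2
      (Algebra.subset_adjoin (Set.mem_singleton x)) hm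
  have h1 : Submodule.span D {x} * F ≤ 1 := by
    calc Submodule.span D {x} * F ≤ Submodule.span D {x} * (I * (1 / I)) := by gcongr
      _ = (Submodule.span D {x} * I) * (1 / I) := by ring
      _ ≤ I * (1 / I) := by gcongr
      _ ≤ 1 := mul_one_div_le_one I
  exact Submodule.mem_one.1 (hF.le_one_of_mul_le h1 (Submodule.mem_span_singleton_self x))

end Fraction

end Star

/-- The submonoid generated by S is finitely generated, cancellative and torsion-free, so it embeds
in some ℤⁿ, which is ordered lexicographically. This supplies leading components for the
Dedekind–Mertens argument. The value 0 outside the submonoid is irrelevant. -/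
theorem exists_orderedEmbedding {Γ : Type*} [AddCancelCommMonoid Γ] [IsAddTorsionFree Γ] (S : Finset Γ) :
    ∃ (n : ℕ) (w : Γ → Lex (Fin n →₀ ℤ)), Set.InjOn w S ∧
      ∀ a ∈ S, ∀ b ∈ S, ∀ c ∈ S, ∀ d ∈ S, a + b = c + d → w a + w b = w c + w d := by
  classical
  let M : AddSubmonoid Γ := AddSubmonoid.closure (S : Set Γ)
  have : AddMonoid.FG M := (AddMonoid.fg_iff_addSubmonoid_fg M).2 ⟨S, rfl⟩
  have : IsAddTorsionFree M := ⟨fun n hn x y h => Subtype.ext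
    (IsAddTorsionFree.nsmul_right_injective hn (congrArg Subtype.val h))⟩
  have hM : ∀ a ∈ S, a ∈ M := fun a ha => AddSubmonoid.subset_closure ha
  let _ : AddCancelCommMonoid M :=
    { (inferInstance : AddCommMonoid M) with
      add_left_cancel := fun x y z h => Subtype.ext (add_left_cancel (congrArg Subtype.val h)) }
  let φ : M →+ (Fin (AffineAddMonoid.dim M) →₀ ℤ) :=
    (FreeAbelianGroup.equivFinsupp _).toAddMonoidHom.comp (AffineAddMonoid.embedding M)
  have hφ : Function.Injective φ :=
    (FreeAbelianGroup.equivFinsupp _).injective.comp AffineAddMonoid.embedding_injective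
  refine ⟨_, fun a => if h : a ∈ M then toLex (φ ⟨a, h⟩) else 0, ?_, ?_⟩
  · intro a ha b hb h
    simp only [dif_pos (hM a ha), dif_pos (hM b hb)] at h
    exact congrArg Subtype.val (hφ (toLex.injective h))
  · intro a ha b hb c hc d hd h
    simp only [dif_pos (hM a ha), dif_pos (hM b hb), dif_pos (hM c hc), dif_pos (hM d hd)]
    rw [← toLex_add, ← toLex_add, ← map_add, ← map_add]
    congr 2
    exact Subtype.ext h

/-! ### The Dedekind–Mertens lemma for graded rings, and contents of sums. -/

section DedekindMertens

variable {Γ R : Type*} [AddCancelCommMonoid Γ] [DecidableEq Γ] [CommRing R]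
  (𝒜 : Γ → AddSubgroup R) [GradedRing 𝒜]

/-- By uniqueness of the degree, the term at (i₀, j₀) is a whole homogeneous component of the
product, so it lies in the homogeneous ideal E. -/
theorem mul_mem_of_sum_mul_sum_mem {ι κ : Type*} {x : ι → R} {d : ι → Γ} {f : κ → R} {e : κ → Γ}
    (hx : ∀ i, x i ∈ 𝒜 (d i)) (hf : ∀ j, f j ∈ 𝒜 (e j)) {A : Finset ι} {B : Finset κ}
    {E : Ideal R} (hE : E.IsHomogeneous 𝒜) (h : (∑ i ∈ A, x i) * ∑ j ∈ B, f j ∈ E)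
    {i₀ : ι} (hi₀ : i₀ ∈ A) {j₀ : κ} (hj₀ : j₀ ∈ B)
    (huniq : ∀ i ∈ A, ∀ j ∈ B, d i + e j = d i₀ + e j₀ → i = i₀ ∧ j = j₀) :
    x i₀ * f j₀ ∈ E := by
  classical
  have h1 := hE (d i₀ + e j₀) h
  have h2 : (DirectSum.decompose 𝒜 ((∑ i ∈ A, x i) * ∑ j ∈ B, f j) (d i₀ + e j₀) : R) =
      x i₀ * f j₀ := by
    rw [← GradedRing.proj_apply, Finset.sum_mul_sum, ← Finset.sum_product', map_sum,
      Finset.sum_eq_single (i₀, j₀)]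
    · rw [GradedRing.proj_apply]
      exact DirectSum.decompose_of_mem_same 𝒜 (SetLike.mul_mem_graded (hx i₀) (hf j₀))
    · rintro ⟨i, j⟩ hij hne
      rw [Finset.mem_product] at hij
      rw [GradedRing.proj_apply]
      refine DirectSum.decompose_of_mem_ne 𝒜 (SetLike.mul_mem_graded (hx i) (hf j)) fun heq => ?_
      obtain ⟨h1, h2⟩ := huniq i hij.1 j hij.2 heq
      exact hne (Prod.ext h1 h2)
    · intro hnot
      exact absurd (Finset.mem_product.2 ⟨hi₀, hj₀⟩) hnot
  rwa [h2] at h1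

variable {ι κ L : Type*} [AddCommGroup L] [LinearOrder L] [IsOrderedAddMonoid L]

/-- The product of the two leading terms, x_{i₀} f_t, lies in E. Subtracting it, f_t (x − x_{i₀})
again multiplies f into E and has one term fewer; each round costs one factor f_t. -/
theorem pow_card_mul_mem_of_max {f : κ → R} {e : κ → Γ} (hf : ∀ j, f j ∈ 𝒜 (e j)) {B : Finset κ}
    {w : ι → L} {v : κ → L} (hv : Set.InjOn v B) {t : κ} (ht : t ∈ B) (htop : ∀ j ∈ B, v j ≤ v t)
    {E : Ideal R} (hE : E.IsHomogeneous 𝒜) (A : Finset ι) :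
    ∀ (x : ι → R) (d : ι → Γ), (∀ i, x i ∈ 𝒜 (d i)) → Set.InjOn w A →
      (∀ i ∈ A, ∀ i' ∈ A, ∀ j ∈ B, ∀ j' ∈ B, d i + e j = d i' + e j' → w i + v j = w i' + v j') →
      (∑ i ∈ A, x i) * ∑ j ∈ B, f j ∈ E → ∀ i ∈ A, f t ^ A.card * x i ∈ E := by
  classical
  induction A using Finset.induction_on_max_value w with
  | empty => simp
  | insert i₀ A hi₀ hmax ih =>
    intro x d hx hw hcompat h
    have h0 : x i₀ * f t ∈ E := by
      refine mul_mem_of_sum_mul_sum_mem 𝒜 hx hf hE h (Finset.mem_insert_self _ _) ht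
        fun i hi j hj hij => ?_
      have h1 := hcompat i hi i₀ (Finset.mem_insert_self _ _) j hj t ht hij
      have h2 : w i ≤ w i₀ := by
        rcases Finset.mem_insert.1 hi with rfl | hi
        · exact le_rfl
        · exact hmax i hi
      have h3 := htop j hj
      have h4 : w i = w i₀ := by
        apply le_antisymm h2
        by_contra hlt
        exact absurd h1 (add_lt_add_of_lt_of_le (not_le.1 hlt) h3).ne
      have h5 : v j = v t := by rwa [h4, add_right_inj] at h1
      exact ⟨hw hi (Finset.mem_insert_self _ _) h4, hv hj ht h5⟩
    have h1 := ih (fun i => f t * x i) (fun i => e t + d i)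
      (fun i => SetLike.mul_mem_graded (hf t) (hx i))
      (hw.mono (Finset.coe_subset.2 (Finset.subset_insert _ _))) ?_ ?_
    · intro i hi
      rw [Finset.card_insert_of_notMem hi₀, pow_succ]
      rcases Finset.mem_insert.1 hi with rfl | hi
      · rw [mul_assoc, mul_comm (f t)]
        exact E.mul_mem_left _ h0
      · rw [mul_assoc]
        exact h1 i hi
    · intro i hi i' hi' j hj j' hj' hij
      refine hcompat i (Finset.mem_insert_of_mem hi) i' (Finset.mem_insert_of_mem hi') j hj j' hj' ?_
      rw [add_assoc, add_assoc] at hij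
      exact add_left_cancel hij
    · have e : (∑ i ∈ A, f t * x i) * ∑ j ∈ B, f j =
          f t * ((∑ i ∈ insert i₀ A, x i) * ∑ j ∈ B, f j) - (x i₀ * f t) * ∑ j ∈ B, f j := by
        rw [Finset.sum_insert hi₀, ← Finset.mul_sum]
        ring
      rw [e]
      exact E.sub_mem (E.mul_mem_left _ h) (E.mul_mem_right _ h0)

/-- The exponent is uniform in x, its degrees and E once the number of terms of x is bounded by a.
The induction on B needs this, as it applies the hypothesis to many homogeneous multiples of x at
once. -/
theorem exists_pow_mul_mem {f : κ → R} {e : κ → Γ} (hf : ∀ j, f j ∈ 𝒜 (e j))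
    {w : ι → L} {v : κ → L} (a : ℕ) (B : Finset κ) : Set.InjOn v B →
    ∃ m : ℕ, ∀ (A : Finset ι), A.card ≤ a → Set.InjOn w A →
      ∀ (x : ι → R) (d : ι → Γ), (∀ i, x i ∈ 𝒜 (d i)) →
      (∀ i ∈ A, ∀ i' ∈ A, ∀ j ∈ B, ∀ j' ∈ B, d i + e j = d i' + e j' → w i + v j = w i' + v j') →
      ∀ E : Ideal R, E.IsHomogeneous 𝒜 → (∑ i ∈ A, x i) * ∑ j ∈ B, f j ∈ E →
      ∀ i ∈ A, ∀ r ∈ Ideal.span (f '' B) ^ m, x i * r ∈ E := by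
  classical
  induction B using Finset.induction_on_max_value v with
  | empty =>
    intro _
    refine ⟨1, fun A _ _ x d _ _ E _ _ i _ r hr => ?_⟩
    simp only [Finset.coe_empty, Set.image_empty, Ideal.span_empty, pow_one] at hr
    rw [Ideal.mem_bot.1 hr, mul_zero]
    exact E.zero_mem
  | insert t B ht hmax ih =>
    intro hv
    obtain ⟨m, hm⟩ := ih (hv.mono (Finset.coe_subset.2 (Finset.subset_insert _ _)))
    -- With C generated by the components other than f_t, the power (C + (f_t))^{ma+a} lies in
    -- C^{ma} + (f_t)^a, and each summand is shown to carry x_i into E.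
    refine ⟨m * a + a, fun A hA hw x d hx hcompat E hE h => ?_⟩
    set C := Ideal.span (f '' B) with hC
    have htop : ∀ j ∈ insert t B, v j ≤ v t := by
      intro j hj
      rcases Finset.mem_insert.1 hj with rfl | hj
      · exact le_rfl
      · exact hmax j hj
    have h1 : ∀ i ∈ A, f t ^ a * x i ∈ E := by
      intro i hi
      have := pow_card_mul_mem_of_max 𝒜 hf hv (Finset.mem_insert_self t B) htop hE A x d hx hw
        hcompat h i hi
      rw [← Nat.sub_add_cancel hA, pow_add, mul_assoc]
      exact E.mul_mem_left _ this
    have hChom : C.IsHomogeneous 𝒜 := by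
      apply Ideal.homogeneous_span
      rintro _ ⟨j, -, rfl⟩
      exact ⟨e j, hf j⟩
    have hpow : ∀ n, (C ^ n).IsHomogeneous 𝒜 := by
      intro n
      induction n with
      | zero => rw [pow_zero, Ideal.one_eq_top]; exact Ideal.IsHomogeneous.top 𝒜
      | succ n ih => rw [pow_succ]; exact ih.mul hChom
    -- Powers of f_t are traded for powers of C. For homogeneous c ∈ C^{mk}, the element f_t^{a-k-1}
    -- c x times f − f_t equals f_t^{a-k-1} c x f − f_t^{a-k} c x, which is in E by the previous
    -- stage; the induction on B then supplies a further factor C^m.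
    have h2 : ∀ k ≤ a, ∀ i ∈ A, ∀ r ∈ C ^ (m * k), f t ^ (a - k) * r * x i ∈ E := by
      intro k
      induction k with
      | zero =>
        intro _ i hi r _
        rw [Nat.sub_zero, mul_right_comm]
        exact E.mul_mem_right _ (h1 i hi)
      | succ k ihk =>
        intro hk i hi r hr
        have hsub : a - k = (a - (k + 1)) + 1 := by omega
        rw [mul_add, mul_one, pow_add] at hr
        refine Submodule.mul_induction_on hr (fun r₁ hr₁ r₂ hr₂ => ?_) fun r₁ r₂ h₁ h₂ => ?_
        · have hhom : ∀ (γ : Γ) (c : R), c ∈ 𝒜 γ → c ∈ C ^ (m * k) →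
              f t ^ (a - (k + 1)) * (c * r₂) * x i ∈ E := by
            intro γ c hc hc'
            have := hm A hA hw (fun i => f t ^ (a - (k + 1)) * c * x i)
              (fun i => ((a - (k + 1)) • e t + γ) + d i)
              (fun i => SetLike.mul_mem_graded (SetLike.mul_mem_graded
                (SetLike.pow_mem_graded _ (hf t)) hc) (hx i)) ?_ E hE ?_ i hi r₂ hr₂
            · convert this using 1
              ring
            · intro i hi i' hi' j hj j' hj' hij
              refine hcompat i hi i' hi' j (Finset.mem_insert_of_mem hj) j'
                (Finset.mem_insert_of_mem hj') ?_
              rw [add_assoc, add_assoc _ (d i')] at hij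
              exact add_left_cancel hij
            · have e1 : (∑ i ∈ A, f t ^ (a - (k + 1)) * c * x i) * ∑ j ∈ B, f j =
                  f t ^ (a - (k + 1)) * c * ((∑ i ∈ A, x i) * ∑ j ∈ insert t B, f j) -
                    ∑ i ∈ A, f t ^ (a - k) * c * x i := by
                rw [Finset.sum_insert ht, ← Finset.mul_sum, ← Finset.mul_sum, hsub, pow_succ]
                ring
              rw [e1]
              exact E.sub_mem (E.mul_mem_left _ h)
                (E.sum_mem fun i hi => ihk (by omega) i hi c hc')
          rw [← DirectSum.sum_support_decompose 𝒜 r₁, Finset.sum_mul, Finset.mul_sum,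
            Finset.sum_mul]
          exact E.sum_mem fun γ _ => hhom γ _ (SetLike.coe_mem _) (hpow _ γ hr₁)
        · rw [mul_add, add_mul]
          exact E.add_mem h₁ h₂
    intro i hi r hr
    have hspan : Ideal.span (f '' (insert t B : Finset κ)) = C ⊔ Ideal.span {f t} := by
      rw [Finset.coe_insert, Set.image_insert_eq, Ideal.span_insert, sup_comm]
    rw [hspan] at hr
    have hr' := Ideal.sup_pow_add_le_pow_sup_pow hr
    obtain ⟨r₁, hr₁, r₂, hr₂, rfl⟩ := Submodule.mem_sup.1 hr'
    rw [mul_add]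
    refine E.add_mem ?_ ?_
    · have := h2 a le_rfl i hi r₁ hr₁
      rwa [Nat.sub_self, pow_zero, one_mul, mul_comm] at this
    · rw [Ideal.span_singleton_pow, Ideal.mem_span_singleton'] at hr₂
      obtain ⟨c, rfl⟩ := hr₂
      rw [mul_left_comm, mul_comm (x i)]
      exact E.mul_mem_left _ (h1 i hi)

theorem contentIdeal_isHomogeneous (f : R) : (contentIdeal 𝒜 f).IsHomogeneous 𝒜 := by
  apply Ideal.homogeneous_span
  rintro _ ⟨α, rfl⟩
  exact ⟨α, SetLike.coe_mem _⟩

theorem decompose_mem_contentIdeal (f : R) (α : Γ) :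
    (DirectSum.decompose 𝒜 f α : R) ∈ contentIdeal 𝒜 f :=
  Ideal.subset_span ⟨α, rfl⟩

theorem mem_contentIdeal (f : R) : f ∈ contentIdeal 𝒜 f := by
  classical
  have := Ideal.sum_mem (contentIdeal 𝒜 f) fun α (_ : α ∈ (DirectSum.decompose 𝒜 f).support) =>
    decompose_mem_contentIdeal 𝒜 f α
  rwa [DirectSum.sum_support_decompose] at this

theorem contentIdeal_le_iff {f : R} {I : Ideal R} :
    contentIdeal 𝒜 f ≤ I ↔ ∀ α, (DirectSum.decompose 𝒜 f α : R) ∈ I := by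
  rw [contentIdeal, Ideal.span_le, Set.range_subset_iff]
  rfl

theorem contentIdeal_le_of_mem {f : R} {I : Ideal R} (hI : I.IsHomogeneous 𝒜) (hf : f ∈ I) :
    contentIdeal 𝒜 f ≤ I :=
  (contentIdeal_le_iff 𝒜).2 fun α => hI α hf

theorem contentIdeal_eq_span_support (f : R) [∀ (i : Γ) (x : 𝒜 i), Decidable (x ≠ 0)] :
    contentIdeal 𝒜 f = Ideal.span
      ((fun α => (DirectSum.decompose 𝒜 f α : R)) '' (DirectSum.decompose 𝒜 f).support) := by
  apply le_antisymm
  · rw [contentIdeal_le_iff]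
    intro α
    by_cases h : DirectSum.decompose 𝒜 f α = 0
    · rw [h]
      exact Ideal.zero_mem _
    · exact Ideal.subset_span ⟨α, by simpa using h, rfl⟩
  · exact Ideal.span_mono (Set.image_subset_range _ _)

/-- A weak form of the Dedekind–Mertens lemma for graded rings. -/
theorem exists_contentIdeal_mul_pow_le [IsAddTorsionFree Γ] (x f : R) :
    ∃ m : ℕ, contentIdeal 𝒜 x * contentIdeal 𝒜 f ^ m ≤ contentIdeal 𝒜 (x * f) := by
  classical
  set A := (DirectSum.decompose 𝒜 x).support with hA
  set B := (DirectSum.decompose 𝒜 f).support with hB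
  obtain ⟨n, w, hw, hadd⟩ := exists_orderedEmbedding (A ∪ B)
  have hAS : ∀ i ∈ A, i ∈ A ∪ B := fun i hi => Finset.mem_union_left _ hi
  have hBS : ∀ i ∈ B, i ∈ A ∪ B := fun i hi => Finset.mem_union_right _ hi
  obtain ⟨m, hm⟩ := exists_pow_mul_mem 𝒜 (f := fun α => (DirectSum.decompose 𝒜 f α : R))
    (e := id) (fun j => SetLike.coe_mem _) (w := w) (v := w) A.card B (hw.mono hBS)
  refine ⟨m, ?_⟩
  have h := hm A le_rfl (hw.mono hAS) (fun α => (DirectSum.decompose 𝒜 x α : R)) id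
    (fun _ => SetLike.coe_mem _)
    (fun i hi i' hi' j hj j' hj' hij => hadd i (hAS i hi) j (hBS j hj) i' (hAS i' hi') j'
      (hBS j' hj') hij) _ (contentIdeal_isHomogeneous 𝒜 (x * f)) ?_
  · rw [contentIdeal_eq_span_support 𝒜 f, Ideal.mul_le]
    intro r hr s hs
    rw [contentIdeal_eq_span_support 𝒜 x] at hr
    refine Submodule.span_induction ?_ ?_ ?_ ?_ hr
    · rintro _ ⟨i, hi, rfl⟩
      exact h i hi s hs
    · rw [zero_mul]
      exact Ideal.zero_mem _
    · intro a b _ _ ha hb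
      rw [add_mul]
      exact Ideal.add_mem _ ha hb
    · intro c a _ ha
      rw [smul_eq_mul, mul_assoc]
      exact Ideal.mul_mem_left _ _ ha
  · rw [DirectSum.sum_support_decompose, DirectSum.sum_support_decompose]
    exact mem_contentIdeal 𝒜 _

theorem contentIdeal_ne_bot {f : R} (hf : f ≠ 0) : contentIdeal 𝒜 f ≠ ⊥ := fun h =>
  hf (by simpa [h] using mem_contentIdeal 𝒜 f)

theorem contentIdeal_mul_le (f g : R) :
    contentIdeal 𝒜 (f * g) ≤ contentIdeal 𝒜 f * contentIdeal 𝒜 g :=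
  contentIdeal_le_of_mem 𝒜
    ((contentIdeal_isHomogeneous 𝒜 f).mul (contentIdeal_isHomogeneous 𝒜 g))
    (Ideal.mul_mem_mul (mem_contentIdeal 𝒜 f) (mem_contentIdeal 𝒜 g))

theorem contentIdeal_of_mem {f : R} {α : Γ} (hf : f ∈ 𝒜 α) : contentIdeal 𝒜 f = Ideal.span {f} := by
  apply le_antisymm
  · apply contentIdeal_le_of_mem 𝒜
    · apply Ideal.homogeneous_span
      rintro _ rfl
      exact ⟨α, hf⟩
    · exact Ideal.mem_span_singleton_self f
  · rw [Ideal.span_singleton_le_iff_mem]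
    exact mem_contentIdeal 𝒜 f

/-- With a homogeneous unit of nonzero degree, the sum of two contents is a content. -/
theorem eventually_contentIdeal_add [IsAddTorsionFree Γ] {α : Γ} (hα : α ≠ 0) {u : R} (hu : u ∈ 𝒜 α)
    (huu : IsUnit u) (f g : R) :
    ∀ᶠ k : ℕ in Filter.atTop,
      contentIdeal 𝒜 (f + u ^ k * g) = contentIdeal 𝒜 f ⊔ contentIdeal 𝒜 g := by
  classical
  set A := (DirectSum.decompose 𝒜 f).support with hA
  set B := (DirectSum.decompose 𝒜 g).support with hB
  -- Only finitely many k let a degree of u^k g collide with a degree of f, since the multiples of α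
  -- ≠ 0 are distinct. For every other k, the components of f + u^k g are those of f together with
  -- those of u^k g.
  have hfin : {k : ℕ | ∃ β ∈ A, ∃ δ ∈ B, k • α + δ = β}.Finite := by
    have : {k : ℕ | ∃ β ∈ A, ∃ δ ∈ B, k • α + δ = β} =
        ⋃ β ∈ A, ⋃ δ ∈ B, {k : ℕ | k • α + δ = β} := by
      ext k
      simp
    rw [this]
    refine A.finite_toSet.biUnion fun β _ => B.finite_toSet.biUnion fun δ _ =>
      Set.Subsingleton.finite fun k hk l hl => ?_
    have h : k • α = l • α := add_right_cancel (hk.trans hl.symm)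
    by_contra hkl
    wlog hlt : k < l generalizing k l
    · exact this l hl k hk h.symm (Ne.symm hkl) (by omega)
    · have h1 : l • α = (l - k) • α + k • α := by rw [← add_nsmul, Nat.sub_add_cancel hlt.le]
      rw [← h] at h1
      have h2 : (l - k) • α = 0 := by simpa using h1.symm
      exact hα (IsAddTorsionFree.nsmul_right_injective (n := l - k) (by omega) (by simpa using h2))
  rw [← Nat.cofinite_eq_atTop]
  filter_upwards [hfin.compl_mem_cofinite] with k hk
  have hk : ∀ β ∈ A, ∀ δ ∈ B, k • α + δ ≠ β := fun β hβ δ hδ h => hk ⟨β, hβ, δ, hδ, h⟩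
  have hmem := decompose_mem_contentIdeal 𝒜 (f + u ^ k * g)
  simp only [DirectSum.decompose_add, DirectSum.add_apply, AddSubgroup.coe_add] at hmem
  have huk : u ^ k ∈ 𝒜 (k • α) := SetLike.pow_mem_graded _ hu
  have hshift : ∀ δ, (DirectSum.decompose 𝒜 (u ^ k * g) (k • α + δ) : R) =
      u ^ k * DirectSum.decompose 𝒜 g δ := fun δ =>
    DirectSum.coe_decompose_mul_add_of_left_mem 𝒜 huk
  have hzero : ∀ β, (∀ δ ∈ B, k • α + δ ≠ β) → (DirectSum.decompose 𝒜 (u ^ k * g) β : R) = 0 := by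
    intro β h
    conv_lhs => rw [← DirectSum.sum_support_decompose 𝒜 g, Finset.mul_sum]
    rw [← GradedRing.proj_apply, map_sum]
    refine Finset.sum_eq_zero fun δ hδ => ?_
    rw [GradedRing.proj_apply]
    exact DirectSum.decompose_of_mem_ne 𝒜 (SetLike.mul_mem_graded huk (SetLike.coe_mem _)) (h δ hδ)
  apply le_antisymm
  · apply contentIdeal_le_of_mem 𝒜
    · exact (contentIdeal_isHomogeneous 𝒜 f).sup (contentIdeal_isHomogeneous 𝒜 g)
    · exact Ideal.add_mem _ (Ideal.mem_sup_left (mem_contentIdeal 𝒜 f))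
        (Ideal.mem_sup_right (Ideal.mul_mem_left _ _ (mem_contentIdeal 𝒜 g)))
  · refine sup_le ((contentIdeal_le_iff 𝒜).2 fun β => ?_) ((contentIdeal_le_iff 𝒜).2 fun δ => ?_)
    · by_cases hβ : β ∈ A
      · have := hmem β
        rwa [hzero β (hk β hβ), add_zero] at this
      · rw [hA, DFinsupp.notMem_support_iff] at hβ
        rw [hβ]
        exact Ideal.zero_mem _
    · by_cases hδ : δ ∈ B
      · have := hmem (k • α + δ)
        rw [hshift] at this
        by_cases hβ : k • α + δ ∈ A
        · exact absurd rfl (hk _ hβ δ hδ)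
        · rw [hA, DFinsupp.notMem_support_iff] at hβ
          rw [hβ, AddSubgroup.coe_zero, zero_add] at this
          exact (Ideal.unit_mul_mem_iff_mem _ (huu.pow k)).1 this
      · rw [hB, DFinsupp.notMem_support_iff] at hδ
        rw [hδ]
        exact Ideal.zero_mem _

theorem exists_contentIdeal_add [IsAddTorsionFree Γ] {α : Γ} (hα : α ≠ 0) {u : R} (hu : u ∈ 𝒜 α)
    (huu : IsUnit u) (f g : R) :
    ∃ k : ℕ, contentIdeal 𝒜 (f + u ^ k * g) = contentIdeal 𝒜 f ⊔ contentIdeal 𝒜 g :=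
  (eventually_contentIdeal_add 𝒜 hα hu huu f g).exists

/-- With a homogeneous unit of nonzero degree, each finitely generated homogeneous ideal is the
content of one of its elements. -/
theorem exists_contentIdeal_eq [IsAddTorsionFree Γ] {α : Γ} (hα : α ≠ 0) {u : R} (hu : u ∈ 𝒜 α)
    (huu : IsUnit u) {I : Ideal R} (hI : I.FG) (hhom : I.IsHomogeneous 𝒜) :
    ∃ f, contentIdeal 𝒜 f = I := by
  classical
  obtain ⟨s, rfl⟩ := hI
  -- The ideal spanned by t need not be homogeneous, so the content is squeezed between it and the
  -- whole ideal rather than computed.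
  have key : ∀ t : Finset R, t ⊆ s →
      ∃ f, Ideal.span (t : Set R) ≤ contentIdeal 𝒜 f ∧ contentIdeal 𝒜 f ≤ Ideal.span (s : Set R) := by
    intro t
    induction t using Finset.induction_on with
    | empty => exact fun _ => ⟨0, by simp, contentIdeal_le_of_mem 𝒜 hhom (Ideal.zero_mem _)⟩
    | insert a t _ ih =>
      intro hs
      obtain ⟨f, h1, h2⟩ := ih ((Finset.subset_insert _ _).trans hs)
      obtain ⟨k, hk⟩ := exists_contentIdeal_add 𝒜 hα hu huu a f
      refine ⟨_, ?_, (hk.trans_le (sup_le ?_ h2))⟩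
      · rw [hk, Finset.coe_insert, Ideal.span_insert]
        exact sup_le_sup (by
          rw [Ideal.span_singleton_le_iff_mem]; exact mem_contentIdeal 𝒜 a) h1
      · exact contentIdeal_le_of_mem 𝒜 hhom (Ideal.subset_span (hs (Finset.mem_insert_self _ _)))
  obtain ⟨f, h1, h2⟩ := key s subset_rfl
  exact ⟨f, le_antisymm h2 h1⟩

end DedekindMertens

/-! ### Homogeneous fractions, fractional contents and graded submodules of `R_H`. -/

section HomogeneousFractions

variable {Γ R : Type*} [AddCancelCommMonoid Γ] [DecidableEq Γ] [CommRing R]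
  (𝒜 : Γ → AddSubgroup R) [GradedRing 𝒜]

theorem mem_homSubmonoid_iff [IsDomain R] {s : R} :
    s ∈ homSubmonoid 𝒜 ↔ (∃ α, s ∈ 𝒜 α) ∧ s ≠ 0 := by
  rw [homSubmonoid, Submonoid.mem_inf, mem_nonZeroDivisors_iff_ne_zero]
  rfl

variable [IsDomain R] (K : Type*) [Field K] [Algebra R K] [IsFractionRing R K]

theorem algebraMap_ne_zero_of_mem_homSubmonoid {s : R} (hs : s ∈ homSubmonoid 𝒜) :
    algebraMap R K s ≠ 0 := by
  simpa using nonZeroDivisors.ne_zero hs.2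

theorem mem_ofField_iff {S : Submonoid R} {hS : S ≤ nonZeroDivisors R} {x : K} :
    x ∈ Localization.subalgebra.ofField K S hS ↔
      ∃ a, ∃ s ∈ S, x = algebraMap R K a / algebraMap R K s := by
  simp only [div_eq_mul_inv]
  constructor
  · rintro ⟨a, s, hs, h⟩
    exact ⟨a, s, hs, h⟩
  · rintro ⟨a, s, hs, h⟩
    exact ⟨a, s, hs, h⟩

theorem mem_homQuotientField_iff {x : K} :
    x ∈ homQuotientField 𝒜 K ↔
      ∃ a, ∃ s ∈ homSubmonoid 𝒜, x = algebraMap R K a / algebraMap R K s :=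
  mem_ofField_iff K

theorem div_mem_homPiece {α β : Γ} {a s : R} (ha : a ∈ 𝒜 α) (hs : s ∈ 𝒜 β) (hs0 : s ≠ 0) :
    algebraMap R K a / algebraMap R K s ∈ homPiece 𝒜 K
      (Algebra.GrothendieckAddGroup.of α - Algebra.GrothendieckAddGroup.of β) :=
  AddSubgroup.subset_closure ⟨α, β, a, ha, s, hs, hs0, rfl, rfl⟩

/-- The fractions of degree γ are already closed under addition: after cross-multiplication both
numerators have the same degree in Γ, because Γ embeds in its quotient group. -/
theorem mem_homPiece_iff {γ : Algebra.GrothendieckAddGroup Γ} {x : K} :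
    x ∈ homPiece 𝒜 K γ ↔ x = 0 ∨ ∃ α β : Γ, ∃ a ∈ 𝒜 α, ∃ s ∈ 𝒜 β, s ≠ 0 ∧
      γ = Algebra.GrothendieckAddGroup.of α - Algebra.GrothendieckAddGroup.of β ∧
      x = algebraMap R K a / algebraMap R K s := by
  constructor
  · intro hx
    have hinj : ∀ s : R, s ≠ 0 → algebraMap R K s ≠ 0 := fun s hs => by simpa using hs
    induction hx using AddSubgroup.closure_induction with
    | mem x hx => exact Or.inr hx
    | zero => exact Or.inl rfl
    | add x y _ _ hx hy =>
      rcases hx with rfl | hx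
      · simpa using hy
      rcases hy with rfl | hy
      · rw [add_zero]
        exact Or.inr hx
      obtain ⟨α₁, β₁, a₁, ha₁, s₁, hs₁, hs₁0, h₁, rfl⟩ := hx
      obtain ⟨α₂, β₂, a₂, ha₂, s₂, hs₂, hs₂0, h₂, rfl⟩ := hy
      have hdeg : α₂ + β₁ = α₁ + β₂ := by
        apply Algebra.GrothendieckAddGroup.of_injective
        rw [map_add, map_add]
        have := h₁.symm.trans h₂
        rw [sub_eq_sub_iff_add_eq_add] at this
        exact this.symm
      refine Or.inr ⟨α₁ + β₂, β₁ + β₂, a₁ * s₂ + a₂ * s₁,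
        add_mem (SetLike.mul_mem_graded ha₁ hs₂) ?_,
        s₁ * s₂, SetLike.mul_mem_graded hs₁ hs₂, mul_ne_zero hs₁0 hs₂0, ?_, ?_⟩
      · rw [← hdeg]
        exact SetLike.mul_mem_graded ha₂ hs₁
      · rw [h₁, map_add, map_add]
        abel
      · have := hinj _ hs₁0
        have := hinj _ hs₂0
        rw [map_add, map_mul, map_mul, map_mul]
        field_simp
    | neg x _ hx =>
      rcases hx with rfl | ⟨α₁, β₁, a₁, ha₁, s₁, hs₁, hs₁0, h₁, rfl⟩
      · exact Or.inl neg_zero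
      · exact Or.inr ⟨α₁, β₁, -a₁, neg_mem ha₁, s₁, hs₁, hs₁0, h₁, by rw [map_neg, neg_div]⟩
  · rintro (rfl | ⟨α, β, a, ha, s, hs, hs0, rfl, rfl⟩)
    · exact zero_mem _
    · exact div_mem_homPiece 𝒜 K ha hs hs0

theorem algebraMap_mem_homPiece {α : Γ} {a : R} (ha : a ∈ 𝒜 α) :
    algebraMap R K a ∈ homPiece 𝒜 K (Algebra.GrothendieckAddGroup.of α) := by
  simpa using div_mem_homPiece 𝒜 K ha SetLike.GradedOne.one_mem one_ne_zero

theorem one_mem_homPiece : (1 : K) ∈ homPiece 𝒜 K 0 := by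
  simpa using algebraMap_mem_homPiece 𝒜 K (SetLike.GradedOne.one_mem (A := 𝒜))

theorem mul_mem_homPiece {γ δ : Algebra.GrothendieckAddGroup Γ} {x y : K}
    (hx : x ∈ homPiece 𝒜 K γ) (hy : y ∈ homPiece 𝒜 K δ) : x * y ∈ homPiece 𝒜 K (γ + δ) := by
  rcases (mem_homPiece_iff 𝒜 K).1 hx with rfl | ⟨α₁, β₁, a₁, ha₁, s₁, hs₁, hs₁0, rfl, rfl⟩
  · rw [zero_mul]
    exact zero_mem _
  rcases (mem_homPiece_iff 𝒜 K).1 hy with rfl | ⟨α₂, β₂, a₂, ha₂, s₂, hs₂, hs₂0, rfl, rfl⟩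
  · rw [mul_zero]
    exact zero_mem _
  have := div_mem_homPiece 𝒜 K (SetLike.mul_mem_graded ha₁ ha₂) (SetLike.mul_mem_graded hs₁ hs₂)
    (mul_ne_zero hs₁0 hs₂0)
  rw [map_add, map_add, map_mul, map_mul, ← div_mul_div_comm] at this
  rwa [sub_add_sub_comm]

theorem inv_mem_homPiece {γ : Algebra.GrothendieckAddGroup Γ} {x : K}
    (hx : x ∈ homPiece 𝒜 K γ) : x⁻¹ ∈ homPiece 𝒜 K (-γ) := by
  rcases (mem_homPiece_iff 𝒜 K).1 hx with rfl | ⟨α₁, β₁, a₁, ha₁, s₁, hs₁, hs₁0, rfl, rfl⟩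
  · rw [inv_zero]
    exact zero_mem _
  by_cases h0 : a₁ = 0
  · rw [h0, map_zero, zero_div, inv_zero]
    exact zero_mem _
  · rw [inv_div, neg_sub]
    exact div_mem_homPiece 𝒜 K hs₁ ha₁ h0

/-- The homogeneous fractions. -/
abbrev IsHomFraction (x : K) : Prop := SetLike.IsHomogeneousElem (homPiece 𝒜 K) x

variable {K} in
theorem IsHomFraction.mul {x y : K} (hx : IsHomFraction 𝒜 K x) (hy : IsHomFraction 𝒜 K y) :
    IsHomFraction 𝒜 K (x * y) := by
  obtain ⟨γ, hγ⟩ := hx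
  obtain ⟨δ, hδ⟩ := hy
  exact ⟨_, mul_mem_homPiece 𝒜 K hγ hδ⟩

variable {K} in
theorem IsHomFraction.inv {x : K} (hx : IsHomFraction 𝒜 K x) : IsHomFraction 𝒜 K x⁻¹ := by
  obtain ⟨γ, hγ⟩ := hx
  exact ⟨_, inv_mem_homPiece 𝒜 K hγ⟩

theorem isHomFraction_one : IsHomFraction 𝒜 K 1 := ⟨0, one_mem_homPiece 𝒜 K⟩

theorem isHomFraction_algebraMap {α : Γ} {a : R} (ha : a ∈ 𝒜 α) :
    IsHomFraction 𝒜 K (algebraMap R K a) :=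
  ⟨_, algebraMap_mem_homPiece 𝒜 K ha⟩

theorem isHomFraction_iff {x : K} : IsHomFraction 𝒜 K x ↔ ∃ α, ∃ a ∈ 𝒜 α, ∃ s ∈ homSubmonoid 𝒜,
    x = algebraMap R K a / algebraMap R K s := by
  constructor
  · rintro ⟨γ, hγ⟩
    rcases (mem_homPiece_iff 𝒜 K).1 hγ with rfl | ⟨α₁, β₁, a₁, ha₁, s₁, hs₁, hs₁0, rfl, rfl⟩
    · exact ⟨0, 0, zero_mem _, 1, one_mem _, by simp⟩
    · exact ⟨α₁, a₁, ha₁, s₁, (mem_homSubmonoid_iff 𝒜).2 ⟨⟨β₁, hs₁⟩, hs₁0⟩, rfl⟩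
  · rintro ⟨α, a, ha, s, hs, rfl⟩
    obtain ⟨⟨β, hs⟩, hs0⟩ := (mem_homSubmonoid_iff 𝒜).1 hs
    exact ⟨_, div_mem_homPiece 𝒜 K ha hs hs0⟩

variable {K} in
theorem IsHomFraction.mem_homQuotientField {x : K} (hx : IsHomFraction 𝒜 K x) :
    x ∈ homQuotientField 𝒜 K := by
  obtain ⟨α, a, -, s, hs, rfl⟩ := (isHomFraction_iff 𝒜 K).1 hx
  exact (mem_homQuotientField_iff 𝒜 K).2 ⟨a, s, hs, rfl⟩

theorem coeSubmodule_span (S : Set R) :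
    IsLocalization.coeSubmodule K (Ideal.span S) = Submodule.span R (algebraMap R K '' S) := by
  rw [IsLocalization.coeSubmodule, Ideal.submodule_span_eq.symm, Submodule.map_span]
  rfl

theorem fracContent_div_eq (a : R) {s : R} (hs : s ∈ homSubmonoid 𝒜) :
    fracContent 𝒜 K (algebraMap R K a / algebraMap R K s) =
      Submodule.span R {(algebraMap R K s)⁻¹} *
        IsLocalization.coeSubmodule K (contentIdeal 𝒜 a) := by
  rw [fracContent_div 𝒜 K a hs, contentIdeal, coeSubmodule_span, Submodule.span_mul_span,
    ← Set.range_comp, Set.singleton_mul, ← Set.range_comp]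
  congr 2
  ext α
  simp [div_eq_inv_mul]

theorem fracContent_algebraMap (a : R) :
    fracContent 𝒜 K (algebraMap R K a) = IsLocalization.coeSubmodule K (contentIdeal 𝒜 a) := by
  have := fracContent_div_eq 𝒜 K a (one_mem (homSubmonoid 𝒜))
  simpa [← Submodule.one_eq_span] using this

theorem fracContent_zero : fracContent 𝒜 K 0 = ⊥ := by
  have h : contentIdeal 𝒜 (0 : R) = ⊥ :=
    le_bot_iff.1 (contentIdeal_le_of_mem 𝒜 (Ideal.IsHomogeneous.bot 𝒜) (Ideal.zero_mem _))
  rw [← map_zero (algebraMap R K), fracContent_algebraMap, h, IsLocalization.coeSubmodule_bot]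

variable {K}

theorem mem_fracContent {x : K} (hx : x ∈ homQuotientField 𝒜 K) : x ∈ fracContent 𝒜 K x := by
  obtain ⟨a, s, hs, rfl⟩ := (mem_homQuotientField_iff 𝒜 K).1 hx
  rw [fracContent_div_eq 𝒜 K a hs, div_eq_inv_mul]
  exact Submodule.mul_mem_mul (Submodule.mem_span_singleton_self _)
    ⟨a, mem_contentIdeal 𝒜 a, rfl⟩

theorem fracContent_fg {x : K} (hx : x ∈ homQuotientField 𝒜 K) : (fracContent 𝒜 K x).FG := by
  obtain ⟨a, s, hs, rfl⟩ := (mem_homQuotientField_iff 𝒜 K).1 hx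
  rw [fracContent_div_eq 𝒜 K a hs]
  exact (Submodule.fg_span_singleton _).mul (coeSubmodule_fg (contentIdeal_fg 𝒜 a))

theorem fracContent_ne_bot {x : K} (hx : x ∈ homQuotientField 𝒜 K) (h0 : x ≠ 0) :
    fracContent 𝒜 K x ≠ ⊥ := fun h => by
  have := mem_fracContent 𝒜 hx
  rw [h, Submodule.mem_bot] at this
  exact h0 this

/-- The content is generated by homogeneous fractions. -/
theorem fracContent_eq_span {x : K} (hx : x ∈ homQuotientField 𝒜 K) :
    fracContent 𝒜 K x = Submodule.span R {y | IsHomFraction 𝒜 K y ∧ y ∈ fracContent 𝒜 K x} := by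
  apply le_antisymm
  · obtain ⟨a, s, hs, rfl⟩ := (mem_homQuotientField_iff 𝒜 K).1 hx
    conv_lhs => rw [fracContent_div 𝒜 K a hs]
    rw [Submodule.span_le]
    rintro _ ⟨α, rfl⟩
    refine Submodule.subset_span ⟨(isHomFraction_iff 𝒜 K).2 ⟨α, _, SetLike.coe_mem _, s, hs, rfl⟩, ?_⟩
    rw [fracContent_div 𝒜 K a hs]
    exact Submodule.subset_span ⟨α, rfl⟩
  · rw [Submodule.span_le]
    exact fun y hy => hy.2

theorem fracContent_add_le {x y : K} (hx : x ∈ homQuotientField 𝒜 K)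
    (hy : y ∈ homQuotientField 𝒜 K) :
    fracContent 𝒜 K (x + y) ≤ fracContent 𝒜 K x ⊔ fracContent 𝒜 K y := by
  obtain ⟨a, s, hs, rfl⟩ := (mem_homQuotientField_iff 𝒜 K).1 hx
  obtain ⟨b, t, ht, rfl⟩ := (mem_homQuotientField_iff 𝒜 K).1 hy
  have hs0 := algebraMap_ne_zero_of_mem_homSubmonoid 𝒜 K hs
  have ht0 := algebraMap_ne_zero_of_mem_homSubmonoid 𝒜 K ht
  have e₁ : algebraMap R K a / algebraMap R K s =
      algebraMap R K (a * t) / algebraMap R K (s * t) := by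
    rw [map_mul, map_mul]
    field_simp
  have e₂ : algebraMap R K b / algebraMap R K t =
      algebraMap R K (b * s) / algebraMap R K (s * t) := by
    rw [map_mul, map_mul]
    field_simp
  rw [e₁, e₂, ← add_div, ← map_add, fracContent_div_eq 𝒜 K _ (mul_mem hs ht),
    fracContent_div_eq 𝒜 K _ (mul_mem hs ht), fracContent_div_eq 𝒜 K _ (mul_mem hs ht),
    ← Submodule.mul_sup, ← IsLocalization.coeSubmodule_sup]
  refine mul_le_mul' le_rfl (IsLocalization.coeSubmodule_mono K ?_)
  exact contentIdeal_le_of_mem 𝒜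
    ((contentIdeal_isHomogeneous 𝒜 _).sup (contentIdeal_isHomogeneous 𝒜 _))
    (Ideal.add_mem _ (Ideal.mem_sup_left (mem_contentIdeal 𝒜 _))
      (Ideal.mem_sup_right (mem_contentIdeal 𝒜 _)))

theorem fracContent_mul_le {x y : K} (hx : x ∈ homQuotientField 𝒜 K)
    (hy : y ∈ homQuotientField 𝒜 K) :
    fracContent 𝒜 K (x * y) ≤ fracContent 𝒜 K x * fracContent 𝒜 K y := by
  obtain ⟨a, s, hs, rfl⟩ := (mem_homQuotientField_iff 𝒜 K).1 hx
  obtain ⟨b, t, ht, rfl⟩ := (mem_homQuotientField_iff 𝒜 K).1 hy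
  rw [div_mul_div_comm, ← map_mul, ← map_mul, fracContent_div_eq 𝒜 K _ (mul_mem hs ht),
    fracContent_div_eq 𝒜 K _ hs, fracContent_div_eq 𝒜 K _ ht, mul_mul_mul_comm,
    Submodule.span_mul_span, Set.singleton_mul_singleton, map_mul, mul_inv,
    ← IsLocalization.coeSubmodule_mul]
  exact mul_le_mul' le_rfl (IsLocalization.coeSubmodule_mono K (contentIdeal_mul_le 𝒜 a b))

theorem fracContent_homFraction {h : K} (hh : IsHomFraction 𝒜 K h) :
    fracContent 𝒜 K h = Submodule.span R {h} := by
  obtain ⟨α, a, ha, s, hs, rfl⟩ := (isHomFraction_iff 𝒜 K).1 hh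
  rw [fracContent_div_eq 𝒜 K _ hs, contentIdeal_of_mem 𝒜 ha,
    IsLocalization.coeSubmodule_span_singleton, Submodule.span_mul_span,
    Set.singleton_mul_singleton, div_eq_inv_mul]

/-- Submultiplicativity of contents is applied to h·x and to h⁻¹·(hx); the inverse is again
homogeneous. -/
theorem fracContent_homFraction_mul {h x : K} (hh : IsHomFraction 𝒜 K h)
    (hx : x ∈ homQuotientField 𝒜 K) :
    fracContent 𝒜 K (h * x) = Submodule.span R {h} * fracContent 𝒜 K x := by
  by_cases h0 : h = 0
  · rw [h0, zero_mul, fracContent_zero, Submodule.span_zero_singleton, Submodule.bot_mul]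
  · have hh' := hh.mem_homQuotientField 𝒜
    apply le_antisymm
    · exact (fracContent_mul_le 𝒜 hh' hx).trans_eq (by rw [fracContent_homFraction 𝒜 hh])
    · have h1 := fracContent_mul_le 𝒜 (IsHomFraction.mem_homQuotientField 𝒜 (hh.inv 𝒜))
        (mul_mem hh' hx)
      rw [inv_mul_cancel_left₀ h0, fracContent_homFraction 𝒜 (hh.inv 𝒜)] at h1
      calc _ ≤ Submodule.span R {h} * (Submodule.span R {h⁻¹} * fracContent 𝒜 K (h * x)) := by
            gcongr
        _ = _ := by
          rw [← mul_assoc, Submodule.span_mul_span, Set.singleton_mul_singleton,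
            mul_inv_cancel₀ h0, ← Submodule.one_eq_span, one_mul]

theorem exists_fracContent_mul_pow_le [IsAddTorsionFree Γ] {x : K}
    (hx : x ∈ homQuotientField 𝒜 K) (f : R) :
    ∃ m : ℕ, fracContent 𝒜 K x * fracContent 𝒜 K (algebraMap R K f) ^ m ≤
      fracContent 𝒜 K (x * algebraMap R K f) := by
  obtain ⟨a, s, hs, rfl⟩ := (mem_homQuotientField_iff 𝒜 K).1 hx
  obtain ⟨m, hm⟩ := exists_contentIdeal_mul_pow_le 𝒜 a f
  refine ⟨m, ?_⟩
  have hpow : IsLocalization.coeSubmodule K (contentIdeal 𝒜 f) ^ m =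
      IsLocalization.coeSubmodule K (contentIdeal 𝒜 f ^ m) := by
    clear hm
    induction m with
    | zero => rw [pow_zero, pow_zero, Ideal.one_eq_top, IsLocalization.coeSubmodule_top]
    | succ m ih => rw [pow_succ, pow_succ, ih, IsLocalization.coeSubmodule_mul]
  rw [div_mul_eq_mul_div, ← map_mul, fracContent_div_eq 𝒜 K _ hs, fracContent_div_eq 𝒜 K _ hs,
    fracContent_algebraMap, hpow, mul_assoc, ← IsLocalization.coeSubmodule_mul]
  exact mul_le_mul' le_rfl (IsLocalization.coeSubmodule_mono K hm)

/-- A submodule of `K` is graded if it lies in `R_H` and contains the contents of its elements. -/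
def IsGraded (E : Submodule R K) : Prop :=
  ∀ x ∈ E, x ∈ homQuotientField 𝒜 K ∧ fracContent 𝒜 K x ≤ E

theorem isGraded_span {S : Set K} (hS : ∀ x ∈ S, IsHomFraction 𝒜 K x) :
    IsGraded 𝒜 (Submodule.span R S) := by
  intro x hx
  induction hx using Submodule.span_induction with
  | mem x hx =>
    refine ⟨(hS x hx).mem_homQuotientField 𝒜, ?_⟩
    rw [fracContent_homFraction 𝒜 (hS x hx)]
    exact Submodule.span_mono (Set.singleton_subset_iff.2 hx)
  | zero => exact ⟨zero_mem _, by rw [fracContent_zero]; exact bot_le⟩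
  | add x y _ _ hx hy =>
    exact ⟨add_mem hx.1 hy.1, (fracContent_add_le 𝒜 hx.1 hy.1).trans (sup_le hx.2 hy.2)⟩
  | smul c x _ hx =>
    refine ⟨Subalgebra.smul_mem _ hx.1 c, ?_⟩
    rw [Algebra.smul_def]
    refine (fracContent_mul_le 𝒜 (algebraMap_mem _ c) hx.1).trans ?_
    rw [fracContent_algebraMap]
    exact (mul_le_mul' (coeSubmodule_le_one _) hx.2).trans_eq (one_mul _)

variable {𝒜}

theorem IsGraded.eq_span {E : Submodule R K} (hE : IsGraded 𝒜 E) :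
    E = Submodule.span R {y | IsHomFraction 𝒜 K y ∧ y ∈ E} := by
  apply le_antisymm
  · intro x hx
    have h1 := mem_fracContent 𝒜 (hE x hx).1
    rw [fracContent_eq_span 𝒜 (hE x hx).1] at h1
    have h2 : {y | IsHomFraction 𝒜 K y ∧ y ∈ fracContent 𝒜 K x} ⊆
        {y | IsHomFraction 𝒜 K y ∧ y ∈ E} := fun y hy => ⟨hy.1, (hE x hx).2 hy.2⟩
    exact Submodule.span_mono h2 h1
  · rw [Submodule.span_le]
    exact fun y hy => hy.2

theorem IsGraded.le_of_forall {E F : Submodule R K} (hE : IsGraded 𝒜 E)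
    (h : ∀ x, IsHomFraction 𝒜 K x → x ∈ E → x ∈ F) : E ≤ F := by
  rw [hE.eq_span, Submodule.span_le]
  exact fun y hy => h y hy.1 hy.2

theorem IsGraded.exists_ne_zero {E : Submodule R K} (hE : IsGraded 𝒜 E) (h0 : E ≠ ⊥) :
    ∃ x, IsHomFraction 𝒜 K x ∧ x ∈ E ∧ x ≠ 0 := by
  by_contra! h
  exact h0 (le_bot_iff.1 (hE.le_of_forall fun x hx hxE => by
    rw [h x hx hxE]
    exact zero_mem _))

theorem IsGraded.exists_finset {E : Submodule R K} (hE : IsGraded 𝒜 E) (hfg : E.FG) :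
    ∃ T : Finset K, (∀ x ∈ T, IsHomFraction 𝒜 K x) ∧ E = Submodule.span R (T : Set K) := by
  rw [hE.eq_span, Submodule.fg_span_iff_fg_span_finset_subset] at hfg
  obtain ⟨T, hT, hT'⟩ := hfg
  exact ⟨T, fun x hx => (hT hx).1, hE.eq_span.trans hT'⟩

theorem IsGraded.sup {E F : Submodule R K} (hE : IsGraded 𝒜 E) (hF : IsGraded 𝒜 F) :
    IsGraded 𝒜 (E ⊔ F) := by
  rw [hE.eq_span, hF.eq_span, ← Submodule.span_union]
  apply isGraded_span
  rintro x (hx | hx)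
  exacts [hx.1, hx.1]

theorem IsGraded.mul {E F : Submodule R K} (hE : IsGraded 𝒜 E) (hF : IsGraded 𝒜 F) :
    IsGraded 𝒜 (E * F) := by
  rw [hE.eq_span, hF.eq_span, Submodule.span_mul_span]
  apply isGraded_span
  rintro _ ⟨x, hx, y, hy, rfl⟩
  exact hx.1.mul 𝒜 hy.1

theorem isGraded_one : IsGraded 𝒜 (1 : Submodule R K) := by
  rw [Submodule.one_eq_span]
  apply isGraded_span
  rintro _ rfl
  exact isHomFraction_one 𝒜 K

theorem isGraded_fracContent {x : K} (hx : x ∈ homQuotientField 𝒜 K) :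
    IsGraded 𝒜 (fracContent 𝒜 K x) := by
  rw [fracContent_eq_span 𝒜 hx]
  exact isGraded_span 𝒜 fun y hy => hy.1

theorem isGraded_coeSubmodule {I : Ideal R} (hI : I.IsHomogeneous 𝒜) :
    IsGraded 𝒜 (IsLocalization.coeSubmodule K I) := by
  rintro _ ⟨a, ha, rfl⟩
  refine ⟨algebraMap_mem _ a, ?_⟩
  rw [Algebra.linearMap_apply, fracContent_algebraMap]
  exact IsLocalization.coeSubmodule_mono K (contentIdeal_le_of_mem 𝒜 hI ha)

theorem IsGraded.isHomogeneous_comap {E : Submodule R K} (hE : IsGraded 𝒜 E) :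
    (E.comap (Algebra.linearMap R K) : Ideal R).IsHomogeneous 𝒜 := by
  intro α r hr
  have h1 := (hE _ hr).2
  rw [Algebra.linearMap_apply, fracContent_algebraMap] at h1
  exact h1 ⟨_, decompose_mem_contentIdeal 𝒜 r α, rfl⟩

theorem mem_homQuotientField_of_mul_mem {h x : K} (hh : IsHomFraction 𝒜 K h) (h0 : h ≠ 0)
    (hx : x * h ∈ homQuotientField 𝒜 K) : x ∈ homQuotientField 𝒜 K := by
  have := mul_mem hx (IsHomFraction.mem_homQuotientField 𝒜 (hh.inv 𝒜))
  rwa [mul_inv_cancel_right₀ h0] at this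

theorem one_le_homQuotientField {x : K} (hx : x ∈ (1 : Submodule R K)) :
    x ∈ homQuotientField 𝒜 K := (isGraded_one x hx).1

/-- Testing on homogeneous e ∈ E suffices, and there C(ye) = e C(y) lies in R together with ye. A
nonzero homogeneous e also forces y ∈ R_H. -/
theorem IsGraded.one_div {E : Submodule R K} (hE : IsGraded 𝒜 E) (h0 : E ≠ ⊥) :
    IsGraded 𝒜 (1 / E) := by
  obtain ⟨h, hh, hhE, hh0⟩ := hE.exists_ne_zero h0
  intro y hy
  rw [mem_one_div] at hy
  have hyR : y ∈ homQuotientField 𝒜 K :=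
    mem_homQuotientField_of_mul_mem hh hh0 (one_le_homQuotientField (hy h hhE))
  refine ⟨hyR, ?_⟩
  rw [le_one_div_iff, mul_comm, Submodule.mul_le]
  intro z hz e he
  rw [hE.eq_span] at he
  induction he using Submodule.span_induction with
  | mem e he =>
    have h1 := (isGraded_one (𝒜 := 𝒜) _ (hy e he.2)).2
    rw [mul_comm, fracContent_homFraction_mul 𝒜 he.1 hyR] at h1
    rw [mul_comm]
    exact h1 (Submodule.mul_mem_mul (Submodule.mem_span_singleton_self e) hz)
  | zero => rw [mul_zero]; exact zero_mem _
  | add a b _ _ ha hb => rw [mul_add]; exact add_mem ha hb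
  | smul c a _ ha => rw [mul_smul_comm]; exact Submodule.smul_mem _ c ha

/-- Homogeneous denominators for finitely generated submodules of `R_H`. -/
theorem exists_homSubmonoid_mul_le_one {E : Submodule R K} (hfg : E.FG)
    (hE : ∀ x ∈ E, x ∈ homQuotientField 𝒜 K) :
    ∃ s ∈ homSubmonoid 𝒜, Submodule.span R {algebraMap R K s} * E ≤ 1 := by
  induction E, hfg using Submodule.fg_induction with
  | singleton x =>
    obtain ⟨a, s, hs, rfl⟩ :=
      (mem_homQuotientField_iff 𝒜 K).1 (hE x (Submodule.mem_span_singleton_self x))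
    refine ⟨s, hs, ?_⟩
    rw [Submodule.span_mul_span, Set.singleton_mul_singleton, Submodule.span_le,
      Set.singleton_subset_iff, mul_div_cancel₀ _ (algebraMap_ne_zero_of_mem_homSubmonoid 𝒜 K hs)]
    exact Submodule.mem_one.2 ⟨a, rfl⟩
  | sup M N _ _ hM hN =>
    obtain ⟨s, hs, hM⟩ := hM fun x hx => hE x (Submodule.mem_sup_left hx)
    obtain ⟨t, ht, hN⟩ := hN fun x hx => hE x (Submodule.mem_sup_right hx)
    refine ⟨s * t, mul_mem hs ht, ?_⟩
    have h1 : ∀ r : R, Submodule.span R {algebraMap R K r} ≤ 1 := fun r => by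
      rw [Submodule.span_singleton_le_iff_mem]
      exact Submodule.mem_one.2 ⟨r, rfl⟩
    rw [map_mul, ← Set.singleton_mul_singleton, ← Submodule.span_mul_span, Submodule.mul_sup]
    refine sup_le ?_ ?_
    · rw [mul_comm (Submodule.span R {algebraMap R K s}), mul_assoc]
      exact (mul_le_mul' (h1 t) hM).trans_eq (one_mul 1)
    · rw [mul_assoc]
      exact (mul_le_mul' (h1 s) hN).trans_eq (one_mul 1)

theorem IsGraded.exists_fracContent_eq [IsAddTorsionFree Γ] {α : Γ} (hα : α ≠ 0) {u : R}
    (hu : u ∈ 𝒜 α) (huu : IsUnit u) {E : Submodule R K} (hE : IsGraded 𝒜 E) (hfg : E.FG) :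
    ∃ f ∈ homQuotientField 𝒜 K, fracContent 𝒜 K f = E := by
  obtain ⟨s, hs, hs1⟩ := exists_homSubmonoid_mul_le_one hfg fun x hx => (hE x hx).1
  obtain ⟨⟨β, hβ⟩, hs0⟩ := (mem_homSubmonoid_iff 𝒜).1 hs
  have hs0' := algebraMap_ne_zero_of_mem_homSubmonoid 𝒜 K hs
  set E' := Submodule.span R {algebraMap R K s} * E
  have hgr : IsGraded 𝒜 E' := (isGraded_span 𝒜 (by
    rintro _ rfl
    exact isHomFraction_algebraMap 𝒜 K hβ)).mul hE
  obtain ⟨f, hf⟩ := exists_contentIdeal_eq 𝒜 hα hu huu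
    (comap_fg hs1 ((Submodule.fg_span_singleton _).mul hfg)) hgr.isHomogeneous_comap
  refine ⟨_, (mem_homQuotientField_iff 𝒜 K).2 ⟨f, s, hs, rfl⟩, ?_⟩
  rw [fracContent_div_eq 𝒜 K f hs, hf, coeSubmodule_comap hs1, ← mul_assoc,
    Submodule.span_mul_span, Set.singleton_mul_singleton, inv_mul_cancel₀ hs0',
    ← Submodule.one_eq_span, one_mul]

variable (𝒜 K) in
/-- The subgroups that are direct sums of their components are the graded submodules. -/
theorem isHomogeneousSubgroup_iff {E : Submodule R K} :
    IsHomogeneousSubgroup 𝒜 K E.toAddSubgroup ↔ IsGraded 𝒜 E := by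
  constructor
  · intro h x hx
    have hx' : x ∈ E.toAddSubgroup := hx
    rw [h] at hx'
    clear hx
    induction hx' using AddSubgroup.iSup_induction' with
    | hp γ x hx =>
      have hh : IsHomFraction 𝒜 K x := ⟨γ, hx.2⟩
      refine ⟨hh.mem_homQuotientField 𝒜, ?_⟩
      rw [fracContent_homFraction 𝒜 hh, Submodule.span_singleton_le_iff_mem]
      exact hx.1
    | h1 => exact ⟨zero_mem _, by rw [fracContent_zero]; exact bot_le⟩
    | hadd x y _ _ hx hy =>
      exact ⟨add_mem hx.1 hy.1, (fracContent_add_le 𝒜 hx.1 hy.1).trans (sup_le hx.2 hy.2)⟩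
  · classical
    intro h
    apply le_antisymm
    · intro x hx
      have hx' : x ∈ E := hx
      rw [h.eq_span] at hx'
      have key : ∀ (c : R) (y : K), IsHomFraction 𝒜 K y → y ∈ E →
          c • y ∈ ⨆ γ, E.toAddSubgroup ⊓ homPiece 𝒜 K γ := by
        rintro c y ⟨γ, hγ⟩ hy
        rw [← DirectSum.sum_support_decompose 𝒜 c, Finset.sum_smul]
        refine sum_mem fun α _ => ?_
        refine AddSubgroup.mem_iSup_of_mem (Algebra.GrothendieckAddGroup.of α + γ)
          ⟨E.smul_mem _ hy, ?_⟩
        rw [Algebra.smul_def]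
        exact mul_mem_homPiece 𝒜 K (algebraMap_mem_homPiece 𝒜 K (SetLike.coe_mem _)) hγ
      obtain ⟨c, rfl⟩ := (Finsupp.mem_span_iff_linearCombination R _ _).1 hx'
      rw [Finsupp.linearCombination_apply, Finsupp.sum]
      exact sum_mem fun y _ => key _ _ y.2.1 y.2.2
    · exact iSup_le fun γ => inf_le_left

end HomogeneousFractions

/-! ### Maximal homogeneous quasi-`t`-ideals and their relation to `N_v(H)`. -/

theorem one_div_vOp {D K : Type*} [CommRing D] [Field K] [Algebra D K] (E : Submodule D K) :
    1 / vOp E = 1 / E :=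
  le_antisymm (one_div_anti (le_vOp E)) (le_vOp (1 / E))

theorem exists_fg_le_sup {A M : Type*} [CommRing A] [AddCommGroup M] [Module A M]
    {F N C : Submodule A M} (hF : F.FG) (h : F ≤ N ⊔ C) : ∃ L, L.FG ∧ L ≤ N ∧ F ≤ L ⊔ C := by
  induction F, hF using Submodule.fg_induction with
  | singleton x =>
    obtain ⟨y, hy, z, hz, hyz⟩ := Submodule.mem_sup.1 (h (Submodule.mem_span_singleton_self x))
    refine ⟨Submodule.span A {y}, Submodule.fg_span_singleton _,
      (Submodule.span_singleton_le_iff_mem _ _).2 hy, ?_⟩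
    rw [Submodule.span_singleton_le_iff_mem, ← hyz]
    exact Submodule.add_mem _ (Submodule.mem_sup_left (Submodule.mem_span_singleton_self y))
      (Submodule.mem_sup_right hz)
  | sup F₁ F₂ _ _ h₁ h₂ =>
    obtain ⟨L₁, hL₁, h₁, h₁'⟩ := h₁ (le_sup_left.trans h)
    obtain ⟨L₂, hL₂, h₂, h₂'⟩ := h₂ (le_sup_right.trans h)
    exact ⟨L₁ ⊔ L₂, hL₁.sup hL₂, sup_le h₁ h₂, sup_le
      (h₁'.trans (sup_le_sup_right le_sup_left _)) (h₂'.trans (sup_le_sup_right le_sup_right _))⟩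

section QuasiMaximal

variable {Γ R : Type*} [AddCancelCommMonoid Γ] [DecidableEq Γ] [CommRing R]
  {𝒜 : Γ → AddSubgroup R} [GradedRing 𝒜]

theorem exists_fg_isHomogeneous {L M : Ideal R} (hL : L.FG) (hM : M.IsHomogeneous 𝒜)
    (h : L ≤ M) : ∃ N : Ideal R, N.FG ∧ N.IsHomogeneous 𝒜 ∧ L ≤ N ∧ N ≤ M := by
  induction L, hL using Submodule.fg_induction with
  | singleton x =>
    refine ⟨contentIdeal 𝒜 x, contentIdeal_fg 𝒜 x, contentIdeal_isHomogeneous 𝒜 x, ?_, ?_⟩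
    · exact (Submodule.span_singleton_le_iff_mem _ _).2 (mem_contentIdeal 𝒜 x)
    · exact contentIdeal_le_of_mem 𝒜 hM (h (Submodule.mem_span_singleton_self x))
  | sup F₁ F₂ _ _ h₁ h₂ =>
    obtain ⟨L₁, hL₁, h₁, h₁', h₁''⟩ := h₁ (le_sup_left.trans h)
    obtain ⟨L₂, hL₂, h₂, h₂', h₂''⟩ := h₂ (le_sup_right.trans h)
    exact ⟨L₁ ⊔ L₂, Submodule.FG.sup hL₁ hL₂, h₁.sup h₂, sup_le_sup h₁' h₂', sup_le h₁'' h₂''⟩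

variable [IsDomain R] {K : Type*} [Field K] [Algebra R K] [IsFractionRing R K]

theorem coeSubmodule_le_iff {I J : Ideal R} :
    IsLocalization.coeSubmodule K I ≤ IsLocalization.coeSubmodule K J ↔ I ≤ J :=
  IsFractionRing.coeSubmodule_le_coeSubmodule

theorem comap_coeSubmodule (I : Ideal R) :
    (IsLocalization.coeSubmodule K I).comap (Algebra.linearMap R K) = I :=
  Submodule.comap_map_eq_of_injective (IsFractionRing.injective R K) I

theorem fg_of_coeSubmodule_fg {I : Ideal R} (h : (IsLocalization.coeSubmodule K I).FG) : I.FG := by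
  have := comap_fg (coeSubmodule_le_one I) h
  rwa [comap_coeSubmodule] at this

theorem isGV_coeSubmodule_top : IsGV (IsLocalization.coeSubmodule K (⊤ : Ideal R)) := by
  rw [IsLocalization.coeSubmodule_top]
  exact isGV_one

theorem IsProperHomQuasiTIdeal.not_isGV {P : Ideal R} (hP : IsProperHomQuasiTIdeal 𝒜 K P)
    (F : Ideal R) (hF : IsGV (IsLocalization.coeSubmodule K F)) : ¬ F ≤ P := by
  intro h
  refine hP.2.1 ((Ideal.eq_top_iff_one _).2 (hP.2.2.2 1 ?_))
  refine mem_tOp_iff.2 ⟨_, hF.1, IsLocalization.coeSubmodule_mono K h, ?_⟩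
  rw [vOp_eq_one_iff.2 hF.2.2, map_one]
  exact Submodule.one_le.1 le_rfl

/-- Zorn's lemma is run on homogeneous ideals containing no GV ideal. GV ideals are finitely
generated, so the condition survives unions of chains, and a maximal such ideal turns out to be a
quasi-`t`-ideal. -/
theorem exists_mem_hQMaxT {D : Ideal R} (hD : D.IsHomogeneous 𝒜) (h0 : D ≠ ⊥)
    (h : ∀ F : Ideal R, IsGV (IsLocalization.coeSubmodule K F) → ¬ F ≤ D) :
    ∃ P ∈ hQMaxT 𝒜 K, D ≤ P := by
  let S : Set (Ideal R) := {I | I.IsHomogeneous 𝒜 ∧ D ≤ I ∧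
    ∀ F : Ideal R, IsGV (IsLocalization.coeSubmodule K F) → ¬ F ≤ I}
  obtain ⟨M, hDM, hM⟩ := zorn_le_nonempty₀ S (fun c hcS hc y hy => by
    refine ⟨sSup c, ⟨Ideal.IsHomogeneous.sSup fun I hI => (hcS hI).1,
      (hcS hy).2.1.trans (le_sSup hy), fun F hF hle => ?_⟩, fun I hI => le_sSup hI⟩
    obtain ⟨I, hI, hFI⟩ := (CompleteLattice.isCompactElement_iff_le_of_directed_sSup_le _ F).1
      ((Submodule.fg_iff_compact F).1 (fg_of_coeSubmodule_fg hF.1)) c ⟨y, hy⟩ hc.directedOn hle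
    exact (hcS hI).2.2 F hF hFI) D ⟨hD, le_rfl, h⟩
  have hM0 : M ≠ ⊥ := fun h1 => h0 (le_bot_iff.1 (h1 ▸ hDM))
  refine ⟨M, ⟨⟨hM0, ?_, hM.prop.1, ?_⟩, ?_⟩, hDM⟩
  · rintro rfl
    exact hM.prop.2.2 ⊤ isGV_coeSubmodule_top le_rfl
  · intro r hr
    obtain ⟨G, hG, hGM, hr⟩ := mem_tOp_iff.1 hr
    have hG1 := hGM.trans (coeSubmodule_le_one M)
    suffices hS : M ⊔ contentIdeal 𝒜 r ∈ S from
      hM.le_of_ge hS le_sup_left (Ideal.mem_sup_right (mem_contentIdeal 𝒜 r))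
    refine ⟨hM.prop.1.sup (contentIdeal_isHomogeneous 𝒜 r), hDM.trans le_sup_left,
      fun F hF hle => ?_⟩
    obtain ⟨L, hL, hLM, hFL⟩ := exists_fg_le_sup (fg_of_coeSubmodule_fg hF.1) hle
    obtain ⟨m, hmM, hm0⟩ := Submodule.exists_mem_ne_zero_of_ne_bot hM0
    have hG' : (G.comap (Algebra.linearMap R K) : Ideal R) ≤ M := by
      rwa [← coeSubmodule_le_iff (K := K), coeSubmodule_comap hG1]
    -- Suppose M + C(r) contained a GV ideal F. A nonzero finitely generated homogeneous Q ⊆ M is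
    -- taken large enough that r ∈ Q^v and F ⊆ Q + C(r). As Q^v is graded it contains C(r), hence F;
    -- so Q⁻¹ = (Q^v)⁻¹ ⊆ F⁻¹ = R, and Q is a GV ideal inside M.
    obtain ⟨Q, hQ, hQhom, hle, hQM⟩ := exists_fg_isHomogeneous
      (Submodule.FG.sup (Submodule.FG.sup hL (comap_fg hG1 hG)) (Submodule.fg_span_singleton m))
      hM.prop.1 (sup_le (sup_le hLM hG') ((Submodule.span_singleton_le_iff_mem _ _).2 hmM))
    have hQ0 : IsLocalization.coeSubmodule K Q ≠ ⊥ := by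
      rw [Ne, coeSubmodule_eq_bot]
      rintro rfl
      exact hm0 (by simpa using le_sup_right.trans hle (Submodule.mem_span_singleton_self m))
    have hgr := ((isGraded_coeSubmodule (K := K) hQhom).one_div hQ0).one_div
      (one_div_ne_bot (coeSubmodule_fg hQ))
    have hGQ : G ≤ IsLocalization.coeSubmodule K Q := by
      rw [← coeSubmodule_comap hG1, coeSubmodule_le_iff]
      exact (le_sup_right.trans le_sup_left).trans hle
    have hrQ := (hgr _ (vOp_mono hGQ hr)).2
    rw [fracContent_algebraMap] at hrQ
    have hFQ : IsLocalization.coeSubmodule K F ≤ vOp (IsLocalization.coeSubmodule K Q) := by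
      refine (IsLocalization.coeSubmodule_mono K (hFL.trans (sup_le_sup_right
        ((le_sup_left.trans le_sup_left).trans hle) _))).trans ?_
      rw [IsLocalization.coeSubmodule_sup]
      exact sup_le (le_vOp _) hrQ
    refine hM.prop.2.2 Q ⟨coeSubmodule_fg hQ, hQ0, le_antisymm ?_ ?_⟩ hQM
    · rw [← one_div_vOp]
      exact (one_div_anti hFQ).trans_eq hF.2.2
    · exact one_div_one.symm.trans_le (one_div_anti (coeSubmodule_le_one Q))
  · intro P hP hMP
    exact hM.le_of_ge ⟨hP.2.2.1, hDM.trans hMP, hP.not_isGV⟩ hMP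

theorem isGV_contentIdeal_iff {f : R} (hf : f ≠ 0) :
    IsGV (IsLocalization.coeSubmodule K (contentIdeal 𝒜 f)) ↔
      vOp (IsLocalization.coeSubmodule K (contentIdeal 𝒜 f)) = 1 := by
  rw [vOp_eq_one_iff]
  refine ⟨fun h => h.2.2, fun h => ⟨coeSubmodule_fg (contentIdeal_fg 𝒜 f), ?_, h⟩⟩
  rw [Ne, coeSubmodule_eq_bot]
  exact contentIdeal_ne_bot 𝒜 hf

variable [IsAddTorsionFree Γ]

theorem mem_nagataSubmonoid_iff {f : R} : f ∈ nagataSubmonoid 𝒜 K ↔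
    IsGV (IsLocalization.coeSubmodule K (contentIdeal 𝒜 f)) := by
  constructor
  · rintro ⟨hf0, hf⟩
    exact (isGV_contentIdeal_iff hf0).2 hf
  · intro h
    have hf0 : f ≠ 0 := by
      rintro rfl
      apply h.2.1
      rw [← fracContent_algebraMap, map_zero, fracContent_zero]
    exact ⟨hf0, (isGV_contentIdeal_iff hf0).1 h⟩

theorem notMem_of_mem_nagataSubmonoid {P : Ideal R} (hP : P ∈ hQMaxT 𝒜 K) {f : R}
    (hf : f ∈ nagataSubmonoid 𝒜 K) : f ∉ P := fun hfP =>
  hP.prop.not_isGV _ (mem_nagataSubmonoid_iff.1 hf) (contentIdeal_le_of_mem 𝒜 hP.prop.2.2.1 hfP)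

/-- By maximality of P, the ideal P + C(f) lies in no member of h-QMax^t(R), so it contains a GV
ideal. Only a finitely generated homogeneous part of P is needed for that; it is a content C(p), and
C(f + u^k p) = C(f) + C(p) for a suitable k. -/
theorem exists_add_mem_nagataSubmonoid {α : Γ} (hα : α ≠ 0) {u : R} (hu : u ∈ 𝒜 α)
    (huu : IsUnit u) {P : Ideal R} (hP : P ∈ hQMaxT 𝒜 K) {f : R} (hf : f ∉ P) :
    ∃ p ∈ P, f + p ∈ nagataSubmonoid 𝒜 K := by
  have hD : ∃ F : Ideal R, IsGV (IsLocalization.coeSubmodule K F) ∧ F ≤ P ⊔ contentIdeal 𝒜 f := by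
    by_contra! h
    obtain ⟨Q, hQ, hle⟩ := exists_mem_hQMaxT
      (hP.prop.2.2.1.sup (contentIdeal_isHomogeneous 𝒜 f))
      (fun h0 => hP.prop.1 (le_bot_iff.1 (h0 ▸ le_sup_left))) h
    exact hf (hP.le_of_ge hQ.prop (le_sup_left.trans hle)
      (hle (Ideal.mem_sup_right (mem_contentIdeal 𝒜 f))))
  obtain ⟨F, hF, hle⟩ := hD
  obtain ⟨L, hL, hLP, hFL⟩ := exists_fg_le_sup (fg_of_coeSubmodule_fg hF.1) hle
  obtain ⟨N, hN, hNhom, hLN, hNP⟩ := exists_fg_isHomogeneous hL hP.prop.2.2.1 hLP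
  obtain ⟨p, rfl⟩ := exists_contentIdeal_eq 𝒜 hα hu huu hN hNhom
  obtain ⟨k, hk⟩ := exists_contentIdeal_add 𝒜 hα hu huu f p
  refine ⟨u ^ k * p, Ideal.mul_mem_left _ _ (hNP (mem_contentIdeal 𝒜 p)), ?_⟩
  rw [mem_nagataSubmonoid_iff, hk]
  refine hF.mono (IsLocalization.coeSubmodule_mono K (hFL.trans ?_)) (coeSubmodule_le_one _)
    (coeSubmodule_fg (Submodule.FG.sup (contentIdeal_fg 𝒜 f) hN))
  rw [sup_comm]
  exact sup_le_sup_left hLN _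

/-- Two elements outside P are congruent modulo P to elements of N_v(H). The product of these stays
in N_v(H), which is disjoint from P. -/
theorem isPrime_of_mem_hQMaxT {α : Γ} (hα : α ≠ 0) {u : R} (hu : u ∈ 𝒜 α)
    (huu : IsUnit u) {P : Ideal R} (hP : P ∈ hQMaxT 𝒜 K) : P.IsPrime := by
  refine ⟨hP.prop.2.1, fun {f g} hfg => ?_⟩
  by_contra! h
  obtain ⟨p, hp, hfp⟩ := exists_add_mem_nagataSubmonoid hα hu huu hP h.1
  obtain ⟨q, hq, hgq⟩ := exists_add_mem_nagataSubmonoid hα hu huu hP h.2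
  refine notMem_of_mem_nagataSubmonoid hP (mul_mem hfp hgq) ?_
  have e : (f + p) * (g + q) = f * g + (p * (g + q) + f * q) := by ring
  rw [e]
  exact P.add_mem hfg (P.add_mem (P.mul_mem_right _ hp) (P.mul_mem_left _ hq))

/-- A homogeneous finitely generated submodule is `t`-invertible if `I I⁻¹` is contained in no
maximal homogeneous quasi-`t`-ideal. -/
theorem IsGraded.isTInvertible {I : Submodule R K} (hI : IsGraded 𝒜 I) (hfg : I.FG) (h0 : I ≠ ⊥)
    (h : ∀ P ∈ hQMaxT 𝒜 K, ∃ s : R, s ∉ P ∧ algebraMap R K s ∈ I * (1 / I)) :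
    IsTInvertible I := by
  have hle := mul_one_div_le_one I
  set D : Ideal R := (I * (1 / I)).comap (Algebra.linearMap R K) with hD
  have hcoe : IsLocalization.coeSubmodule K D = I * (1 / I) := coeSubmodule_comap hle
  by_contra hcon
  obtain ⟨P, hP, hDP⟩ := exists_mem_hQMaxT (K := K) (D := D)
    (hI.mul (hI.one_div h0)).isHomogeneous_comap (fun hD0 => by
      rw [hD0, IsLocalization.coeSubmodule_bot] at hcoe
      exact mul_ne_bot h0 (one_div_ne_bot hfg) hcoe.symm)
    (fun F hF hFD => hcon ⟨_, hF, by rw [← hcoe]; exact IsLocalization.coeSubmodule_mono K hFD⟩)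
  obtain ⟨s, hs, hsI⟩ := h P hP
  exact hs (hDP hsI)

/-- Conversely, `I I⁻¹` is contained in no maximal homogeneous quasi-`t`-ideal if `I` is
`t`-invertible. -/
theorem IsGraded.exists_mem_homSubmonoid {I : Submodule R K} (hI : IsGraded 𝒜 I)
    (h' : IsTInvertible I) {P : Ideal R} (hP : P ∈ hQMaxT 𝒜 K) :
    ∃ s ∈ homSubmonoid 𝒜, s ∉ P ∧ algebraMap R K s ∈ I * (1 / I) := by
  obtain ⟨F, hF, hFI⟩ := id h'
  have hcoe := coeSubmodule_comap hF.le_one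
  have h1 := hP.prop.not_isGV (F.comap (Algebra.linearMap R K)) (by rwa [hcoe])
  obtain ⟨f, hfF, hfP⟩ := SetLike.not_le_iff_exists.1 h1
  have h2 : ¬ contentIdeal 𝒜 f ≤ P := fun h => hfP (h (mem_contentIdeal 𝒜 f))
  rw [contentIdeal_le_iff] at h2
  push Not at h2
  obtain ⟨β, hβ⟩ := h2
  refine ⟨_, (mem_homSubmonoid_iff 𝒜).2 ⟨⟨β, SetLike.coe_mem _⟩, fun h0 => hβ ?_⟩, hβ, ?_⟩
  · rw [h0]
    exact P.zero_mem
  · have h3 := ((hI.mul (hI.one_div h'.ne_bot)).isHomogeneous_comap) β (hFI hfF)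
    exact h3

end QuasiMaximal

/-! ### Consequences of the graded P`v`MD property: the content formula and the Kronecker function
ring. -/

theorem exists_fg_le_mul {D K : Type*} [CommRing D] [Field K] [Algebra D K]
    {F G V : Submodule D K} (hF : F.FG) (h : F ≤ G * V) :
    ∃ W, W.FG ∧ W ≤ V ∧ F ≤ G * W := by
  induction F, hF using Submodule.fg_induction with
  | singleton x =>
    have hx := h (Submodule.mem_span_singleton_self x)
    simp only [Submodule.span_singleton_le_iff_mem]
    refine Submodule.mul_induction_on hx (fun g hg v hv => ?_) ?_
    · exact ⟨Submodule.span D {v}, Submodule.fg_span_singleton v,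
        (Submodule.span_singleton_le_iff_mem _ _).2 hv,
        Submodule.mul_mem_mul hg (Submodule.mem_span_singleton_self v)⟩
    · rintro x y ⟨W₁, h₁, h₁', h₁''⟩ ⟨W₂, h₂, h₂', h₂''⟩
      refine ⟨W₁ ⊔ W₂, h₁.sup h₂, sup_le h₁' h₂', ?_⟩
      rw [Submodule.mul_sup]
      exact Submodule.add_mem_sup h₁'' h₂''
  | sup F₁ F₂ _ _ h₁ h₂ =>
    obtain ⟨W₁, h₁, h₁', h₁''⟩ := h₁ (le_sup_left.trans h)
    obtain ⟨W₂, h₂, h₂', h₂''⟩ := h₂ (le_sup_right.trans h)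
    refine ⟨W₁ ⊔ W₂, h₁.sup h₂, sup_le h₁' h₂', ?_⟩
    rw [Submodule.mul_sup]
    exact sup_le_sup h₁'' h₂''

section GradedPvMD

variable {Γ R : Type*} [AddCancelCommMonoid Γ] [DecidableEq Γ] [CommRing R]
  {𝒜 : Γ → AddSubgroup R} [GradedRing 𝒜] [IsDomain R] {K : Type*} [Field K] [Algebra R K]
  [IsFractionRing R K]

theorem IsGraded.exists_fg {W V : Submodule R K} (hW : W.FG) (hV : IsGraded 𝒜 V) (h : W ≤ V) :
    ∃ W', W'.FG ∧ IsGraded 𝒜 W' ∧ W ≤ W' ∧ W' ≤ V := by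
  induction W, hW using Submodule.fg_induction with
  | singleton x =>
    have hx := hV x (h (Submodule.mem_span_singleton_self x))
    exact ⟨_, fracContent_fg 𝒜 hx.1, isGraded_fracContent hx.1,
      (Submodule.span_singleton_le_iff_mem _ _).2 (mem_fracContent 𝒜 hx.1), hx.2⟩
  | sup F₁ F₂ _ _ h₁ h₂ =>
    obtain ⟨L₁, hL₁, h₁, h₁', h₁''⟩ := h₁ (le_sup_left.trans h)
    obtain ⟨L₂, hL₂, h₂, h₂', h₂''⟩ := h₂ (le_sup_right.trans h)
    exact ⟨L₁ ⊔ L₂, hL₁.sup hL₂, h₁.sup h₂, sup_le_sup h₁' h₂', sup_le h₁'' h₂''⟩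

theorem isGradedPvMD_iff : IsGradedPvMD 𝒜 K ↔ ∀ I : Ideal R, I.FG → I ≠ ⊥ → I.IsHomogeneous 𝒜 →
    IsTInvertible (IsLocalization.coeSubmodule K I) := by
  refine forall₄_congr fun I hI h0 _ => tOp_mul_one_div_eq_one_iff (coeSubmodule_fg hI) ?_
  rwa [Ne, coeSubmodule_eq_bot]

theorem IsGradedPvMD.isTInvertible (h : IsGradedPvMD 𝒜 K) {E : Submodule R K}
    (hE : IsGraded 𝒜 E) (hfg : E.FG) (h0 : E ≠ ⊥) : IsTInvertible E := by
  obtain ⟨s, hs, hs1⟩ := exists_homSubmonoid_mul_le_one hfg fun x hx => (hE x hx).1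
  obtain ⟨⟨β, hβ⟩, -⟩ := (mem_homSubmonoid_iff 𝒜).1 hs
  have hs0 := algebraMap_ne_zero_of_mem_homSubmonoid 𝒜 K hs
  have hgr : IsGraded 𝒜 (Submodule.span R {algebraMap R K s} * E) := (isGraded_span 𝒜 (by
    rintro _ rfl
    exact isHomFraction_algebraMap 𝒜 K hβ)).mul hE
  have hcoe := coeSubmodule_comap hs1
  have := isGradedPvMD_iff.1 h _ (comap_fg hs1 ((Submodule.fg_span_singleton _).mul hfg))
    (fun hb => by
      rw [hb, IsLocalization.coeSubmodule_bot] at hcoe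
      exact mul_ne_bot (by simpa using hs0) h0 hcoe.symm) hgr.isHomogeneous_comap
  rw [hcoe, mul_comm] at this
  exact this.of_mul

theorem isGradedPvMD_of_pair (h : ∀ x y : K, IsHomFraction 𝒜 K x → IsHomFraction 𝒜 K y →
    x ≠ 0 → y ≠ 0 → IsTInvertible (Submodule.span R {x, y})) : IsGradedPvMD 𝒜 K := by
  classical
  rw [isGradedPvMD_iff]
  intro I hI h0 hhom
  obtain ⟨T, hT, hIT⟩ := (isGraded_coeSubmodule (K := K) hhom).exists_finset (coeSubmodule_fg hI)
  have hspan : Submodule.span R (T : Set K) = Submodule.span R ((T.erase 0 : Finset K) : Set K) := by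
    rw [Finset.coe_erase, Submodule.span_sdiff_singleton_zero]
  rw [hIT, hspan]
  refine isTInvertible_span_finset (S := {x | IsHomFraction 𝒜 K x ∧ x ≠ 0})
    (fun a ha b hb => h a b ha.1 hb.1 ha.2 hb.2) _ ?_ ?_
  · rw [Finset.nonempty_iff_ne_empty]
    intro he
    rw [he, Finset.coe_empty, Submodule.span_empty] at hspan
    rw [hspan, coeSubmodule_eq_bot] at hIT
    exact h0 hIT
  · intro x hx
    rw [Finset.mem_coe, Finset.mem_erase] at hx
    exact ⟨hT x hx.2, hx.1⟩

/-- In a graded P`v`MD, contents are multiplicative up to the `w`-operation. -/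
theorem IsGradedPvMD.fracContent_mul_le [IsAddTorsionFree Γ] (h : IsGradedPvMD 𝒜 K) {x y : K}
    (hx : x ∈ homQuotientField 𝒜 K) (hy : y ∈ homQuotientField 𝒜 K) :
    fracContent 𝒜 K x * fracContent 𝒜 K y ≤ wOp (fracContent 𝒜 K (x * y)) := by
  by_cases hy0 : y = 0
  · rw [hy0, fracContent_zero, Submodule.mul_bot]
    exact bot_le
  set G := fracContent 𝒜 K y with hG
  have hGgr : IsGraded 𝒜 G := isGraded_fracContent hy
  have hG0 : G ≠ ⊥ := fracContent_ne_bot 𝒜 hy hy0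
  obtain ⟨F, hF, hFG⟩ := h.isTInvertible hGgr (fracContent_fg 𝒜 hy) hG0
  set A := fracContent 𝒜 K x * G with hA
  set B := fracContent 𝒜 K (x * y) with hB
  -- The elements of R multiplying C(x) C(y) into C(xy). Once the radical of this ideal contains a
  -- GV ideal, some power of that GV ideal lies in it and witnesses the claim.
  let 𝔞 : Ideal R := (B / A).comap (Algebra.linearMap R K)
  have hrad : G * (1 / G) ≤ IsLocalization.coeSubmodule K 𝔞.radical := by
    rw [(hGgr.one_div hG0).eq_span, Submodule.mul_le]
    intro g hg z hz
    refine Submodule.span_induction (p := fun z _ => g * z ∈ _) ?_ ?_ ?_ ?_ hz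
    · rintro z ⟨hzh, hz⟩
      rw [mem_one_div] at hz
      -- For homogeneous z ∈ G⁻¹, f = zy lies in R and has content zG. Dedekind–Mertens reads C(x)
      -- (zG)^m ⊆ z C(xy); multiplied by G, and using zG ⊆ R, this puts (gz)^m in 𝔞 for every g ∈ G.
      obtain ⟨f, hf⟩ := Submodule.mem_one.1 (hz y (mem_fracContent 𝒜 hy))
      obtain ⟨r, hr⟩ := Submodule.mem_one.1 (hz g hg)
      obtain ⟨m, hm⟩ := exists_fracContent_mul_pow_le 𝒜 hx f
      have hxy : x * algebraMap R K f = z * (x * y) := by rw [hf]; ring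
      rw [hxy, fracContent_homFraction_mul 𝒜 hzh (mul_mem hx hy), hf,
        fracContent_homFraction_mul 𝒜 hzh hy] at hm
      have hzG : Submodule.span R {z} * G ≤ 1 := by
        rw [Submodule.mul_le]
        intro a ha b hb
        obtain ⟨c, rfl⟩ := Submodule.mem_span_singleton.1 ha
        rw [smul_mul_assoc]
        exact Submodule.smul_mem _ c (hz b hb)
      have key : A * (Submodule.span R {z} * G) ^ m ≤ B := by
        calc A * (Submodule.span R {z} * G) ^ m
            = (fracContent 𝒜 K x * (Submodule.span R {z} * G) ^ m) * G := by rw [hA]; ring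
          _ ≤ (Submodule.span R {z} * B) * G := by gcongr
          _ = (Submodule.span R {z} * G) * B := by ring
          _ ≤ 1 * B := by gcongr
          _ = B := one_mul B
      refine ⟨r, ⟨m, ?_⟩, by rw [Algebra.linearMap_apply, hr, mul_comm]⟩
      change algebraMap R K (r ^ m) ∈ B / A
      rw [Submodule.mem_div_iff_forall_mul_mem]
      intro a ha
      rw [mul_comm, map_pow, hr]
      exact key (Submodule.mul_mem_mul ha (Submodule.pow_mem_pow _
        (Submodule.mul_mem_mul (Submodule.mem_span_singleton_self z) hg) m))
    · rw [mul_zero]; exact zero_mem _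
    · intro a b _ _ ha hb
      rw [mul_add]; exact add_mem ha hb
    · intro c a _ ha
      rw [mul_smul_comm]; exact Submodule.smul_mem _ c ha
  have hle : (F.comap (Algebra.linearMap R K) : Ideal R) ≤ 𝔞.radical := by
    rw [← coeSubmodule_le_iff (K := K), coeSubmodule_comap hF.le_one]
    exact hFG.trans hrad
  obtain ⟨n, hn⟩ := Ideal.exists_pow_le_of_le_radical_of_fg hle (comap_fg hF.le_one hF.1)
  have hpow : ∀ I : Ideal R, IsLocalization.coeSubmodule K (I ^ n) =
      IsLocalization.coeSubmodule K I ^ n := fun I => by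
    clear hn
    induction n with
    | zero => rw [pow_zero, pow_zero, Ideal.one_eq_top, IsLocalization.coeSubmodule_top]
    | succ m ih => rw [pow_succ, pow_succ, ← ih, IsLocalization.coeSubmodule_mul]
  have hn' := IsLocalization.coeSubmodule_mono K hn
  rw [hpow, coeSubmodule_comap hF.le_one] at hn'
  refine le_wOp_of_mul_le (hF.pow n) ?_
  rw [Submodule.mul_le]
  intro a ha j hj
  obtain ⟨r, hr, rfl⟩ := hn' hj
  rw [mul_comm]
  exact Submodule.mem_div_iff_forall_mul_mem.1 hr a ha

variable [IsAddTorsionFree Γ]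

theorem IsGradedPvMD.wOp_fracContent_mul (h : IsGradedPvMD 𝒜 K) {x y : K}
    (hx : x ∈ homQuotientField 𝒜 K) (hy : y ∈ homQuotientField 𝒜 K) :
    wOp (fracContent 𝒜 K x * fracContent 𝒜 K y) = wOp (fracContent 𝒜 K (x * y)) :=
  le_antisymm (wOp_le_wOp_iff.2 (h.fracContent_mul_le hx hy))
    (wOp_mono (GradedDomain.fracContent_mul_le 𝒜 hx hy))

/-- Write x/y = xw/(yw), where C(w) ⊆ C(y)⁻¹ is finitely generated and C(y) C(w) contains a GV
submodule. Then xw ∈ R because C(x) ⊆ C(y)^w, and yw ∈ N_v(H) by the content formula. -/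
theorem IsGradedPvMD.div_mem_nagataRing (h : IsGradedPvMD 𝒜 K)
    (hunit : ∃ α : Γ, α ≠ 0 ∧ ∃ u ∈ 𝒜 α, IsUnit u) {x y : K}
    (hx : x ∈ homQuotientField 𝒜 K) (hy : y ∈ homQuotientField 𝒜 K) (hy0 : y ≠ 0)
    (hxy : fracContent 𝒜 K x ≤ wOp (fracContent 𝒜 K y)) : x / y ∈ nagataRing 𝒜 K := by
  obtain ⟨α, hα, u, hu, huu⟩ := hunit
  set G := fracContent 𝒜 K y with hG
  have hGgr : IsGraded 𝒜 G := isGraded_fracContent hy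
  have hG0 : G ≠ ⊥ := fracContent_ne_bot 𝒜 hy hy0
  obtain ⟨F, hF, hFG⟩ := h.isTInvertible hGgr (fracContent_fg 𝒜 hy) hG0
  obtain ⟨W, hW, hWG, hFW⟩ := exists_fg_le_mul hF.1 hFG
  obtain ⟨W', hW', hgr, hWW', hWG'⟩ := IsGraded.exists_fg hW (hGgr.one_div hG0) hWG
  obtain ⟨w, hw, rfl⟩ := hgr.exists_fracContent_eq hα hu huu hW'
  have hGW := le_one_div_iff.1 hWG'
  have hxw : fracContent 𝒜 K (x * w) ≤ 1 := by
    calc fracContent 𝒜 K (x * w) ≤ fracContent 𝒜 K x * fracContent 𝒜 K w :=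
          GradedDomain.fracContent_mul_le 𝒜 hx hw
      _ ≤ wOp G * fracContent 𝒜 K w := by gcongr
      _ = fracContent 𝒜 K w * wOp G := mul_comm _ _
      _ ≤ wOp (fracContent 𝒜 K w * G) := mul_wOp_le _ _
      _ ≤ wOp 1 := wOp_mono (by rwa [mul_comm])
      _ = 1 := wOp_one
  have hyw : fracContent 𝒜 K (y * w) ≤ 1 :=
    (GradedDomain.fracContent_mul_le 𝒜 hy hw).trans hGW
  obtain ⟨a, ha⟩ := Submodule.mem_one.1 (hxw (mem_fracContent 𝒜 (mul_mem hx hw)))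
  obtain ⟨n, hn⟩ := Submodule.mem_one.1 (hyw (mem_fracContent 𝒜 (mul_mem hy hw)))
  have hFle : F ≤ wOp (fracContent 𝒜 K (y * w)) :=
    hFW.trans ((mul_le_mul' le_rfl hWW').trans (h.fracContent_mul_le hy hw))
  obtain ⟨J, hJ, hFJ⟩ := exists_isGV_mul_le hF.1 hFle
  have hgv : IsGV (fracContent 𝒜 K (y * w)) :=
    (hF.mul hJ).mono hFJ hyw (fracContent_fg 𝒜 (mul_mem hy hw))
  have hw0 : w ≠ 0 := by
    rintro rfl
    apply hgv.2.1
    rw [mul_zero, fracContent_zero]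
  rw [← hn, fracContent_algebraMap] at hgv
  refine (mem_ofField_iff K).2 ⟨a, n, mem_nagataSubmonoid_iff.2 hgv, ?_⟩
  rw [ha, hn, mul_div_mul_right _ _ hw0]

theorem IsGradedPvMD.div_mem_nagataRing' (h : IsGradedPvMD 𝒜 K)
    (hunit : ∃ α : Γ, α ≠ 0 ∧ ∃ u ∈ 𝒜 α, IsUnit u) {f g : R} (hg : g ≠ 0)
    (hfg : contentIdeal 𝒜 f ≤ contentIdeal 𝒜 g) :
    algebraMap R K f / algebraMap R K g ∈ nagataRing 𝒜 K := by
  refine h.div_mem_nagataRing hunit (algebraMap_mem _ f) (algebraMap_mem _ g)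
    (by simpa using hg) ?_
  rw [fracContent_algebraMap, fracContent_algebraMap]
  exact (IsLocalization.coeSubmodule_mono K hfg).trans (le_wOp _)

theorem nagataRing_subset_Kr : (nagataRing 𝒜 K : Set K) ⊆ Kr 𝒜 K := by
  intro x hx
  obtain ⟨f, n, hn, rfl⟩ := (mem_ofField_iff K).1 hx
  refine ⟨f, n, hn.1, rfl, 1, one_ne_zero, ?_⟩
  have h1 : contentIdeal 𝒜 (1 : R) = ⊤ :=
    (Ideal.eq_top_iff_one _).2 (mem_contentIdeal 𝒜 1)
  rw [h1, Ideal.mul_top, Ideal.mul_top]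
  refine (coeSubmodule_le_one _).trans (le_wOp_of_mul_le (mem_nagataSubmonoid_iff.1 hn) ?_)
  rw [one_mul]

/-- In the condition defining Kr(R, w), the auxiliary content C(h) is `t`-invertible and can be
cancelled modulo `w`. -/
theorem IsGradedPvMD.nagataRing_eq_Kr (h : IsGradedPvMD 𝒜 K)
    (hunit : ∃ α : Γ, α ≠ 0 ∧ ∃ u ∈ 𝒜 α, IsUnit u) :
    (nagataRing 𝒜 K : Set K) = Kr 𝒜 K := by
  refine nagataRing_subset_Kr.antisymm ?_
  rintro _ ⟨f, g, hg, rfl, l, hl, hle⟩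
  refine h.div_mem_nagataRing hunit (algebraMap_mem _ f) (algebraMap_mem _ g)
    (by simpa using hg) ?_
  rw [fracContent_algebraMap, fracContent_algebraMap]
  rw [IsLocalization.coeSubmodule_mul, IsLocalization.coeSubmodule_mul] at hle
  refine (h.isTInvertible (isGraded_coeSubmodule (contentIdeal_isHomogeneous 𝒜 l))
    (coeSubmodule_fg (contentIdeal_fg 𝒜 l)) ?_).le_wOp_of_mul_le hle
  rw [Ne, coeSubmodule_eq_bot]
  exact contentIdeal_ne_bot 𝒜 hl

end GradedPvMD

/-! ### Invertibility in rings of fractions and extension of submodules to overrings. -/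

theorem IsPruferDomain.of_isBezout {D K : Type*} [CommRing D] [IsDomain D] [Field K] [Algebra D K]
    [IsFractionRing D K] (h : IsBezout D) : IsPruferDomain D K := by
  intro I hI h0
  obtain ⟨d, hd, hdI⟩ := exists_smul_le_one hI
  have hd0 : algebraMap D K d ≠ 0 := by simpa using hd
  have hle : Submodule.span D {algebraMap D K d} * I ≤ 1 := by
    rw [Submodule.mul_le]
    intro a ha b hb
    obtain ⟨c, rfl⟩ := Submodule.mem_span_singleton.1 ha
    rw [smul_mul_assoc]
    exact Submodule.smul_mem _ c (hdI b hb)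
  obtain ⟨c, hc⟩ := (h.isPrincipal_of_FG _
    (comap_fg hle ((Submodule.fg_span_singleton _).mul hI))).principal
  have hcoe := coeSubmodule_comap hle
  rw [hc, Ideal.submodule_span_eq, IsLocalization.coeSubmodule_span_singleton] at hcoe
  have hc0 : algebraMap D K c ≠ 0 := by
    intro hc0
    rw [hc0, Submodule.span_zero_singleton] at hcoe
    exact mul_ne_bot (by simpa using hd0) h0 hcoe.symm
  refine le_antisymm (mul_one_div_le_one I) ?_
  have h1 : I * Submodule.span D {algebraMap D K d / algebraMap D K c} = 1 := by
    have : Submodule.span D {algebraMap D K d / algebraMap D K c} =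
        Submodule.span D {algebraMap D K d} * Submodule.span D {(algebraMap D K c)⁻¹} := by
      rw [Submodule.span_mul_span, Set.singleton_mul_singleton, div_eq_mul_inv]
    rw [this, ← mul_assoc, mul_comm I, ← hcoe, Submodule.span_mul_span,
      Set.singleton_mul_singleton, mul_inv_cancel₀ hc0, ← Submodule.one_eq_span]
  exact h1.symm.trans_le (mul_le_mul' le_rfl (le_one_div_iff.2 h1.le))

section Localization

variable {R K : Type*} [CommRing R] [IsDomain R] [Field K] [Algebra R K]
  [IsFractionRing R K] {S : Submonoid R} {hS : S ≤ nonZeroDivisors R}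

theorem algebraMap_ne_zero_of_mem (hS : S ≤ nonZeroDivisors R) {s : R} (hs : s ∈ S) :
    algebraMap R K s ≠ 0 := by
  simpa using nonZeroDivisors.ne_zero (hS hs)

theorem exists_mul_mem_of_mem_span {E : Submodule R K} {x : K}
    (hx : x ∈ Submodule.span (Localization.subalgebra.ofField K S hS) (E : Set K)) :
    ∃ s ∈ S, algebraMap R K s * x ∈ E := by
  induction hx using Submodule.span_induction with
  | mem x hx => exact ⟨1, one_mem S, by simpa using hx⟩
  | zero => exact ⟨1, one_mem S, by simp⟩
  | add x y _ _ hx hy =>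
    obtain ⟨s, hs, hx⟩ := hx
    obtain ⟨t, ht, hy⟩ := hy
    refine ⟨s * t, mul_mem hs ht, ?_⟩
    have : algebraMap R K (s * t) * (x + y) =
        t • (algebraMap R K s * x) + s • (algebraMap R K t * y) := by
      rw [Algebra.smul_def, Algebra.smul_def, map_mul]
      ring
    rw [this]
    exact E.add_mem (E.smul_mem _ hx) (E.smul_mem _ hy)
  | smul c x _ hx =>
    obtain ⟨s, hs, hx⟩ := hx
    obtain ⟨c, hc⟩ := c
    obtain ⟨a, t, ht, rfl⟩ := (mem_ofField_iff K).1 hc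
    refine ⟨t * s, mul_mem ht hs, ?_⟩
    have ht0 := algebraMap_ne_zero_of_mem (K := K) hS ht
    have : algebraMap R K (t * s) * ((algebraMap R K a / algebraMap R K t) * x) =
        a • (algebraMap R K s * x) := by
      rw [Algebra.smul_def, map_mul]
      field_simp
    rw [Subalgebra.smul_def, smul_eq_mul, this]
    exact E.smul_mem a hx

theorem exists_mul_mem_one_of_fg {M : Submodule R K} (hM : M.FG)
    (h : ∀ x ∈ M, x ∈ Localization.subalgebra.ofField K S hS) :
    ∃ s ∈ S, ∀ x ∈ M, algebraMap R K s * x ∈ (1 : Submodule R K) := by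
  induction M, hM using Submodule.fg_induction with
  | singleton x =>
    obtain ⟨a, s, hs, rfl⟩ := (mem_ofField_iff K).1 (h x (Submodule.mem_span_singleton_self x))
    refine ⟨s, hs, fun y hy => ?_⟩
    obtain ⟨c, rfl⟩ := Submodule.mem_span_singleton.1 hy
    rw [mul_smul_comm, mul_div_cancel₀ _ (algebraMap_ne_zero_of_mem hS hs)]
    exact Submodule.smul_mem _ c (Submodule.mem_one.2 ⟨a, rfl⟩)
  | sup M N _ _ hM hN =>
    obtain ⟨s, hs, hM⟩ := hM fun x hx => h x (Submodule.mem_sup_left hx)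
    obtain ⟨t, ht, hN⟩ := hN fun x hx => h x (Submodule.mem_sup_right hx)
    refine ⟨s * t, mul_mem hs ht, fun x hx => ?_⟩
    obtain ⟨m, hm, n, hn, rfl⟩ := Submodule.mem_sup.1 hx
    have : algebraMap R K (s * t) * (m + n) =
        t • (algebraMap R K s * m) + s • (algebraMap R K t * n) := by
      rw [Algebra.smul_def, Algebra.smul_def, map_mul]
      ring
    rw [this]
    exact Submodule.add_mem _ (Submodule.smul_mem _ _ (hM m hm)) (Submodule.smul_mem _ _ (hN n hn))

/-- If `I` becomes invertible in a ring of fractions `R_S`, then `I I⁻¹` meets `S`. -/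
theorem exists_mem_mul_one_div {I : Submodule R K} (hI : I.FG)
    (h : Submodule.span (Localization.subalgebra.ofField K S hS) (I : Set K) *
      (1 / Submodule.span (Localization.subalgebra.ofField K S hS) (I : Set K)) = 1) :
    ∃ s ∈ S, algebraMap R K s ∈ I * (1 / I) := by
  set IT := Submodule.span (Localization.subalgebra.ofField K S hS) (I : Set K) with hIT
  have h1 : (1 : K) ∈ IT * (1 / IT) := by
    rw [h]
    exact Submodule.one_le.1 le_rfl
  have key : ∀ x ∈ IT * (1 / IT), ∃ s ∈ S, algebraMap R K s * x ∈ I * (1 / I) := by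
    intro x hx
    induction hx using Submodule.mul_induction_on' with
    | mem_mul_mem a ha b hb =>
      obtain ⟨s, hs, hsa⟩ := exists_mul_mem_of_mem_span ha
      have hfg : (Submodule.span R {b} * I).FG := (Submodule.fg_span_singleton b).mul hI
      obtain ⟨t, ht, htb⟩ := exists_mul_mem_one_of_fg (S := S) (hS := hS) hfg (by
        intro x hx
        induction hx using Submodule.mul_induction_on' with
        | mem_mul_mem m hm n hn =>
          obtain ⟨c, rfl⟩ := Submodule.mem_span_singleton.1 hm
          have := mem_one_div.1 hb n (Submodule.subset_span hn)
          obtain ⟨⟨y, hy⟩, hyn⟩ := Submodule.mem_one.1 this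
          rw [smul_mul_assoc, ← hyn]
          exact Subalgebra.smul_mem _ hy c
        | add x _ y _ hx hy => exact add_mem hx hy)
      refine ⟨s * t, mul_mem hs ht, ?_⟩
      have : algebraMap R K (s * t) * (a * b) =
          (algebraMap R K s * a) * (algebraMap R K t * b) := by
        rw [map_mul]
        ring
      rw [this]
      refine Submodule.mul_mem_mul hsa (mem_one_div.2 fun y hy => ?_)
      rw [mul_assoc]
      exact htb _ (Submodule.mul_mem_mul (Submodule.mem_span_singleton_self b) hy)
    | add x _ y _ hx hy =>
      obtain ⟨s, hs, hx⟩ := hx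
      obtain ⟨t, ht, hy⟩ := hy
      refine ⟨s * t, mul_mem hs ht, ?_⟩
      have : algebraMap R K (s * t) * (x + y) =
          t • (algebraMap R K s * x) + s • (algebraMap R K t * y) := by
        rw [Algebra.smul_def, Algebra.smul_def, map_mul]
        ring
      rw [this]
      exact Submodule.add_mem _ (Submodule.smul_mem _ _ hx) (Submodule.smul_mem _ _ hy)
  obtain ⟨s, hs, hs'⟩ := key 1 h1
  exact ⟨s, hs, by simpa using hs'⟩

theorem span_ne_bot {T : Subalgebra R K} {I : Submodule R K} (h : I ≠ ⊥) :
    Submodule.span T (I : Set K) ≠ ⊥ := by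
  obtain ⟨x, hx, hx0⟩ := Submodule.exists_mem_ne_zero_of_ne_bot h
  intro h0
  have : x ∈ Submodule.span T (I : Set K) := Submodule.subset_span hx
  rw [h0] at this
  exact hx0 (by simpa using this)

theorem span_fg {T : Subalgebra R K} {I : Submodule R K} (h : I.FG) :
    (Submodule.span T (I : Set K)).FG := by
  obtain ⟨s, rfl⟩ := h
  refine ⟨s, ?_⟩
  apply le_antisymm
  · exact Submodule.span_mono Submodule.subset_span
  · rw [Submodule.span_le]
    intro x hx
    exact Submodule.span_le_restrictScalars R T _ hx

/-- The `T`-submodule generated by an `R`-submodule, as an `R`-submodule. -/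
theorem restrictScalars_span (T : Subalgebra R K) (I : Submodule R K) :
    (Submodule.span T (I : Set K)).restrictScalars R = Subalgebra.toSubmodule T * I := by
  apply le_antisymm
  · intro x hx
    rw [Submodule.restrictScalars_mem] at hx
    induction hx using Submodule.span_induction with
    | mem x hx =>
      have := Submodule.mul_mem_mul (M := Subalgebra.toSubmodule T) (one_mem T) hx
      rwa [one_mul] at this
    | zero => exact zero_mem _
    | add x y _ _ hx hy => exact add_mem hx hy
    | smul c x _ hx =>
      rw [Subalgebra.smul_def, smul_eq_mul]
      have h1 : (c : K) * x ∈ Subalgebra.toSubmodule T * (Subalgebra.toSubmodule T * I) :=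
        Submodule.mul_mem_mul c.2 hx
      rwa [← mul_assoc, (Subalgebra.isIdempotentElem_toSubmodule T).eq] at h1
  · rw [Submodule.mul_le]
    intro t ht x hx
    exact Submodule.smul_mem _ (⟨t, ht⟩ : T) (Submodule.subset_span hx)

end Localization

/-! ### The conditions on `R_{N_v(H)}`, on `R_P` and on `R_{H \ P}`. -/

section Implications

variable {Γ R : Type*} [AddCancelCommMonoid Γ] [IsAddTorsionFree Γ] [DecidableEq Γ] [CommRing R]
  {𝒜 : Γ → AddSubgroup R} [GradedRing 𝒜] [IsDomain R] {K : Type*} [Field K] [Algebra R K]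
  [IsFractionRing R K]

/-- Some n ∈ N_v(H) lies in I I⁻¹; since that module is graded, it contains the GV ideal C(n). -/
theorem IsGradedPvMD.of_isPruferDomain_nagataRing (h : IsPruferDomain (nagataRing 𝒜 K) K) :
    IsGradedPvMD 𝒜 K := by
  rw [isGradedPvMD_iff]
  intro I hI h0 hhom
  have hI0 : IsLocalization.coeSubmodule K I ≠ ⊥ := mt (coeSubmodule_eq_bot (K := K)).1 h0
  have hfg := coeSubmodule_fg (K := K) hI
  obtain ⟨n, hn, hnI⟩ := exists_mem_mul_one_div hfg (h _ (span_fg hfg) (span_ne_bot hI0))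
  have hgr := isGraded_coeSubmodule (K := K) hhom
  have h1 := ((hgr.mul (hgr.one_div hI0)) _ hnI).2
  rw [fracContent_algebraMap] at h1
  exact ⟨_, mem_nagataSubmonoid_iff.1 hn, h1⟩

theorem IsGradedPvMD.of_valuationRing (h : ∀ P ∈ hQMaxT 𝒜 K, ∃ _ : P.IsPrime,
    ValuationRing (localizationAt K P)) : IsGradedPvMD 𝒜 K := by
  rw [isGradedPvMD_iff]
  intro I hI h0 hhom
  have hI0 : IsLocalization.coeSubmodule K I ≠ ⊥ := mt (coeSubmodule_eq_bot (K := K)).1 h0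
  have hfg := coeSubmodule_fg (K := K) hI
  refine (isGraded_coeSubmodule hhom).isTInvertible hfg hI0 fun P hP => ?_
  obtain ⟨hprime, hval⟩ := h P hP
  have hprf : IsPruferDomain (localizationAt K P) K := .of_isBezout inferInstance
  exact exists_mem_mul_one_div hfg (hprf _ (span_fg hfg) (span_ne_bot hI0))

theorem isGraded_homLocalization (P : Ideal R) [P.IsPrime] :
    IsGraded 𝒜 (Subalgebra.toSubmodule (homLocalization 𝒜 K P)) := by
  intro x hx
  have hx' : x ∈ homLocalization 𝒜 K P := hx
  obtain ⟨a, s, hs, rfl⟩ := (mem_ofField_iff K).1 hx'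
  refine ⟨(mem_homQuotientField_iff 𝒜 K).2 ⟨a, s, hs.1, rfl⟩, ?_⟩
  rw [fracContent_div 𝒜 K a hs.1, Submodule.span_le]
  rintro _ ⟨β, rfl⟩
  have : algebraMap R K (DirectSum.decompose 𝒜 a β) / algebraMap R K s ∈
      homLocalization 𝒜 K P := (mem_ofField_iff K).2 ⟨_, s, hs, rfl⟩
  exact this

theorem IsGradedPvMD.of_isGradedPruferDomain (h : ∀ P ∈ hQMaxT 𝒜 K, ∃ _ : P.IsPrime,
    IsGradedPruferDomain 𝒜 K (homLocalization 𝒜 K P)) : IsGradedPvMD 𝒜 K := by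
  rw [isGradedPvMD_iff]
  intro I hI h0 hhom
  have hI0 : IsLocalization.coeSubmodule K I ≠ ⊥ := mt (coeSubmodule_eq_bot (K := K)).1 h0
  have hfg := coeSubmodule_fg (K := K) hI
  refine (isGraded_coeSubmodule hhom).isTInvertible hfg hI0 fun P hP => ?_
  obtain ⟨hprime, hprf⟩ := h P hP
  have h1 : Submodule.span (homLocalization 𝒜 K P) (IsLocalization.coeSubmodule K I : Set K) ≤ 1 := by
    rw [Submodule.span_le]
    intro x hx
    obtain ⟨r, rfl⟩ := Submodule.mem_one.1 (coeSubmodule_le_one I hx)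
    exact Submodule.mem_one.2 ⟨algebraMap R _ r, rfl⟩
  have h2 := (isHomogeneousSubgroup_iff 𝒜 K).2
    ((isGraded_homLocalization (K := K) P).mul (isGraded_coeSubmodule (K := K) hhom))
  rw [← restrictScalars_span] at h2
  obtain ⟨s, hs, hsI⟩ :=
    exists_mem_mul_one_div hfg (hprf _ h1 (span_fg hfg) (span_ne_bot hI0) h2)
  exact ⟨s, hs.2, hsI⟩

/-- The ideal is extended from a finitely generated graded R-submodule E, and E E⁻¹ contains a
homogeneous element outside P, which is a unit of R_{H∖P}. -/
theorem IsGradedPvMD.isGradedPruferDomain (h : IsGradedPvMD 𝒜 K) {P : Ideal R}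
    (hP : P ∈ hQMaxT 𝒜 K) [P.IsPrime] : IsGradedPruferDomain 𝒜 K (homLocalization 𝒜 K P) := by
  intro I hI1 hI hI0 hhom
  have hgr : IsGraded 𝒜 (I.restrictScalars R) := (isHomogeneousSubgroup_iff 𝒜 K).1 hhom
  obtain ⟨X, hX⟩ := hI
  obtain ⟨E, hEfg, hE, hXE, hEI⟩ := IsGraded.exists_fg (W := Submodule.span R (X : Set K))
    (Submodule.fg_span X.finite_toSet) hgr (by
      rw [Submodule.span_le]
      intro x hx
      change x ∈ I
      rw [← hX]
      exact Submodule.subset_span hx)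
  have hspan : Submodule.span (homLocalization 𝒜 K P) (E : Set K) = I := by
    apply le_antisymm
    · rw [Submodule.span_le]
      exact fun x hx => hEI hx
    · rw [← hX]
      exact Submodule.span_mono (Submodule.span_le.1 hXE)
  have hE0 : E ≠ ⊥ := by
    rintro rfl
    apply hI0
    rw [← hspan]
    simp
  obtain ⟨s, hs, hsP, hsE⟩ := hE.exists_mem_homSubmonoid (h.isTInvertible hE hEfg hE0) hP
  have key : ∀ x ∈ E * (1 / E), x ∈ I * (1 / I) := by
    intro x hx
    induction hx using Submodule.mul_induction_on' with
    | mem_mul_mem a ha b hb =>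
      refine Submodule.mul_mem_mul (hEI ha) (mem_one_div.2 fun y hy => ?_)
      rw [← hspan] at hy
      induction hy using Submodule.span_induction with
      | mem y hy =>
        obtain ⟨r, hr⟩ := Submodule.mem_one.1 (mem_one_div.1 hb y hy)
        exact Submodule.mem_one.2 ⟨algebraMap R _ r, hr⟩
      | zero => rw [mul_zero]; exact zero_mem _
      | add y z _ _ hy hz => rw [mul_add]; exact add_mem hy hz
      | smul c y _ hy => rw [mul_smul_comm]; exact Submodule.smul_mem _ c hy
    | add x _ y _ hx hy => exact add_mem hx hy
  refine le_antisymm (mul_one_div_le_one I) ?_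
  rw [Submodule.one_le]
  have hs0 := algebraMap_ne_zero_of_mem_homSubmonoid 𝒜 K hs
  have hinv : (algebraMap R K s)⁻¹ ∈ homLocalization 𝒜 K P :=
    (mem_ofField_iff K).2 ⟨1, s, ⟨hs, hsP⟩, by simp⟩
  have := Submodule.smul_mem _ (⟨_, hinv⟩ : homLocalization 𝒜 K P) (key _ hsE)
  rwa [Subalgebra.smul_def, smul_eq_mul, inv_mul_cancel₀ hs0] at this

instance : IsLocalization (nagataSubmonoid 𝒜 K) (nagataRing 𝒜 K) :=
  Localization.subalgebra.isLocalization_ofField K _ _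

/-- Divisibility in `R_{N_v(H)}` is detected by contents. -/
def ContentDivisibility (𝒜 : Γ → AddSubgroup R) [GradedRing 𝒜] (K : Type*) [Field K]
    [Algebra R K] [IsFractionRing R K] : Prop :=
  ∀ f g : R, g ≠ 0 → contentIdeal 𝒜 f ≤ contentIdeal 𝒜 g →
    algebraMap R K f / algebraMap R K g ∈ nagataRing 𝒜 K

/-- The homogeneous ideal is the sum of the contents of the f ∈ R whose image lies in A. It does not
exceed A because f divides each of its components in R_{N_v(H)}. -/
theorem ContentDivisibility.exists_ideal (h : ContentDivisibility 𝒜 K)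
    (A : Ideal (nagataRing 𝒜 K)) :
    ∃ I : Ideal R, I.IsHomogeneous 𝒜 ∧ A = I.map (algebraMap R (nagataRing 𝒜 K)) := by
  refine ⟨sSup {J | ∃ f, algebraMap R (nagataRing 𝒜 K) f ∈ A ∧ J = contentIdeal 𝒜 f},
    Ideal.IsHomogeneous.sSup ?_, le_antisymm ?_ ?_⟩
  · rintro _ ⟨f, -, rfl⟩
    exact contentIdeal_isHomogeneous 𝒜 f
  · refine (IsLocalization.map_under (nagataSubmonoid 𝒜 K) (nagataRing 𝒜 K) A).ge.trans
      (Ideal.map_mono fun f hf => ?_)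
    have hle := le_sSup (s := {J | ∃ f, algebraMap R (nagataRing 𝒜 K) f ∈ A ∧
      J = contentIdeal 𝒜 f}) (a := contentIdeal 𝒜 f) ⟨f, hf, rfl⟩
    exact hle (mem_contentIdeal 𝒜 f)
  · rw [Ideal.map_le_iff_le_comap]
    refine sSup_le ?_
    rintro _ ⟨f, hf, rfl⟩
    rw [contentIdeal_le_iff]
    intro β
    by_cases hf0 : f = 0
    · rw [hf0]
      simp
    have h1 := h (DirectSum.decompose 𝒜 f β) f hf0 (contentIdeal_le_of_mem 𝒜
      (contentIdeal_isHomogeneous 𝒜 f) (decompose_mem_contentIdeal 𝒜 f β))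
    have h2 : algebraMap R (nagataRing 𝒜 K) (DirectSum.decompose 𝒜 f β) =
        ⟨_, h1⟩ * algebraMap R (nagataRing 𝒜 K) f := by
      apply Subtype.ext
      change algebraMap R K _ = _ / _ * algebraMap R K f
      rw [div_mul_cancel₀]
      simpa using hf0
    change algebraMap R (nagataRing 𝒜 K) (DirectSum.decompose 𝒜 f β) ∈ A
    rw [h2]
    exact A.mul_mem_left _ hf

/-- If (g) is extended from a homogeneous I, then gn ∈ I for some n ∈ N_v(H). Dedekind–Mertens gives
f n^m ∈ C(g) C(n)^m ⊆ C(gn) ⊆ I, and n is a unit, so f ∈ (g). -/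
theorem ContentDivisibility.of_exists_ideal (h : ∀ A : Ideal (nagataRing 𝒜 K), ∃ I : Ideal R,
    I.IsHomogeneous 𝒜 ∧ A = I.map (algebraMap R (nagataRing 𝒜 K))) :
    ContentDivisibility 𝒜 K := by
  intro f g hg hfg
  obtain ⟨I, hI, hgI⟩ := h (Ideal.span {algebraMap R (nagataRing 𝒜 K) g})
  have h1 := Ideal.mem_span_singleton_self (algebraMap R (nagataRing 𝒜 K) g)
  rw [hgI] at h1
  obtain ⟨⟨⟨i, hi⟩, n⟩, hn⟩ :=
    (IsLocalization.mem_map_algebraMap_iff (nagataSubmonoid 𝒜 K) (nagataRing 𝒜 K)).1 h1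
  have hinj : Function.Injective (algebraMap R (nagataRing 𝒜 K)) :=
    IsLocalization.injective _ (M := nagataSubmonoid 𝒜 K)
      (fun x hx => mem_nonZeroDivisors_of_ne_zero hx.1)
  rw [← map_mul] at hn
  have hgn : g * n ∈ I := by
    rw [hinj hn]
    exact hi
  obtain ⟨m, hm⟩ := exists_contentIdeal_mul_pow_le 𝒜 g n
  have h2 : f * n ^ m ∈ I := (hm.trans (contentIdeal_le_of_mem 𝒜 hI hgn))
    (Ideal.mul_mem_mul (hfg (mem_contentIdeal 𝒜 f)) (Ideal.pow_mem_pow (mem_contentIdeal 𝒜 _) m))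
  have h3 : algebraMap R (nagataRing 𝒜 K) f ∈ Ideal.span {algebraMap R (nagataRing 𝒜 K) g} := by
    rw [hgI]
    refine (IsLocalization.mem_map_algebraMap_iff (nagataSubmonoid 𝒜 K) (nagataRing 𝒜 K)).2
      ⟨⟨⟨_, h2⟩, n ^ m⟩, ?_⟩
    rw [← map_mul]
    rfl
  obtain ⟨c, hc⟩ := Ideal.mem_span_singleton'.1 h3
  have h4 : (c : K) * algebraMap R K g = algebraMap R K f := congrArg Subtype.val hc
  rw [← h4, mul_div_cancel_right₀ _ (by simpa using hg)]
  exact c.2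

/-- Up to units the generators are f, g ∈ R, and f + u^k g with content C(f) + C(g) divides both of
them, so it generates (f, g). -/
theorem ContentDivisibility.isBezout (hunit : ∃ α : Γ, α ≠ 0 ∧ ∃ u ∈ 𝒜 α, IsUnit u)
    (h : ContentDivisibility 𝒜 K) : IsBezout (nagataRing 𝒜 K) := by
  obtain ⟨α, hα, u, hu, huu⟩ := hunit
  rw [IsBezout.iff_span_pair_isPrincipal]
  rintro ⟨x, hx⟩ ⟨y, hy⟩
  obtain ⟨f, n, hn, rfl⟩ := (mem_ofField_iff K).1 hx
  obtain ⟨g, l, hl, rfl⟩ := (mem_ofField_iff K).1 hy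
  obtain ⟨k, hk⟩ := exists_contentIdeal_add 𝒜 hα hu huu f g
  have hn0 : algebraMap R K n ≠ 0 := by simpa using hn.1
  have hl0 : algebraMap R K l ≠ 0 := by simpa using hl.1
  refine ⟨algebraMap R _ (f + u ^ k * g), ?_⟩
  by_cases h0 : f + u ^ k * g = 0
  · have hc : contentIdeal 𝒜 f ⊔ contentIdeal 𝒜 g = ⊥ := by
      rw [← hk, h0]
      exact le_bot_iff.1 (contentIdeal_le_of_mem 𝒜 (Ideal.IsHomogeneous.bot 𝒜) (Ideal.zero_mem _))
    rw [sup_eq_bot_iff] at hc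
    have hf : f = 0 := by simpa [hc.1] using mem_contentIdeal 𝒜 f
    have hg : g = 0 := by simpa [hc.2] using mem_contentIdeal 𝒜 g
    simp [hf, hg]
    rfl
  · have hf := h f _ h0 (le_sup_left.trans_eq hk.symm)
    have hg := h g _ h0 (le_sup_right.trans_eq hk.symm)
    have h0' : algebraMap R K (f + u ^ k * g) ≠ 0 := by
      rwa [Ne, FaithfulSMul.algebraMap_eq_zero_iff]
    have hn' : (algebraMap R K n)⁻¹ ∈ nagataRing 𝒜 K :=
      (mem_ofField_iff K).2 ⟨1, n, hn, by simp⟩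
    have hl' : (algebraMap R K l)⁻¹ ∈ nagataRing 𝒜 K :=
      (mem_ofField_iff K).2 ⟨1, l, hl, by simp⟩
    rw [Ideal.submodule_span_eq]
    apply le_antisymm
    · rw [Ideal.span_le]
      rintro _ (rfl | rfl)
      · refine Ideal.mem_span_singleton'.2 ⟨⟨_, hf⟩ * ⟨_, hn'⟩, Subtype.ext ?_⟩
        change _ / _ * _ * algebraMap R K (f + u ^ k * g) = _
        field_simp
      · refine Ideal.mem_span_singleton'.2 ⟨⟨_, hg⟩ * ⟨_, hl'⟩, Subtype.ext ?_⟩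
        change _ / _ * _ * algebraMap R K (f + u ^ k * g) = _
        field_simp
    · rw [Ideal.span_singleton_le_iff_mem]
      refine Ideal.mem_span_pair.2 ⟨algebraMap R _ n, algebraMap R _ (u ^ k * l), Subtype.ext ?_⟩
      change algebraMap R K n * (_ / _) + algebraMap R K (u ^ k * l) * (_ / _) =
        algebraMap R K (f + u ^ k * g)
      rw [map_add, map_mul, map_mul]
      field_simp

theorem ContentDivisibility.valuationRing (hunit : ∃ α : Γ, α ≠ 0 ∧ ∃ u ∈ 𝒜 α, IsUnit u)
    (h : ContentDivisibility 𝒜 K) {P : Ideal R} (hP : P ∈ hQMaxT 𝒜 K) [P.IsPrime] :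
    ValuationRing (localizationAt K P) := by
  obtain ⟨α, hα, u, hu, huu⟩ := hunit
  rw [ValuationRing.iff_isInteger_or_isInteger _ K]
  intro x
  obtain ⟨f, g, hg, rfl⟩ := IsFractionRing.div_surjective R x
  have hg0 : g ≠ 0 := nonZeroDivisors.ne_zero hg
  obtain ⟨k, hk⟩ := exists_contentIdeal_add 𝒜 hα hu huu f g
  have h0 : f + u ^ k * g ≠ 0 := by
    intro h0
    have hc : contentIdeal 𝒜 f ⊔ contentIdeal 𝒜 g = ⊥ := by
      rw [← hk, h0]
      exact le_bot_iff.1 (contentIdeal_le_of_mem 𝒜 (Ideal.IsHomogeneous.bot 𝒜) (Ideal.zero_mem _))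
    rw [sup_eq_bot_iff] at hc
    exact hg0 (by simpa [hc.2] using mem_contentIdeal 𝒜 g)
  have hf := h f _ h0 (le_sup_left.trans_eq hk.symm)
  have hg := h g _ h0 (le_sup_right.trans_eq hk.symm)
  have h0' : algebraMap R K (f + u ^ k * g) ≠ 0 := by
      rwa [Ne, FaithfulSMul.algebraMap_eq_zero_iff]
  have hg0' : algebraMap R K g ≠ 0 := by simpa using hg0
  obtain ⟨a, n, hn, ha⟩ := (mem_ofField_iff K).1 hf
  obtain ⟨b, l, hl, hb⟩ := (mem_ofField_iff K).1 hg
  have hn0 : algebraMap R K n ≠ 0 := by simpa using hn.1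
  have hl0 : algebraMap R K l ≠ 0 := by simpa using hl.1
  -- The common divisor h = f + u^k g gives f/h = a/n and g/h = b/l, so that f/h + u^k (g/h) = 1.
  -- The right-hand side n l lies outside P, hence one of al, bn does too; as f/g = al/(bn), either
  -- f/g or its inverse lies in R_P.
  have key : a * l + u ^ k * (b * n) = n * l := by
    apply IsFractionRing.injective R K
    rw [div_eq_div_iff h0' hn0] at ha
    rw [div_eq_div_iff h0' hl0] at hb
    have e : algebraMap R K (f + u ^ k * g) *
        (algebraMap R K a * algebraMap R K l +
          algebraMap R K u ^ k * (algebraMap R K b * algebraMap R K n)) =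
        algebraMap R K (f + u ^ k * g) * (algebraMap R K n * algebraMap R K l) := by
      have : algebraMap R K (f + u ^ k * g) =
          algebraMap R K f + algebraMap R K u ^ k * algebraMap R K g := by simp
      linear_combination (-algebraMap R K l) * ha -
        algebraMap R K u ^ k * algebraMap R K n * hb -
        algebraMap R K n * algebraMap R K l * this
    simpa using mul_left_cancel₀ h0' e
  have hnl : n * l ∉ P := notMem_of_mem_nagataSubmonoid hP (mul_mem hn hl)
  have hfg : algebraMap R K f * (algebraMap R K b * algebraMap R K n) =
      algebraMap R K g * (algebraMap R K a * algebraMap R K l) := by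
    rw [div_eq_div_iff h0' hn0] at ha
    rw [div_eq_div_iff h0' hl0] at hb
    apply mul_left_cancel₀ h0'
    linear_combination (-algebraMap R K f) * algebraMap R K n * hb +
      algebraMap R K g * algebraMap R K l * ha
  by_cases hbn : b * n ∈ P
  · right
    have hal : a * l ∉ P := fun hal => hnl (key ▸ P.add_mem hal (P.mul_mem_left _ hbn))
    have hal0 : algebraMap R K (a * l) ≠ 0 := by
      rw [Ne, FaithfulSMul.algebraMap_eq_zero_iff]
      rintro h
      exact hal (h ▸ P.zero_mem)
    have hmem : (algebraMap R K f / algebraMap R K g)⁻¹ ∈ localizationAt K P := by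
      refine (mem_ofField_iff K).2 ⟨b * n, a * l, hal, ?_⟩
      have hf0 : algebraMap R K f ≠ 0 := by
        intro hf0
        rw [hf0, zero_mul, ← map_mul] at hfg
        exact mul_ne_zero hg0' hal0 hfg.symm
      rw [inv_div, div_eq_div_iff hf0 hal0, map_mul, map_mul]
      linear_combination -hfg
    exact ⟨⟨_, hmem⟩, rfl⟩
  · left
    have hbn0 : algebraMap R K (b * n) ≠ 0 := by
      rw [Ne, FaithfulSMul.algebraMap_eq_zero_iff]
      rintro h
      exact hbn (h ▸ P.zero_mem)
    have hmem : algebraMap R K f / algebraMap R K g ∈ localizationAt K P := by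
      refine (mem_ofField_iff K).2 ⟨a * l, b * n, hbn, ?_⟩
      rw [div_eq_div_iff hg0' hbn0, map_mul, map_mul]
      linear_combination hfg
    exact ⟨⟨_, hmem⟩, rfl⟩

end Implications

/-! ### Two integrality lemmas. -/

/-- The determinant trick: if `d B ⊆ J B` for a nonzero finitely generated ideal `B` of a domain,
then a power of `d` lies in `J`. -/
theorem mem_radical_of_mul_le {R : Type*} [CommRing R] [IsDomain R] {B J : Ideal R} (hB : B.FG)
    (h0 : B ≠ ⊥) {d : R} (h : ∀ b ∈ B, d * b ∈ J * B) : d ∈ J.radical := by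
  have : Module.Finite R B := Module.Finite.iff_fg.2 hB
  obtain ⟨b, hb, hb0⟩ := Submodule.exists_mem_ne_zero_of_ne_bot h0
  obtain ⟨p, hp, -, hcoeff, hzero⟩ :=
    LinearMap.exists_monic_and_natDegree_eq_and_coeff_mem_pow_and_aeval_eq_zero R
      (algebraMap R (Module.End R B) d) J (by
        rintro _ ⟨x, rfl⟩
        have hx := h x x.2
        rw [Module.algebraMap_end_apply]
        have h1 : (J • (⊤ : Submodule R B)).map B.subtype = J * B := by
          rw [Submodule.map_smul'', Submodule.map_top, Submodule.range_subtype]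
          rfl
        rw [← h1] at hx
        obtain ⟨y, hy, hyx⟩ := hx
        have : y = d • x := Subtype.ext hyx
        rwa [this] at hy)
  rw [Polynomial.aeval_algebraMap_apply] at hzero
  have h1 := LinearMap.congr_fun hzero ⟨b, hb⟩
  rw [Module.algebraMap_end_apply] at h1
  have h2 : Polynomial.aeval d p * b = 0 := congrArg Subtype.val h1
  have h3 := (mul_eq_zero.1 h2).resolve_right hb0
  refine ⟨p.natDegree, ?_⟩
  rw [Polynomial.coe_aeval_eq_eval, Polynomial.eval_eq_sum_range, Finset.sum_range_succ,
    hp.coeff_natDegree, one_mul] at h3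
  rw [← neg_eq_of_add_eq_zero_right h3]
  refine J.neg_mem (J.sum_mem fun k hk => J.mul_mem_right _ ?_)
  rw [Finset.mem_range] at hk
  exact Ideal.pow_le_self (by omega) (hcoeff k)

/-- Clearing the leading coefficients of a polynomial over an integrally closed domain at one of
its roots: each coefficient is `b - c z` with `b`, `b z`, `c`, `c z` integral. -/
theorem exists_coeff_eq_sub {S K : Type*} [CommRing S] [IsDomain S] [IsIntegrallyClosed S]
    [Field K] [Algebra S K] [IsFractionRing S K] {z : K} (q : Polynomial S)
    (hq : Polynomial.aeval z q = 0) (i : ℕ) :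
    ∃ b b' c c' : S, algebraMap S K b * z = algebraMap S K b' ∧
      algebraMap S K c * z = algebraMap S K c' ∧ q.coeff i = b - c' := by
  induction hn : q.natDegree using Nat.strong_induction_on generalizing q i with
  | _ n ih =>
    rcases Nat.eq_zero_or_pos n with h0 | hpos
    · rw [h0] at hn
      rw [Polynomial.eq_C_of_natDegree_eq_zero hn, Polynomial.aeval_C,
        FaithfulSMul.algebraMap_eq_zero_iff] at hq
      rw [Polynomial.eq_C_of_natDegree_eq_zero hn, hq]
      exact ⟨0, 0, 0, 0, by simp⟩
    · obtain ⟨a', ha'⟩ := IsIntegrallyClosed.isIntegral_iff.1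
        (isIntegral_leadingCoeff_smul q z hq)
      rw [Algebra.smul_def] at ha'
      set a := q.leadingCoeff with ha
      -- The leading term a Xⁿ is traded for (az) X^{n-1}, which keeps the root z and lowers the
      -- degree; a' = az lies in S because a leading coefficient times a root is integral. Only the
      -- coefficients of index n and n − 1 change, by a and by −a'.
      set q₁ : Polynomial S := q.eraseLead + Polynomial.C a' * Polynomial.X ^ (n - 1) with hq₁
      have hsum : q.eraseLead + Polynomial.C a * Polynomial.X ^ n = q := by
        rw [ha, ← hn, Polynomial.C_mul_X_pow_eq_monomial]
        exact Polynomial.eraseLead_add_monomial_natDegree_leadingCoeff q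
      have hz : Polynomial.aeval z q₁ = 0 := by
        rw [← hsum] at hq
        rw [hq₁]
        simp only [map_add, map_mul, Polynomial.aeval_C, map_pow, Polynomial.aeval_X] at hq ⊢
        rw [ha', mul_assoc, ← pow_succ', Nat.sub_add_cancel hpos]
        exact hq
      have hdeg : q₁.natDegree < n := by
        have h1 : q.eraseLead.natDegree ≤ n - 1 := by
          rw [← hn]
          exact Polynomial.eraseLead_natDegree_le q
        have h2 := Polynomial.natDegree_add_le_of_degree_le h1
          (Polynomial.natDegree_C_mul_X_pow_le a' (n - 1))
        rw [← hq₁] at h2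
        omega
      have hcoeff : ∀ i, q.coeff i + (if i = n - 1 then a' else 0) =
          q₁.coeff i + (if i = n then a else 0) := by
        intro i
        conv_lhs => rw [← hsum]
        rw [hq₁]
        simp only [Polynomial.coeff_add, Polynomial.coeff_C_mul_X_pow]
        ring
      obtain ⟨b, b', c, c', hb, hc, hi⟩ := ih _ hdeg q₁ hz i rfl
      have := hcoeff i
      by_cases h1 : i = n - 1
      · have h2 : i ≠ n := by omega
        rw [if_pos h1, if_neg h2, add_zero, hi] at this
        refine ⟨b, b', c + a, c' + a', hb, ?_, ?_⟩
        · rw [map_add, map_add, add_mul, hc, ha']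
        · linear_combination this
      · rw [if_neg h1, add_zero] at this
        by_cases h2 : i = n
        · have h3 : q₁.coeff i = 0 := Polynomial.coeff_eq_zero_of_natDegree_lt (by omega)
          rw [if_pos h2, h3, zero_add] at this
          exact ⟨a, a', 0, 0, ha'.symm, by simp, by rw [this, sub_zero]⟩
        · rw [if_neg h2, add_zero] at this
          exact ⟨b, b', c, c', hb, hc, this.trans hi⟩

/-! ### Ideals with two homogeneous generators: the content formula and the operation `w_a`. -/

section Implications

variable {Γ R : Type*} [AddCancelCommMonoid Γ] [IsAddTorsionFree Γ] [DecidableEq Γ] [CommRing R]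
  {𝒜 : Γ → AddSubgroup R} [GradedRing 𝒜] [IsDomain R] {K : Type*} [Field K] [Algebra R K]
  [IsFractionRing R K]

/-- For j in the GV denominator, xyj = px² + qy². Then e = q y/x is a root of X² − jX + pq, hence in
R by `hclosed`, and p x/y = j − e. So p/y and q/x lie in (x, y)⁻¹, and j = x (p/y) + y (q/x). -/
theorem isTInvertible_pair {x y : K} (hx : x ≠ 0) (hy : y ≠ 0)
    (h : x * y ∈ wOp (Submodule.span R {x ^ 2, y ^ 2}))
    (hclosed : ∀ (q j c : R), (algebraMap R K q * (y / x)) ^ 2 =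
      algebraMap R K j * (algebraMap R K q * (y / x)) - algebraMap R K c →
      algebraMap R K q * (y / x) ∈ (1 : Submodule R K)) :
    IsTInvertible (Submodule.span R {x, y}) := by
  obtain ⟨F, hF, h⟩ := mem_wOp_iff.1 h
  refine ⟨F, hF, fun j hj => ?_⟩
  obtain ⟨p, q, hpq⟩ := Submodule.mem_span_pair.1 (h j hj)
  obtain ⟨j, rfl⟩ := Submodule.mem_one.1 (hF.le_one hj)
  rw [Algebra.smul_def, Algebra.smul_def] at hpq
  have he : algebraMap R K q * (y / x) ∈ (1 : Submodule R K) := by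
    refine hclosed q j (p * q) ?_
    rw [map_mul]
    field_simp
    linear_combination algebraMap R K q * hpq
  have he' : algebraMap R K p * (x / y) ∈ (1 : Submodule R K) := by
    have : algebraMap R K p * (x / y) = algebraMap R K j - algebraMap R K q * (y / x) := by
      field_simp
      linear_combination hpq
    rw [this]
    exact sub_mem (Submodule.mem_one.2 ⟨j, rfl⟩) he
  have hpair : ∀ w : K, w * x ∈ (1 : Submodule R K) → w * y ∈ (1 : Submodule R K) →
      w ∈ 1 / Submodule.span R {x, y} := by
    intro w h1 h2
    rw [mem_one_div]
    intro v hv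
    obtain ⟨a, b, rfl⟩ := Submodule.mem_span_pair.1 hv
    rw [mul_add, mul_smul_comm, mul_smul_comm]
    exact add_mem (Submodule.smul_mem _ _ h1) (Submodule.smul_mem _ _ h2)
  have h1 : algebraMap R K q / x ∈ 1 / Submodule.span R {x, y} := by
    refine hpair _ ?_ ?_
    · rw [div_mul_cancel₀ _ hx]
      exact Submodule.mem_one.2 ⟨q, rfl⟩
    · convert he using 1
      ring
  have h2 : algebraMap R K p / y ∈ 1 / Submodule.span R {x, y} := by
    refine hpair _ ?_ ?_
    · convert he' using 1
      ring
    · rw [div_mul_cancel₀ _ hy]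
      exact Submodule.mem_one.2 ⟨p, rfl⟩
  have : algebraMap R K j = x * (algebraMap R K p / y) + y * (algebraMap R K q / x) := by
    field_simp
    linear_combination -hpq
  rw [this]
  exact add_mem (Submodule.mul_mem_mul (Submodule.subset_span (by simp)) h2)
    (Submodule.mul_mem_mul (Submodule.subset_span (by simp)) h1)

theorem eventually_fracContent_add {α : Γ} (hα : α ≠ 0) {u : R} (hu : u ∈ 𝒜 α) (huu : IsUnit u)
    {x y : K} (hx : x ∈ homQuotientField 𝒜 K) (hy : y ∈ homQuotientField 𝒜 K) :
    ∀ᶠ k : ℕ in Filter.atTop, fracContent 𝒜 K (x + algebraMap R K u ^ k * y) =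
      fracContent 𝒜 K x ⊔ fracContent 𝒜 K y := by
  obtain ⟨a, s, hs, rfl⟩ := (mem_homQuotientField_iff 𝒜 K).1 hx
  obtain ⟨b, t, ht, rfl⟩ := (mem_homQuotientField_iff 𝒜 K).1 hy
  have hs0 := algebraMap_ne_zero_of_mem_homSubmonoid 𝒜 K hs
  have ht0 := algebraMap_ne_zero_of_mem_homSubmonoid 𝒜 K ht
  have e₁ : algebraMap R K a / algebraMap R K s =
      algebraMap R K (a * t) / algebraMap R K (s * t) := by
    rw [map_mul, map_mul]
    field_simp
  have e₂ : algebraMap R K b / algebraMap R K t =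
      algebraMap R K (b * s) / algebraMap R K (s * t) := by
    rw [map_mul, map_mul]
    field_simp
  filter_upwards [eventually_contentIdeal_add 𝒜 hα hu huu (a * t) (b * s)] with k hk
  have e : algebraMap R K a / algebraMap R K s +
      algebraMap R K u ^ k * (algebraMap R K b / algebraMap R K t) =
      algebraMap R K (a * t + u ^ k * (b * s)) / algebraMap R K (s * t) := by
    rw [e₁, e₂, map_add, map_mul _ (u ^ k), map_pow, add_div, mul_div_assoc]
  rw [e, e₁, e₂, fracContent_div_eq 𝒜 K _ (mul_mem hs ht), hk,
    fracContent_div_eq 𝒜 K _ (mul_mem hs ht), fracContent_div_eq 𝒜 K _ (mul_mem hs ht),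
    ← Submodule.mul_sup, ← IsLocalization.coeSubmodule_sup]

theorem isGraded_span_pair {x y : K} (hx : IsHomFraction 𝒜 K x) (hy : IsHomFraction 𝒜 K y) :
    IsGraded 𝒜 (Submodule.span R {x, y}) := by
  apply isGraded_span
  rintro _ (rfl | rfl)
  exacts [hx, hy]

theorem fracContent_neg (x : K) (hx : x ∈ homQuotientField 𝒜 K) :
    fracContent 𝒜 K (-x) = fracContent 𝒜 K x := by
  have h : ∀ y : K, y ∈ homQuotientField 𝒜 K → fracContent 𝒜 K (-y) ≤ fracContent 𝒜 K y :=
    fun y hy => ((isGraded_fracContent hy) _ (neg_mem (mem_fracContent 𝒜 hy))).2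
  refine le_antisymm (h x hx) ?_
  simpa using h (-x) (neg_mem hx)

/-- Both hypotheses of `isTInvertible_pair` come from the content formula applied to products that
are linear in the quasi-indeterminate u^k. -/
theorem IsGradedPvMD.of_wOp_fracContent_mul
    (hunit : ∃ α : Γ, α ≠ 0 ∧ ∃ u ∈ 𝒜 α, IsUnit u)
    (h : ∀ f ∈ homQuotientField 𝒜 K, ∀ g ∈ homQuotientField 𝒜 K,
      wOp (fracContent 𝒜 K f * fracContent 𝒜 K g) = wOp (fracContent 𝒜 K (f * g))) :
    IsGradedPvMD 𝒜 K := by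
  obtain ⟨α, hα, u, hu, huu⟩ := hunit
  have hvu : ∀ k : ℕ, algebraMap R K u ^ k ∈ homQuotientField 𝒜 K := fun k =>
    pow_mem (algebraMap_mem _ u) k
  have hle : ∀ f ∈ homQuotientField 𝒜 K, ∀ g ∈ homQuotientField 𝒜 K, ∀ E : Submodule R K,
      fracContent 𝒜 K (f * g) ≤ E →
      fracContent 𝒜 K f * fracContent 𝒜 K g ≤ wOp E := fun f hf g hg E hE =>
    (le_wOp _).trans ((h f hf g hg).trans_le (wOp_mono hE))
  refine isGradedPvMD_of_pair fun x y hx hy hx0 hy0 => isTInvertible_pair hx0 hy0 ?_ ?_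
  · have hx' := hx.mem_homQuotientField 𝒜
    have hy' := hy.mem_homQuotientField 𝒜
    obtain ⟨k, hk₁, hk₂⟩ := ((eventually_fracContent_add hα hu huu hx' hy').and
      (eventually_fracContent_add hα hu huu hx' (neg_mem hy'))).exists
    have hgr : IsGraded 𝒜 (Submodule.span R {x ^ 2, y ^ 2}) := by
      rw [sq, sq]
      exact isGraded_span_pair (hx.mul 𝒜 hx) (hy.mul 𝒜 hy)
    -- Both factors have content (x, y), while their product is x² − u^{2k} y². Hence xy ∈ (x, y)² ⊆
    -- (x², y²)^w.
    have hmem : (x + algebraMap R K u ^ k * y) * (x + algebraMap R K u ^ k * -y) ∈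
        Submodule.span R {x ^ 2, y ^ 2} := by
      refine Submodule.mem_span_pair.2 ⟨1, -(u ^ k) ^ 2, ?_⟩
      rw [Algebra.smul_def, Algebra.smul_def]
      simp only [map_one, map_neg, map_pow]
      ring
    have := hle _ (add_mem hx' (mul_mem (hvu k) hy')) _
      (add_mem hx' (mul_mem (hvu k) (neg_mem hy'))) _ (hgr _ hmem).2
    apply this
    rw [hk₁, hk₂, fracContent_neg y hy']
    exact Submodule.mul_mem_mul (Submodule.mem_sup_left (mem_fracContent 𝒜 hx'))
      (Submodule.mem_sup_right (mem_fracContent 𝒜 hy'))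
  · intro q j c he
    set e := algebraMap R K q * (y / x) with he_def
    have heR : e ∈ homQuotientField 𝒜 K := by
      rw [he_def, div_eq_mul_inv]
      exact mul_mem (algebraMap_mem _ q)
        ((hy.mul 𝒜 (hx.inv 𝒜)).mem_homQuotientField 𝒜)
    have heR' : algebraMap R K j - e ∈ homQuotientField 𝒜 K :=
      sub_mem (algebraMap_mem _ j) heR
    have h1R := one_mem (homQuotientField 𝒜 K)
    obtain ⟨k, hk₁, hk₂⟩ := ((eventually_fracContent_add hα hu huu (neg_mem heR) h1R).and
      (eventually_fracContent_add hα hu huu (neg_mem heR') h1R)).exists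
    -- The monic quadratic with roots e and j − e, evaluated at u^k, lies in R. The contents of its
    -- two factors contain e and 1 respectively, so e ∈ R^w = R.
    have hmem : (-e + algebraMap R K u ^ k * 1) *
        (-(algebraMap R K j - e) + algebraMap R K u ^ k * 1) ∈ (1 : Submodule R K) := by
      refine Submodule.mem_one.2 ⟨(u ^ k) ^ 2 - j * u ^ k + c, ?_⟩
      simp only [map_add, map_sub, map_mul, map_pow]
      linear_combination he
    have := hle _ (add_mem (neg_mem heR) (mul_mem (hvu k) h1R)) _
      (add_mem (neg_mem heR') (mul_mem (hvu k) h1R)) _ (isGraded_one (𝒜 := 𝒜) _ hmem).2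
    rw [wOp_one] at this
    apply this
    rw [hk₁, hk₂, fracContent_neg e heR, ← mul_one e]
    refine Submodule.mul_mem_mul (Submodule.mem_sup_left ?_)
      (Submodule.mem_sup_right (mem_fracContent 𝒜 h1R))
    rw [mul_one]
    exact mem_fracContent 𝒜 heR

/-- The submodule G = R gives one inclusion; the other is cancellation of the `t`-invertible G
modulo `w`. -/
theorem IsPvMD.wOp_eq_eabOp (h : IsPvMD R K) (I : Submodule R K) :
    (wOp I : Set K) = eabOp wOp I := by
  ext x
  simp only [eabOp, Set.mem_iUnion, SetLike.mem_coe, Set.mem_ofPred_eq, exists_prop]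
  constructor
  · intro hx
    refine ⟨1, ⟨isGV_one.1, one_ne_bot⟩, ?_⟩
    rw [Submodule.mem_div_iff_forall_mul_mem, wOp_one, mul_one]
    intro y hy
    obtain ⟨r, rfl⟩ := Submodule.mem_one.1 hy
    rw [mul_comm, ← Algebra.smul_def]
    exact Submodule.smul_mem _ r hx
  · rintro ⟨G, ⟨hG, hG0⟩, hx⟩
    rw [Submodule.mem_div_iff_forall_mul_mem] at hx
    have : Submodule.span R {x} * G ≤ wOp (I * G) := by
      rw [Submodule.mul_le]
      intro a ha b hb
      obtain ⟨c, rfl⟩ := Submodule.mem_span_singleton.1 ha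
      rw [smul_mul_assoc]
      exact Submodule.smul_mem _ c (hx b (le_wOp G hb))
    exact (isPvMD_iff.1 h G hG hG0).le_wOp_of_mul_le this (Submodule.mem_span_singleton_self x)

theorem mem_eabOp_of_mul_le {I G : Submodule R K} {x : K} (hG : G.FG) (hG0 : G ≠ ⊥)
    (h : Submodule.span R {x} * G ≤ I * G) : x ∈ eabOp wOp I := by
  simp only [eabOp, Set.mem_iUnion, SetLike.mem_coe, Set.mem_ofPred_eq, exists_prop]
  refine ⟨G, ⟨hG, hG0⟩, ?_⟩
  rw [Submodule.mem_div_iff_forall_mul_mem]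
  intro y hy
  exact ((mul_wOp_le _ _).trans (wOp_mono h))
    (Submodule.mul_mem_mul (Submodule.mem_span_singleton_self x) hy)

theorem IsGradedPvMD.of_wOp_eq_eabOp
    (h : ∀ I : Ideal R, I ≠ ⊥ → I.FG → I.IsHomogeneous 𝒜 →
      (wOp (IsLocalization.coeSubmodule K I) : Set K) =
        eabOp wOp (IsLocalization.coeSubmodule K I)) : IsGradedPvMD 𝒜 K := by
  have h' : ∀ I : Submodule R K, I ≤ 1 → I ≠ ⊥ → I.FG → IsGraded 𝒜 I → ∀ x ∈ eabOp wOp I,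
      x ∈ wOp I := by
    intro I h1 h0 hfg hgr x hx
    have hcoe := coeSubmodule_comap h1
    have := h _ (fun hb => h0 (by rw [← hcoe, hb, IsLocalization.coeSubmodule_bot]))
      (comap_fg h1 hfg) hgr.isHomogeneous_comap
    rw [hcoe] at this
    rw [← this] at hx
    exact hx
  refine isGradedPvMD_of_pair fun x y hx hy hx0 hy0 => ?_
  -- The hypothesis concerns integral ideals only, so x and y are first scaled into R by a
  -- homogeneous element.
  obtain ⟨s, hs, hs1⟩ := exists_homSubmonoid_mul_le_one (𝒜 := 𝒜) (E := Submodule.span R {x, y})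
    (Submodule.fg_span (by simp)) (fun w hw => (isGraded_span_pair hx hy w hw).1)
  have hs0 := algebraMap_ne_zero_of_mem_homSubmonoid 𝒜 K hs
  obtain ⟨⟨β, hβ⟩, -⟩ := (mem_homSubmonoid_iff 𝒜).1 hs
  have hsh := isHomFraction_algebraMap 𝒜 K hβ
  have e : Submodule.span R {x, y} * Submodule.span R {algebraMap R K s} =
      Submodule.span R {algebraMap R K s * x, algebraMap R K s * y} := by
    rw [mul_comm, Submodule.span_mul_span, Set.singleton_mul, Set.image_pair]
  apply IsTInvertible.of_mul (J := Submodule.span R {algebraMap R K s})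
  rw [mul_comm, e] at hs1
  rw [e]
  set a := algebraMap R K s * x with ha
  set b := algebraMap R K s * y with hb
  have ha0 : a ≠ 0 := mul_ne_zero hs0 hx0
  have hb0 : b ≠ 0 := mul_ne_zero hs0 hy0
  have hah := hsh.mul 𝒜 hx
  have hbh := hsh.mul 𝒜 hy
  have ha1 : a ∈ (1 : Submodule R K) := hs1 (Submodule.subset_span (by simp))
  have hb1 : b ∈ (1 : Submodule R K) := hs1 (Submodule.subset_span (by simp))
  refine isTInvertible_pair ha0 hb0 ?_ ?_
  -- The witness G = (a, b) works since ab (a, b) = (a²b, ab²) ⊆ (a², b²)(a, b).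
  · refine h' _ ?_ ?_ (Submodule.fg_span (by simp)) ?_ _
      (mem_eabOp_of_mul_le (G := Submodule.span R {a, b}) (Submodule.fg_span (by simp)) ?_ ?_)
    · rw [Submodule.span_le]
      have hsq : ∀ c ∈ (1 : Submodule R K), c ^ 2 ∈ (1 : Submodule R K) := fun c hc => by
        rw [sq]
        simpa using Submodule.mul_mem_mul hc hc
      rintro _ (rfl | rfl)
      exacts [hsq a ha1, hsq b hb1]
    · intro h0
      have : a ^ 2 ∈ Submodule.span R {a ^ 2, b ^ 2} := Submodule.subset_span (by simp)
      rw [h0, Submodule.mem_bot] at this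
      exact ha0 (pow_eq_zero_iff (two_ne_zero)|>.1 this)
    · rw [sq, sq]
      exact isGraded_span_pair (hah.mul 𝒜 hah) (hbh.mul 𝒜 hbh)
    · intro h0
      have : a ∈ Submodule.span R {a, b} := Submodule.subset_span (by simp)
      rw [h0, Submodule.mem_bot] at this
      exact ha0 this
    · rw [Submodule.span_mul_span, Submodule.span_mul_span, Submodule.span_le]
      rintro _ ⟨_, rfl, v, hv, rfl⟩
      rcases hv with rfl | rfl
      · refine Submodule.subset_span ⟨a ^ 2, by simp, b, by simp, ?_⟩
        ring
      · refine Submodule.subset_span ⟨b ^ 2, by simp, a, by simp, ?_⟩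
        ring
  · intro q j c he
    set e := algebraMap R K q * (b / a) with he_def
    rw [← wOp_one]
    -- Here G = (1, e): the quadratic equation of e gives e G ⊆ G, whence e ∈ R^{w_a} = R^w = R.
    refine h' 1 le_rfl one_ne_bot isGV_one.1 isGraded_one _
      (mem_eabOp_of_mul_le (G := Submodule.span R {1, e}) (Submodule.fg_span (by simp)) ?_ ?_)
    · intro h0
      have : (1 : K) ∈ Submodule.span R {1, e} := Submodule.subset_span (by simp)
      rw [h0, Submodule.mem_bot] at this
      exact one_ne_zero this
    · rw [one_mul, Submodule.span_mul_span, Submodule.span_le]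
      rintro _ ⟨_, rfl, v, hv, rfl⟩
      rcases hv with rfl | rfl
      · exact Submodule.subset_span (by simp)
      · refine Submodule.mem_span_pair.2 ⟨-c, j, ?_⟩
        rw [Algebra.smul_def, Algebra.smul_def, map_neg]
        linear_combination -he

end Implications

/-! ### Flat overrings. -/

section Overrings

variable {R K : Type*} [CommRing R] [IsDomain R] [Field K] [Algebra R K] [IsFractionRing R K]

theorem mul_one_div_le_span (T : Subalgebra R K) {E : Submodule R K} {x : K}
    (hx : x ∈ E * (1 / E)) :
    x ∈ Submodule.span T (E : Set K) * (1 / Submodule.span T (E : Set K)) := by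
  induction hx using Submodule.mul_induction_on' with
  | mem_mul_mem a ha b hb =>
    refine Submodule.mul_mem_mul (Submodule.subset_span ha) (mem_one_div.2 fun y hy => ?_)
    induction hy using Submodule.span_induction with
    | mem y hy =>
      obtain ⟨r, hr⟩ := Submodule.mem_one.1 (mem_one_div.1 hb y hy)
      exact Submodule.mem_one.2 ⟨algebraMap R _ r, hr⟩
    | zero => rw [mul_zero]; exact zero_mem _
    | add y z _ _ hy hz => rw [mul_add]; exact add_mem hy hz
    | smul c y _ hy => rw [mul_smul_comm]; exact Submodule.smul_mem _ c hy
  | add x _ y _ hx hy => exact add_mem hx hy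

/-- In a flat overring `T` of `R`, each finite set of elements of `T` has denominators generating
the unit ideal of `T`. -/
theorem one_mem_mul_one_div_inf_one (T : Subalgebra R K) [Module.Flat R T] {M : Submodule R K}
    (hM : M.FG) (h : M ≤ Subalgebra.toSubmodule T) :
    (1 : K) ∈ Subalgebra.toSubmodule T * (1 / M ⊓ 1) := by
  induction M, hM using Submodule.fg_induction with
  | singleton x =>
    have hxT : x ∈ T := h (Submodule.mem_span_singleton_self x)
    obtain ⟨a, b, hb, hx⟩ := IsFractionRing.div_surjective R x
    have hb0 : algebraMap R K b ≠ 0 := by simpa using nonZeroDivisors.ne_zero hb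
    -- For x = a/b, the relation b·x − a·1 = 0 in T is trivial by flatness: 1 = Σ y_j r_{1j} with b
    -- r_{0j} = a r_{1j}. So each r_{1j} ∈ R satisfies x r_{1j} = r_{0j} ∈ R.
    have hrel : ∑ i : Fin 2, (![b, -a] : Fin 2 → R) i • (![⟨x, hxT⟩, 1] : Fin 2 → T) i = 0 := by
      rw [Fin.sum_univ_two]
      apply Subtype.ext
      change b • x + (-a) • (1 : K) = 0
      rw [Algebra.smul_def, Algebra.smul_def, map_neg, ← hx, mul_div_cancel₀ _ hb0, mul_one,
        add_neg_cancel]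
    obtain ⟨k, r, y, hy, hr⟩ := Module.Flat.isTrivialRelation_of_sum_smul_eq_zero hrel
    have h1 : (1 : K) = ∑ j, (y j : K) * algebraMap R K (r 1 j) := by
      have := congrArg Subtype.val (hy 1)
      simp only [Matrix.cons_val_one, AddSubmonoidClass.coe_finsetSum, Algebra.smul_def] at this
      refine this.trans (Finset.sum_congr rfl fun j _ => mul_comm _ _)
    rw [h1]
    refine sum_mem fun j _ => Submodule.mul_mem_mul (y j).2 ⟨?_, Submodule.mem_one.2 ⟨_, rfl⟩⟩
    rw [SetLike.mem_coe, mem_one_div]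
    intro z hz
    obtain ⟨c, rfl⟩ := Submodule.mem_span_singleton.1 hz
    rw [mul_smul_comm]
    refine Submodule.smul_mem _ c (Submodule.mem_one.2 ⟨r 0 j, ?_⟩)
    have h2 := hr j
    simp only [Fin.sum_univ_two, Matrix.cons_val_zero, Matrix.cons_val_one] at h2
    have h3 := congrArg (algebraMap R K) h2
    rw [map_add, map_mul, map_mul, map_neg, map_zero] at h3
    rw [← hx]
    field_simp
    linear_combination h3
  | sup M N _ _ hM hN =>
    have h1 := Submodule.mul_mem_mul (hM (le_sup_left.trans h)) (hN (le_sup_right.trans h))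
    rw [one_mul, mul_mul_mul_comm, (Subalgebra.isIdempotentElem_toSubmodule T).eq] at h1
    have h2 : (1 / M ⊓ 1) * (1 / N ⊓ 1) ≤ 1 / (M ⊔ N) ⊓ 1 := by
      refine le_inf ?_ ((mul_le_mul' inf_le_right inf_le_right).trans_eq (mul_one 1))
      rw [le_one_div_iff, Submodule.sup_mul]
      refine sup_le ?_ ?_
      · calc M * ((1 / M ⊓ 1) * (1 / N ⊓ 1)) ≤ M * ((1 / M) * 1) := by
              gcongr
              exacts [inf_le_left, inf_le_right]
          _ ≤ 1 := by rw [mul_one]; exact mul_one_div_le_one M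
      · calc N * ((1 / M ⊓ 1) * (1 / N ⊓ 1)) ≤ N * (1 * (1 / N)) := by
              gcongr
              exacts [inf_le_right, inf_le_left]
          _ ≤ 1 := by rw [one_mul]; exact mul_one_div_le_one N
    exact mul_le_mul' le_rfl h2 h1

end Overrings

/-! ### Flatness of `Kr(R, w)`, and homogeneously `t`-linked overrings of a P`v`MD. -/

section Implications

variable {Γ R : Type*} [AddCancelCommMonoid Γ] [IsAddTorsionFree Γ] [DecidableEq Γ] [CommRing R]
  {𝒜 : Γ → AddSubgroup R} [GradedRing 𝒜] [IsDomain R] {K : Type*} [Field K] [Algebra R K]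
  [IsFractionRing R K]

theorem div_mem_Kr {f g : R} (hg : g ≠ 0) (h : contentIdeal 𝒜 f ≤ contentIdeal 𝒜 g) :
    algebraMap R K f / algebraMap R K g ∈ Kr 𝒜 K :=
  ⟨f, g, hg, rfl, 1, one_ne_zero,
    (IsLocalization.coeSubmodule_mono K (Ideal.mul_mono_left h)).trans (le_wOp _)⟩

/-- Write I = C(f). Then f⁻¹ I ⊆ T, and the denominators of f⁻¹ I form f I⁻¹ ⊆ I I⁻¹, so flatness
makes I I⁻¹ generate the unit ideal of T. Finite generation and the definition of Kr(R, w) turn this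
into a GV ideal inside I I⁻¹. -/
theorem IsGradedPvMD.of_flat (hunit : ∃ α : Γ, α ≠ 0 ∧ ∃ u ∈ 𝒜 α, IsUnit u) (T : Subalgebra R K)
    (hT : (T : Set K) = Kr 𝒜 K) [Module.Flat R T] : IsGradedPvMD 𝒜 K := by
  obtain ⟨α, hα, u, hu, huu⟩ := hunit
  have hmem : ∀ x, x ∈ T ↔ x ∈ Kr 𝒜 K := fun x => by rw [← hT]; rfl
  rw [isGradedPvMD_iff]
  intro I hI h0 hhom
  obtain ⟨f, hf⟩ := exists_contentIdeal_eq 𝒜 hα hu huu hI hhom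
  set E := IsLocalization.coeSubmodule K I with hE
  have hE0 : E ≠ ⊥ := mt (coeSubmodule_eq_bot (K := K)).1 h0
  have hEgr : IsGraded 𝒜 E := isGraded_coeSubmodule hhom
  have hEfg : E.FG := coeSubmodule_fg hI
  have hf0 : f ≠ 0 := by
    rintro rfl
    exact h0 (hf.symm.trans (le_bot_iff.1
      (contentIdeal_le_of_mem 𝒜 (Ideal.IsHomogeneous.bot 𝒜) (Ideal.zero_mem _))))
  have hf0' : algebraMap R K f ≠ 0 := by simpa using hf0
  have hfE : algebraMap R K f ∈ E := ⟨f, hf ▸ mem_contentIdeal 𝒜 f, rfl⟩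
  have hMT : Submodule.span R {(algebraMap R K f)⁻¹} * E ≤ Subalgebra.toSubmodule T := by
    rw [Submodule.mul_le]
    rintro m hm _ ⟨a, ha, rfl⟩
    obtain ⟨c, rfl⟩ := Submodule.mem_span_singleton.1 hm
    rw [smul_mul_assoc]
    refine Submodule.smul_mem _ c ?_
    rw [Algebra.linearMap_apply, mul_comm, ← div_eq_mul_inv]
    refine (hmem _).2 (div_mem_Kr hf0 ?_)
    rw [hf]
    exact contentIdeal_le_of_mem 𝒜 hhom ha
  have h1 := one_mem_mul_one_div_inf_one T ((Submodule.fg_span_singleton _).mul hEfg) hMT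
  have h2 : 1 / (Submodule.span R {(algebraMap R K f)⁻¹} * E) ≤ E * (1 / E) := by
    intro y hy
    have h3 : (algebraMap R K f)⁻¹ * y ∈ 1 / E := by
      rw [mem_one_div] at hy ⊢
      intro e he
      have := hy _ (Submodule.mul_mem_mul (Submodule.mem_span_singleton_self _) he)
      convert this using 1
      ring
    have := Submodule.mul_mem_mul hfE h3
    rwa [mul_inv_cancel_left₀ hf0'] at this
  have h3 : (1 : Submodule R K) ≤ Subalgebra.toSubmodule T * (E * (1 / E)) :=
    Submodule.one_le.2 (mul_le_mul' le_rfl (inf_le_left.trans h2) h1)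
  obtain ⟨J₀, hJ₀, hJ₀E, h4⟩ := exists_fg_le_mul isGV_one.1 h3
  have hEE := hEgr.mul (hEgr.one_div hE0)
  obtain ⟨J, hJ, hJgr, hJJ, hJE⟩ := IsGraded.exists_fg hJ₀ hEE hJ₀E
  have hJ1 : J ≤ 1 := hJE.trans (mul_one_div_le_one E)
  set J' : Ideal R := J.comap (Algebra.linearMap R K) with hJ'
  have hcoe : IsLocalization.coeSubmodule K J' = J := coeSubmodule_comap hJ1
  obtain ⟨l, hl⟩ := exists_contentIdeal_eq 𝒜 hα hu huu (comap_fg hJ1 hJ) hJgr.isHomogeneous_comap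
  have h5 : (1 : K) ∈ Subalgebra.toSubmodule T * J :=
    mul_le_mul' le_rfl hJJ (h4 (Submodule.one_le.1 le_rfl))
  have hl0 : l ≠ 0 := by
    rintro rfl
    have : J = ⊥ := by
      rw [← hcoe, coeSubmodule_eq_bot, hJ', ← hl]
      exact le_bot_iff.1
        (contentIdeal_le_of_mem 𝒜 (Ideal.IsHomogeneous.bot 𝒜) (Ideal.zero_mem _))
    rw [this, Submodule.mul_bot, Submodule.mem_bot] at h5
    exact one_ne_zero h5
  have hl0' : algebraMap R K l ≠ 0 := by simpa using hl0
  -- As J = C(l), the element l divides all of J in T. Applied to 1 ∈ TJ, this makes l a unit of T,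
  -- that is, 1/l ∈ Kr(R, w).
  have h6 : ∀ w ∈ Subalgebra.toSubmodule T * J, w / algebraMap R K l ∈ T := by
    intro w hw
    induction hw using Submodule.mul_induction_on' with
    | mem_mul_mem t ht j hj =>
      rw [← hcoe] at hj
      obtain ⟨a, ha, rfl⟩ := hj
      rw [mul_div_assoc]
      refine mul_mem ht ((hmem _).2 (div_mem_Kr hl0 ?_))
      rw [hl]
      exact contentIdeal_le_of_mem 𝒜 hJgr.isHomogeneous_comap ha
    | add x _ y _ hx hy => rw [add_div]; exact add_mem hx hy
  obtain ⟨p, q, hq, hpq, h, hh0, hle⟩ := (hmem _).1 (h6 1 h5)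
  have hq0' : algebraMap R K q ≠ 0 := by simpa using hq
  have hqp : q = p * l := by
    apply IsFractionRing.injective R K
    rw [div_eq_div_iff hl0' hq0', one_mul] at hpq
    rw [hpq, map_mul]
  have hp0 : p ≠ 0 := by
    rintro rfl
    rw [zero_mul] at hqp
    exact hq hqp
  set B := contentIdeal 𝒜 p * contentIdeal 𝒜 h with hB
  have hBfg : B.FG := (contentIdeal_fg 𝒜 p).mul (contentIdeal_fg 𝒜 h)
  have hB0 : B ≠ ⊥ := mul_ne_zero (contentIdeal_ne_bot 𝒜 hp0) (contentIdeal_ne_bot 𝒜 hh0)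
  -- Writing 1/l = p/q with q = pl, membership in Kr(R, w) becomes B ⊆ (JB)^w for B = C(p) C(h). A
  -- GV ideal F then satisfies FB ⊆ JB, and the determinant trick puts F in the radical of J.
  have hle' : IsLocalization.coeSubmodule K B ≤ wOp (IsLocalization.coeSubmodule K (J' * B)) := by
    refine hle.trans (wOp_mono (IsLocalization.coeSubmodule_mono K ?_))
    rw [hqp, hB, mul_comm J', mul_right_comm]
    refine Ideal.mul_mono_left ((contentIdeal_mul_le 𝒜 p l).trans ?_)
    rw [hl]
  obtain ⟨F, hF, hFB⟩ := exists_isGV_mul_le (coeSubmodule_fg hBfg) hle'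
  have hFrad : (F.comap (Algebra.linearMap R K) : Ideal R) ≤ J'.radical := by
    intro d hd
    refine mem_radical_of_mul_le hBfg hB0 fun b hb => ?_
    obtain ⟨c, hc, hcb⟩ := hFB (Submodule.mul_mem_mul ⟨b, hb, rfl⟩ hd)
    have : c = d * b := by
      apply IsFractionRing.injective R K
      rw [map_mul, mul_comm]
      exact hcb
    rwa [← this]
  obtain ⟨n, hn⟩ := Ideal.exists_pow_le_of_le_radical_of_fg hFrad (comap_fg hF.le_one hF.1)
  have hpow : ∀ I : Ideal R, IsLocalization.coeSubmodule K (I ^ n) =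
      IsLocalization.coeSubmodule K I ^ n := fun I => by
    clear hn
    induction n with
    | zero => rw [pow_zero, pow_zero, Ideal.one_eq_top, IsLocalization.coeSubmodule_top]
    | succ m ih => rw [pow_succ, pow_succ, ← ih, IsLocalization.coeSubmodule_mul]
  have hn' := IsLocalization.coeSubmodule_mono K hn
  rw [hpow, coeSubmodule_comap hF.le_one, hcoe] at hn'
  exact ⟨_, hF.pow n, hn'.trans hJE⟩

theorem isGraded_of_isHomogeneousOverring {T : Subalgebra R K}
    (hT : IsHomogeneousOverring 𝒜 K T) : IsGraded 𝒜 (Subalgebra.toSubmodule T) :=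
  (isHomogeneousSubgroup_iff 𝒜 K).1 hT.2

theorem isHomogeneousOverring_of_isGraded {T : Subalgebra R K}
    (hT : IsGraded 𝒜 (Subalgebra.toSubmodule T)) : IsHomogeneousOverring 𝒜 K T :=
  ⟨fun x hx => (hT x hx).1, (isHomogeneousSubgroup_iff 𝒜 K).2 hT⟩

/-- I is extended from E, and E E⁻¹ contains a GV module F. Since F need not be homogeneous, the
linkedness hypothesis does not apply to it directly; Dedekind–Mertens replaces it by a homogeneous
GV ideal. -/
theorem IsPvMD.of_isHomogeneouslyTLinked (h : IsPvMD R K) {T : Subalgebra R K}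
    (hT : IsHomogeneousOverring 𝒜 K T) (hlink : IsHomogeneouslyTLinked 𝒜 K T) : IsPvMD T K := by
  have hgr := isGraded_of_isHomogeneousOverring hT
  rw [isPvMD_iff]
  intro I hI hI0
  obtain ⟨X, hX⟩ := hI
  set E := Submodule.span R (X : Set K) with hE
  have hspan : Submodule.span T (E : Set K) = I := by
    rw [hE, Submodule.span_span_of_tower, hX]
  have hE0 : E ≠ ⊥ := by
    intro h0
    apply hI0
    rw [← hspan, h0]
    simp
  obtain ⟨F, hF, hFE⟩ := isPvMD_iff.1 h E (Submodule.fg_span X.finite_toSet) hE0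
  have hle : Submodule.span T (F : Set K) ≤ I * (1 / I) := by
    rw [Submodule.span_le, ← hspan]
    exact fun x hx => mul_one_div_le_span T (hFE hx)
  refine ⟨_, ⟨span_fg hF.1, span_ne_bot hF.2.1, le_antisymm ?_ ?_⟩, hle⟩
  · intro y hy
    have hy' : ∀ j ∈ F, y * j ∈ T := by
      intro j hj
      obtain ⟨t, ht⟩ := Submodule.mem_one.1 (mem_one_div.1 hy j (Submodule.subset_span hj))
      rw [← ht]
      exact t.2
    have hyF : ∀ x ∈ Submodule.span R {y} * F, x ∈ T := by
      have : Submodule.span R {y} * F ≤ Subalgebra.toSubmodule T := by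
        rw [Submodule.mul_le]
        intro a ha b hb
        obtain ⟨c, rfl⟩ := Submodule.mem_span_singleton.1 ha
        rw [smul_mul_assoc]
        exact Submodule.smul_mem _ c (hy' b hb)
      exact this
    -- A homogeneous s carries yF into R, and F⁻¹ = R then gives sy ∈ R.
    have hyR : y ∈ homQuotientField 𝒜 K := by
      obtain ⟨s, hs, hs1⟩ := exists_homSubmonoid_mul_le_one (𝒜 := 𝒜)
        ((Submodule.fg_span_singleton y).mul hF.1) fun x hx => (hgr x (hyF x hx)).1
      rw [← mul_assoc] at hs1
      have h1 := hF.le_one_of_mul_le hs1 (Submodule.mul_mem_mul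
        (Submodule.mem_span_singleton_self _) (Submodule.mem_span_singleton_self y))
      obtain ⟨⟨β, hβ⟩, -⟩ := (mem_homSubmonoid_iff 𝒜).1 hs
      refine mem_homQuotientField_of_mul_mem (isHomFraction_algebraMap 𝒜 K hβ)
        (algebraMap_ne_zero_of_mem_homSubmonoid 𝒜 K hs) ?_
      rw [mul_comm]
      exact one_le_homQuotientField h1
    set C := fracContent 𝒜 K y with hC
    let 𝔞 : Ideal R := (Subalgebra.toSubmodule T / C).comap (Algebra.linearMap R K)
    set F' : Ideal R := F.comap (Algebra.linearMap R K) with hF'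
    have hcoe : IsLocalization.coeSubmodule K F' = F := coeSubmodule_comap hF.le_one
    -- For j ∈ F, C(y) C(j)^m ⊆ C(yj) ⊆ T, so the m-th power of each element of C(j) carries C(y)
    -- into T.
    have hrad : sSup {J | ∃ j ∈ F', J = contentIdeal 𝒜 j} ≤ 𝔞.radical := by
      refine sSup_le ?_
      rintro _ ⟨j, hj, rfl⟩
      obtain ⟨m, hm⟩ := exists_fracContent_mul_pow_le 𝒜 hyR j
      intro r hr
      refine ⟨m, ?_⟩
      change algebraMap R K (r ^ m) ∈ Subalgebra.toSubmodule T / C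
      rw [Submodule.mem_div_iff_forall_mul_mem]
      intro c hc
      rw [mul_comm, map_pow]
      refine (hm.trans (hgr _ (hy' _ hj)).2) (Submodule.mul_mem_mul hc
        (Submodule.pow_mem_pow _ ?_ m))
      rw [fracContent_algebraMap]
      exact ⟨r, hr, rfl⟩
    obtain ⟨N, hN, hNhom, hFN, hNle⟩ := exists_fg_isHomogeneous (𝒜 := 𝒜) (L := F')
      (M := sSup {J | ∃ j ∈ F', J = contentIdeal 𝒜 j}) (comap_fg hF.le_one hF.1)
      (Ideal.IsHomogeneous.sSup (by
        rintro _ ⟨j, -, rfl⟩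
        exact contentIdeal_isHomogeneous 𝒜 j))
      (fun j hj => le_sSup (a := contentIdeal 𝒜 j) (show _ ∈ {J | ∃ j ∈ F', J = contentIdeal 𝒜 j}
        from ⟨j, hj, rfl⟩) (mem_contentIdeal 𝒜 j))
    obtain ⟨n, hn⟩ := Ideal.exists_pow_le_of_le_radical_of_fg (hNle.trans hrad) hN
    have hpow : IsLocalization.coeSubmodule K (N ^ n) = IsLocalization.coeSubmodule K N ^ n := by
      clear hn
      induction n with
      | zero => rw [pow_zero, pow_zero, Ideal.one_eq_top, IsLocalization.coeSubmodule_top]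
      | succ m ih => rw [pow_succ, pow_succ, ← ih, IsLocalization.coeSubmodule_mul]
    have hNhom' : (N ^ n).IsHomogeneous 𝒜 := by
      clear hn hpow
      induction n with
      | zero => rw [pow_zero, Ideal.one_eq_top]; exact Ideal.IsHomogeneous.top 𝒜
      | succ m ih => rw [pow_succ]; exact ih.mul hNhom
    have hNgv : IsGV (IsLocalization.coeSubmodule K (N ^ n)) := by
      rw [hpow]
      refine IsGV.pow (hF.mono ?_ (coeSubmodule_le_one N) (coeSubmodule_fg hN)) n
      rw [← hcoe]
      exact IsLocalization.coeSubmodule_mono K hFN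
    have hN0 : N ^ n ≠ ⊥ := mt (coeSubmodule_eq_bot (K := K)).2 hNgv.2.1
    have hNfg : (N ^ n).FG := fg_of_coeSubmodule_fg hNgv.1
    have h1 := hlink _ hN0 hNfg hNhom' ((tOp_eq_one_iff hNgv.2.1 (coeSubmodule_le_one _)).2
      ⟨_, hNgv, le_rfl⟩)
    have hset : (algebraMap R K '' ((N ^ n : Ideal R) : Set R)) =
        (IsLocalization.coeSubmodule K (N ^ n) : Set K) := rfl
    rw [hset] at h1
    have hle1 : Submodule.span T (IsLocalization.coeSubmodule K (N ^ n) : Set K) ≤ 1 := by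
      rw [Submodule.span_le]
      intro x hx
      obtain ⟨r, rfl⟩ := Submodule.mem_one.1 (coeSubmodule_le_one _ hx)
      exact Submodule.mem_one.2 ⟨algebraMap R _ r, rfl⟩
    obtain ⟨G, hG, hGle⟩ := (tOp_eq_one_iff (span_ne_bot hNgv.2.1) hle1).1 h1
    refine hG.mem_one fun j hj => ?_
    have hj' := hGle hj
    clear hj
    induction hj' using Submodule.span_induction with
    | mem x hx =>
      obtain ⟨r, hr, rfl⟩ := hx
      have h2 := Submodule.mem_div_iff_forall_mul_mem.1 (hn hr) y (mem_fracContent 𝒜 hyR)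
      rw [mul_comm] at h2
      exact Submodule.mem_one.2 ⟨⟨_, h2⟩, rfl⟩
    | zero => rw [mul_zero]; exact zero_mem _
    | add a b _ _ ha hb => rw [mul_add]; exact add_mem ha hb
    | smul c a _ ha => rw [mul_smul_comm]; exact Submodule.smul_mem _ c ha
  · exact one_div_one.symm.trans_le (one_div_anti (hle.trans (mul_one_div_le_one I)))

end Implications

/-! ### Integrally closed homogeneously `t`-linked overrings. -/

section Implications

variable {Γ R : Type*} [AddCancelCommMonoid Γ] [IsAddTorsionFree Γ] [DecidableEq Γ] [CommRing R]
  {𝒜 : Γ → AddSubgroup R} [GradedRing 𝒜] [IsDomain R] {K : Type*} [Field K] [Algebra R K]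
  [IsFractionRing R K]

/-- A homogeneous F with F^t = R has a homogeneous element outside P. This is a unit of T, so FT =
T. -/
theorem isHomogeneouslyTLinked_of_homLocalization_le {P : Ideal R} (hP : P ∈ hQMaxT 𝒜 K)
    [P.IsPrime] {T : Subalgebra R K} (hT : homLocalization 𝒜 K P ≤ T) :
    IsHomogeneouslyTLinked 𝒜 K T := by
  intro F hF0 hF hFhom htop
  have hE0 : IsLocalization.coeSubmodule K F ≠ ⊥ := mt (coeSubmodule_eq_bot (K := K)).1 hF0
  obtain ⟨G, hG, hGF⟩ := (tOp_eq_one_iff hE0 (coeSubmodule_le_one F)).1 htop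
  have hFP : ¬ F ≤ P := 
    hP.1.not_isGV F (hG.mono hGF (coeSubmodule_le_one F) (coeSubmodule_fg hF))
  obtain ⟨f, hf, hfP⟩ := Set.not_subset.1 hFP
  have : ∃ β, (DirectSum.decompose 𝒜 f β : R) ∉ P := by
    by_contra! hcon
    exact hfP ((contentIdeal_le_iff 𝒜).2 hcon (mem_contentIdeal 𝒜 f))
  obtain ⟨β, hβ⟩ := this
  set s : R := (DirectSum.decompose 𝒜 f β : R) with hs
  have hsF : s ∈ F := hFhom β hf
  have hs0 : s ≠ 0 := fun h => hβ (h ▸ zero_mem P)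
  have hs0' : algebraMap R K s ≠ 0 := by simpa using hs0
  have hinv : (algebraMap R K s)⁻¹ ∈ T := hT ((mem_ofField_iff K).2
    ⟨1, s, ⟨(mem_homSubmonoid_iff 𝒜).2 ⟨⟨β, SetLike.coe_mem _⟩, hs0⟩, hβ⟩, by simp⟩)
  have h1 : (1 : Submodule T K) = Submodule.span T (algebraMap R K '' (F : Set R)) := by
    refine le_antisymm (Submodule.one_le.2 ?_) (Submodule.span_le.2 ?_)
    · have := Submodule.smul_mem _ (⟨_, hinv⟩ : T)
        (Submodule.subset_span (R := T) (Set.mem_image_of_mem (algebraMap R K) hsF))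
      rwa [Algebra.smul_def, show algebraMap T K ⟨_, hinv⟩ = (algebraMap R K s)⁻¹ from rfl,
        inv_mul_cancel₀ hs0'] at this
    · rintro _ ⟨r, -, rfl⟩
      exact Submodule.mem_one.2 ⟨algebraMap R T r, rfl⟩
  rw [← h1]
  exact (tOp_eq_one_iff one_ne_bot le_rfl).2 ⟨1, isGV_one, le_rfl⟩

theorem isGraded_sup_adjoin {S : Subalgebra R K} (hS : IsGraded 𝒜 (Subalgebra.toSubmodule S))
    {z : K} (hz : IsHomFraction 𝒜 K z) :
    IsGraded 𝒜 (Subalgebra.toSubmodule (S ⊔ Algebra.adjoin R {z})) := by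
  rw [← Subalgebra.mul_toSubmodule]
  refine hS.mul ?_
  rw [Algebra.adjoin_eq_span]
  refine isGraded_span 𝒜 fun x hx => ?_
  obtain ⟨n, rfl⟩ := Submonoid.mem_closure_singleton.1 hx
  induction n with
  | zero => rw [pow_zero]; exact isHomFraction_one 𝒜 K
  | succ n ih =>
    rw [pow_succ]
    exact (ih (Submonoid.mem_closure_singleton.2 ⟨n, rfl⟩)).mul 𝒜 hz

/-- z is integral over S[z²], hence z = p(z²) with p over S. The coefficient of X in p(X²) − X is
−1, and `exists_coeff_eq_sub` writes it as b − cz. -/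
theorem exists_coeff_relation {S : Subalgebra R K} [IsIntegrallyClosed S] {z : K}
    (hclosed : IsIntegrallyClosed ↥(S ⊔ Algebra.adjoin R {z ^ 2})) :
    ∃ b ∈ S, ∃ c ∈ S, b * z ∈ S ∧ c * z ∈ S ∧ 1 = c * z - b := by
  have hz2 : z ^ 2 ∈ S ⊔ Algebra.adjoin R {z ^ 2} :=
    le_sup_right (a := S) (Algebra.self_mem_adjoin_singleton R (z ^ 2))
  have hzint : IsIntegral ↥(S ⊔ Algebra.adjoin R {z ^ 2}) z :=
    IsIntegral.of_pow two_pos (isIntegral_algebraMap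
      (x := (⟨z ^ 2, hz2⟩ : ↥(S ⊔ Algebra.adjoin R {z ^ 2}))))
  obtain ⟨t, ht⟩ := (isIntegrallyClosed_iff K).1 hclosed hzint
  have hzT : z ∈ S ⊔ Algebra.adjoin R {z ^ 2}   := by
    have h1 : algebraMap ↥(S ⊔ Algebra.adjoin R {z ^ 2}) K t ∈ S ⊔ Algebra.adjoin R {z ^ 2} := t.2
    rwa [ht] at h1
  have hle : S ⊔ Algebra.adjoin R {z ^ 2} ≤
      (Algebra.adjoin S {z ^ 2}).restrictScalars R := by
    refine sup_le (fun x hx => ?_) (Algebra.adjoin_le ?_)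
    · exact (Algebra.adjoin S {z ^ 2}).algebraMap_mem ⟨x, hx⟩
    · exact Set.singleton_subset_iff.2 (Algebra.self_mem_adjoin_singleton S (z ^ 2))
  have hz := hle hzT
  rw [Subalgebra.mem_restrictScalars, Algebra.adjoin_singleton_eq_range_aeval] at hz
  obtain ⟨p, hp⟩ := hz
  obtain ⟨b, b', c, c', hb, hc, h⟩ := exists_coeff_eq_sub (z := z)
    (Polynomial.expand S 2 p - Polynomial.X) (by
      rw [map_sub, Polynomial.expand_aeval, Polynomial.aeval_X, sub_eq_zero]
      exact hp) 1
  refine ⟨b, b.2, c, c.2, ?_, ?_, ?_⟩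
  · exact hb ▸ b'.2
  · exact hc ▸ c'.2
  · rw [Polynomial.coeff_sub, Polynomial.coeff_expand two_pos, if_neg (by decide),
      Polynomial.coeff_X_one, zero_sub] at h
    have h' := congrArg (algebraMap S K) h
    rw [map_neg, map_one, map_sub, ← hc] at h'
    change 1 = algebraMap S K c * z - algebraMap S K b
    linear_combination -h'

/-- For each P, apply the hypothesis to S = R_{H∖P} and S[z²] with z = y/x. The relation 1 = cz − b,
cleared by some s ∉ P, becomes s = y (sc/x) − x (sb/x) with sc/x and sb/x in (x, y)⁻¹. -/
theorem IsGradedPvMD.of_isIntegrallyClosed (hunit : ∃ α : Γ, α ≠ 0 ∧ ∃ u ∈ 𝒜 α, IsUnit u)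
    (h : ∀ T : Subalgebra R K, IsHomogeneousOverring 𝒜 K T → IsHomogeneouslyTLinked 𝒜 K T →
      IsIntegrallyClosed T) : IsGradedPvMD 𝒜 K := by
  obtain ⟨α, hα, u, hu, huu⟩ := hunit
  refine isGradedPvMD_of_pair fun x y hx hy hx0 hy0 => ?_
  refine (isGraded_span_pair hx hy).isTInvertible (Submodule.fg_span (by simp))
    (Submodule.ne_bot_iff _ |>.2 ⟨x, Submodule.subset_span (by simp), hx0⟩) fun P hP => ?_
  have : P.IsPrime := isPrime_of_mem_hQMaxT hα hu huu hP
  set S := homLocalization 𝒜 K P with hS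
  have hz : IsHomFraction 𝒜 K (y / x) := by
    rw [div_eq_mul_inv]
    exact hy.mul 𝒜 (hx.inv 𝒜)
  have hSgr := isGraded_homLocalization (𝒜 := 𝒜) (K := K) P
  have hSint : IsIntegrallyClosed S := h S (isHomogeneousOverring_of_isGraded hSgr)
    (isHomogeneouslyTLinked_of_homLocalization_le hP le_rfl)
  have hTint := h (S ⊔ Algebra.adjoin R {(y / x) ^ 2})
    (isHomogeneousOverring_of_isGraded (isGraded_sup_adjoin hSgr (by
      rw [pow_two]; exact hz.mul 𝒜 hz)))
    (isHomogeneouslyTLinked_of_homLocalization_le hP le_sup_left)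
  obtain ⟨b, hb, c, hc, hbz, hcz, h1⟩ := exists_coeff_relation hTint
  obtain ⟨s, hs, hsM⟩ := exists_mul_mem_one_of_fg (R := R) (K := K)
    (S := homSubmonoid 𝒜 ⊓ P.primeCompl) (hS := inf_le_left.trans inf_le_right)
    (M := Submodule.span R {b, c, b * (y / x), c * (y / x)}) (Submodule.fg_span (by simp)) (by
      have : Submodule.span R {b, c, b * (y / x), c * (y / x)} ≤ Subalgebra.toSubmodule S := by
        rw [Submodule.span_le]
        rintro w (rfl | rfl | rfl | rfl)
        exacts [hb, hc, hbz, hcz]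
      exact this)
  have hmem : ∀ w ∈ ({b, c, b * (y / x), c * (y / x)} : Set K),
      algebraMap R K s * w ∈ (1 : Submodule R K) := fun w hw => hsM w (Submodule.subset_span hw)
  have hdiv : ∀ w, w ∈ ({b, c, b * (y / x), c * (y / x)} : Set K) →
      w * (y / x) ∈ ({b, c, b * (y / x), c * (y / x)} : Set K) →
      algebraMap R K s * w / x ∈ 1 / Submodule.span R {x, y} := by
    intro w hw hwz
    rw [← SetLike.mem_coe, ← Set.singleton_subset_iff, ← Submodule.span_le, le_one_div_iff,
      Submodule.span_mul_span, Submodule.span_le]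
    rintro _ ⟨v, hv, _, rfl, rfl⟩
    rcases hv with rfl | rfl
    · change _ ∈ (1 : Submodule R K)
      convert hmem w hw using 1
      field_simp
    · change _ ∈ (1 : Submodule R K)
      convert hmem _ hwz using 1
      field_simp
  refine ⟨s, hs.2, ?_⟩
  have h2 := Submodule.sub_mem _
    (Submodule.mul_mem_mul (Submodule.subset_span (by simp) : y ∈ Submodule.span R {x, y})
      (hdiv c (by simp) (by simp)))
    (Submodule.mul_mem_mul (Submodule.subset_span (by simp) : x ∈ Submodule.span R {x, y})
      (hdiv b (by simp) (by simp)))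
  convert h2 using 1
  calc algebraMap R K s = algebraMap R K s * (c * (y / x) - b) := by rw [← h1, mul_one]
    _ = _ := by field_simp

end Implications

/-! ### Graded fields: greatest common divisors in the sum of the components. -/

section GradedField

variable {G K : Type*} [AddCommGroup G] [Field K]

/-- A direct family of subgroups of a field, closed under products and inverses of homogeneous
elements; their sum is then a graded ring in which each nonzero homogeneous element is a unit. -/
structure IsGradedField (L : G → AddSubgroup K) : Prop where
  one_mem : (1 : K) ∈ L 0
  mul_mem : ∀ {g h : G} {x y : K}, x ∈ L g → y ∈ L h → x * y ∈ L (g + h)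
  inv_mem : ∀ {g : G} {x : K}, x ∈ L g → x⁻¹ ∈ L (-g)
  eq_zero_of_sum_eq_zero : ∀ (s : Finset G) (v : G → K), (∀ g, v g ∈ L g) →
    ∑ g ∈ s, v g = 0 → ∀ g ∈ s, v g = 0

namespace IsGradedField

variable {L : G → AddSubgroup K}

/-- The field of the elements of degree `0`. -/
def zeroSubfield (hL : IsGradedField L) : Subfield K where
  carrier := L 0
  mul_mem' hx hy := by simpa using hL.mul_mem hx hy
  one_mem' := hL.one_mem
  add_mem' := add_mem
  zero_mem' := zero_mem _
  neg_mem' := neg_mem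
  inv_mem' _ hx := by simpa using hL.inv_mem hx

theorem prod_mem (hL : IsGradedField L) {J : Type*} (s : Finset J) {v : J → K} {δ : J → G} (h : ∀ j, v j ∈ L (δ j)) :
    ∏ j ∈ s, v j ∈ L (∑ j ∈ s, δ j) := by
  classical
  induction s using Finset.induction_on with
  | empty => simpa using hL.one_mem
  | insert a s ha ih =>
    rw [Finset.prod_insert ha, Finset.sum_insert ha]
    exact hL.mul_mem (h a) ih

theorem pow_mem (hL : IsGradedField L) {g : G} {x : K} (h : x ∈ L g) (n : ℕ) : x ^ n ∈ L (n • g) := by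
  simpa using hL.prod_mem (Finset.range n) (v := fun _ => x) (δ := fun _ => g) fun _ => h

theorem eq_zero_of_injective (hL : IsGradedField L) {J : Type*} (s : Finset J) {v : J → K} {δ : J → G}
    (hδ : Function.Injective δ) (h : ∀ j, v j ∈ L (δ j)) (hs : ∑ j ∈ s, v j = 0) {j : J}
    (hj : j ∈ s) : v j = 0 := by
  classical
  have h0 : ∀ j, ∑ i ∈ s with δ i = δ j, v i = if j ∈ s then v j else 0 := by
    intro j
    have : s.filter (fun i => δ i = δ j) = s.filter (fun i => i = j) :=
      Finset.filter_congr fun i _ => hδ.eq_iff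
    rw [this, Finset.sum_filter, Finset.sum_ite_eq']
  have h1 := hL.eq_zero_of_sum_eq_zero (s.image δ) (fun g => ∑ i ∈ s with δ i = g, v i)
    (fun g => sum_mem fun i hi => (Finset.mem_filter.1 hi).2 ▸ h i) (by
      rw [Finset.sum_fiberwise_of_maps_to (fun i hi => Finset.mem_image_of_mem δ hi)]
      exact hs) (δ j) (Finset.mem_image_of_mem δ hj)
  simpa [h0, hj] using h1

section Monomials

variable {m : ℕ} {e : Fin m → G} {t : Fin m → K}

theorem monomial_mem (hL : IsGradedField L) (ht : ∀ j, t j ∈ L (e j)) (d : Fin m → ℕ) :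
    ∏ j, t j ^ d j ∈ L (∑ j, d j • e j) :=
  hL.prod_mem _ fun j => hL.pow_mem (ht j) _

/-- A homogeneous x is a degree-zero scalar times a Laurent monomial in the t_j; a high power of ∏
t_j makes all exponents nonnegative. -/
theorem exists_pow_mul_eq (hL : IsGradedField L) (ht : ∀ j, t j ∈ L (e j)) (ht0 : ∀ j, t j ≠ 0) (a : Fin m → ℤ) {x : K}
    (hx : x ∈ L (∑ j, a j • e j)) :
    ∃ N, ∀ n ≥ N, ∃ p : MvPolynomial (Fin m) hL.zeroSubfield,
      (∏ j, t j) ^ n * x = MvPolynomial.aeval t p := by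
  refine ⟨∑ j, (a j).natAbs, fun n hn => ?_⟩
  let d : Fin m → ℕ := fun j => (n + a j).toNat
  have hd : ∀ j, (d j : ℤ) = n + a j := fun j => by
    have := Finset.single_le_sum (f := fun j => (a j).natAbs) (fun _ _ => Nat.zero_le _)
      (Finset.mem_univ j)
    simp only [d]
    omega
  have hd0 : ∏ j, t j ^ d j ≠ 0 := Finset.prod_ne_zero_iff.2 fun j _ => pow_ne_zero _ (ht0 j)
  have hk : (∏ j, t j) ^ n * x * (∏ j, t j ^ d j)⁻¹ ∈ L 0 := by
    have h1 := hL.mul_mem (hL.mul_mem (hL.pow_mem (hL.prod_mem Finset.univ ht) n) hx)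
      (hL.inv_mem (hL.monomial_mem ht d))
    convert h1 using 2
    rw [Finset.smul_sum, ← Finset.sum_add_distrib, ← sub_eq_add_neg, ← Finset.sum_sub_distrib]
    symm
    refine Finset.sum_eq_zero fun j _ => ?_
    rw [← natCast_zsmul (e j) (d j), hd, add_smul, natCast_zsmul, sub_self]
  refine ⟨MvPolynomial.monomial (Finsupp.equivFunOnFinite.symm d) ⟨_, hk⟩, ?_⟩
  rw [MvPolynomial.aeval_monomial, Finsupp.prod_fintype _ _ (fun _ => pow_zero _)]
  change _ = (∏ j, t j) ^ n * x * (∏ j, t j ^ d j)⁻¹ * ∏ j, t j ^ d j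
  rw [inv_mul_cancel_right₀ hd0]

/-- The terms κ t^d w_c, κ of degree zero, have pairwise distinct degrees, so a vanishing sum
vanishes term by term. -/
theorem eq_zero_of_sum_aeval_mul (hL : IsGradedField L) {ι : Type*} (ht : ∀ j, t j ∈ L (e j)) (ht0 : ∀ j, t j ≠ 0)
    {δ : ι → G} {w : ι → K} (hw : ∀ c, w c ∈ L (δ c)) (hw0 : ∀ c, w c ≠ 0)
    (hinj : Function.Injective fun i : ι × (Fin m →₀ ℕ) => δ i.1 + ∑ j, i.2 j • e j)
    (l : ι →₀ MvPolynomial (Fin m) hL.zeroSubfield)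
    (h : l.sum (fun c p => MvPolynomial.aeval t p * w c) = 0) : l = 0 := by
  classical
  let v : ι × (Fin m →₀ ℕ) → K := fun i =>
    (MvPolynomial.coeff i.2 (l i.1) : hL.zeroSubfield) * (∏ j, t j ^ i.2 j) * w i.1
  have hv : ∀ i, v i ∈ L (δ i.1 + ∑ j, i.2 j • e j) := by
    intro i
    have h1 := hL.mul_mem (hL.mul_mem (MvPolynomial.coeff i.2 (l i.1)).2 (hL.monomial_mem ht i.2)) (hw i.1)
    rwa [zero_add, add_comm] at h1
  let U : Finset (Fin m →₀ ℕ) := l.support.biUnion fun c => (l c).support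
  have hsum : ∑ i ∈ l.support ×ˢ U, v i = 0 := by
    rw [← h, Finsupp.sum, Finset.sum_product]
    refine Finset.sum_congr rfl fun c hc => ?_
    rw [MvPolynomial.aeval_def, MvPolynomial.eval₂_eq', Finset.sum_mul]
    symm
    refine Finset.sum_subset (Finset.subset_biUnion_of_mem (fun c => (l c).support) hc)
      fun d _ hd => ?_
    rw [MvPolynomial.notMem_support_iff] at hd
    simp [hd]
  ext c d
  rw [Finsupp.zero_apply, MvPolynomial.coeff_zero]
  by_contra hne
  have hne' : MvPolynomial.coeff d (l c) ≠ 0 := fun h0 => hne (by rw [h0])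
  have hdc : d ∈ (l c).support := MvPolynomial.mem_support_iff.2 hne'
  have hc : c ∈ l.support := Finsupp.mem_support_iff.2 fun h0 => hne' (by rw [h0]; simp)
  have hz := hL.eq_zero_of_injective (l.support ×ˢ U) hinj hv hsum (j := (c, d))
    (Finset.mem_product.2 ⟨hc, Finset.mem_biUnion.2 ⟨c, hc, hdc⟩⟩)
  have hk : algebraMap hL.zeroSubfield K (MvPolynomial.coeff d (l c)) ≠ 0 := fun h0 => hne' (Subtype.ext h0)
  exact mul_ne_zero (mul_ne_zero hk (Finset.prod_ne_zero_iff.2 fun j _ => pow_ne_zero _ (ht0 j)))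
    (hw0 c) hz

end Monomials

end IsGradedField

/-- Comparing coordinates of y q(x) q(x₀) shows that q(x₀) divides q(x) times each coordinate of y
q(x₀), for all x. The coprimality condition `hq` then lets each of these coordinates be divided by
q(x₀). -/
theorem mem_span_of_dvd {A ι X : Type*} [CommRing A] [IsDomain A] [Algebra A K] {t : ι → K}
    (ht : LinearIndependent A t) (q : X → A) {x₀ : X} (hx₀ : algebraMap A K (q x₀) ≠ 0)
    (hq : ∀ a, (∀ x, q x₀ ∣ a * q x) → q x₀ ∣ a) {y : K}
    (hy : ∀ x, y * algebraMap A K (q x) ∈ Submodule.span A (Set.range t)) :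
    y ∈ Submodule.span A (Set.range t) := by
  simp only [Finsupp.mem_span_range_iff_exists_finsupp, ← Finsupp.linearCombination_apply] at hy
  choose l hl using hy
  have hl0 : q x₀ ≠ 0 := fun h0 => hx₀ (by rw [h0, map_zero])
  have key : ∀ x, q x • l x₀ = q x₀ • l x := by
    intro x
    apply ht
    rw [map_smul, map_smul, hl, hl, Algebra.smul_def, Algebra.smul_def]
    ring
  have hdvd : ∀ c, q x₀ ∣ l x₀ c := fun c => hq _ fun x => ⟨l x c, by
    have := DFunLike.congr_fun (key x) c
    simp only [Finsupp.smul_apply, smul_eq_mul] at this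
    rw [mul_comm, this]⟩
  have hy' : algebraMap A K (q x₀) * y = ∑ c ∈ (l x₀).support, l x₀ c • t c := by
    rw [mul_comm, ← hl x₀, Finsupp.linearCombination_apply, Finsupp.sum]
  choose b hb using hdvd
  have : y = ∑ c ∈ (l x₀).support, b c • t c := by
    apply mul_left_cancel₀ hx₀
    rw [hy', Finset.mul_sum]
    refine Finset.sum_congr rfl fun c _ => ?_
    rw [hb, mul_smul, Algebra.smul_def]
  rw [this]
  exact sum_mem fun c _ => Submodule.smul_mem _ _ (Submodule.subset_span ⟨c, rfl⟩)

end GradedField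

section GradedField

variable {G K : Type*} [AddCommGroup G] [Field K]

namespace IsGradedField

variable {L : G → AddSubgroup K}

theorem mul_mem_iSup (hL : IsGradedField L) {g : G} {x y : K} (hx : x ∈ L g)
    (hy : y ∈ ⨆ g, L g) : x * y ∈ ⨆ g, L g := by
  refine AddSubgroup.iSup_induction L (C := fun y => x * y ∈ ⨆ g, L g) hy
    (fun i z hz => AddSubgroup.mem_iSup_of_mem _ (hL.mul_mem hx hz)) ?_ fun y z hy hz => ?_
  · rw [mul_zero]
    exact zero_mem _
  · rw [mul_add]
    exact add_mem hy hz

theorem aeval_mul_mem_iSup (hL : IsGradedField L) {m : ℕ} {e : Fin m → G} {t : Fin m → K}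
    (ht : ∀ j, t j ∈ L (e j)) (p : MvPolynomial (Fin m) hL.zeroSubfield) {g : G} {x : K}
    (hx : x ∈ L g) : MvPolynomial.aeval t p * x ∈ ⨆ g, L g := by
  rw [MvPolynomial.aeval_def, MvPolynomial.eval₂_eq', Finset.sum_mul]
  exact sum_mem fun d _ => AddSubgroup.mem_iSup_of_mem _
    (hL.mul_mem (hL.mul_mem (MvPolynomial.coeff d p).2 (hL.monomial_mem ht d)) hx)

/-- The degrees in which there is a nonzero element. -/
def support (hL : IsGradedField L) : AddSubgroup G where
  carrier := {g | ∃ x ∈ L g, x ≠ 0}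
  zero_mem' := ⟨1, hL.one_mem, one_ne_zero⟩
  add_mem' := by
    rintro g h ⟨x, hx, hx0⟩ ⟨y, hy, hy0⟩
    exact ⟨x * y, hL.mul_mem hx hy, mul_ne_zero hx0 hy0⟩
  neg_mem' := by
    rintro g ⟨x, hx, hx0⟩
    exact ⟨x⁻¹, hL.inv_mem hx, inv_ne_zero hx0⟩

theorem exists_finset_mem_iSup (hL : IsGradedField L) (s : Finset K)
    (hs : ∀ f ∈ s, f ∈ ⨆ g, L g) :
    ∃ D : Finset G, (D : Set G) ⊆ hL.support ∧ ∀ f ∈ s, f ∈ ⨆ g ∈ D, L g := by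
  classical
  have hmono : ∀ {D E : Finset G} {x : K}, D ⊆ E → x ∈ ⨆ g ∈ D, L g → x ∈ ⨆ g ∈ E, L g := by
    intro D E x h hx
    exact (show (⨆ g ∈ D, L g) ≤ ⨆ g ∈ E, L g from biSup_mono fun g hg => h hg) hx
  have key : ∀ f ∈ ⨆ g, L g, ∃ D : Finset G, (D : Set G) ⊆ hL.support ∧ f ∈ ⨆ g ∈ D, L g := by
    intro f hf
    refine AddSubgroup.iSup_induction L
      (C := fun f => ∃ D : Finset G, (D : Set G) ⊆ hL.support ∧ f ∈ ⨆ g ∈ D, L g) hf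
      (fun g x hx => ?_) ⟨∅, by simp, zero_mem _⟩ fun x y hx hy => ?_
    · by_cases h0 : x = 0
      · exact ⟨∅, by simp, by rw [h0]; exact zero_mem _⟩
      · refine ⟨{g}, by simpa using ⟨x, hx, h0⟩, by simpa using hx⟩
    · obtain ⟨D, hD, hx⟩ := hx
      obtain ⟨E, hE, hy⟩ := hy
      refine ⟨D ∪ E, by simpa using ⟨hD, hE⟩, add_mem ?_ ?_⟩
      · exact hmono Finset.subset_union_left hx
      · exact hmono Finset.subset_union_right hy
  induction s using Finset.induction_on with
  | empty => exact ⟨∅, by simp, by simp⟩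
  | insert a s _ ih =>
    obtain ⟨D, hD, h⟩ := ih fun f hf => hs f (Finset.mem_insert_of_mem hf)
    obtain ⟨E, hE, ha⟩ := key a (hs a (Finset.mem_insert_self _ _))
    refine ⟨E ∪ D, by simpa using ⟨hE, hD⟩, fun f hf => ?_⟩
    rcases Finset.mem_insert.1 hf with rfl | hf
    · exact hmono Finset.subset_union_left ha
    · exact hmono Finset.subset_union_right (h f hf)

/-- In the ring `⨆ g, L g` of a graded field with torsion-free grading group, finitely many
elements have a greatest common divisor, and dividing by it makes them coprime in the sense of
divisorial ideals. -/
theorem exists_mul_mem_iSup [IsAddTorsionFree G] (hL : IsGradedField L) (s : Finset K)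
    (hs : ∀ f ∈ s, f ∈ ⨆ g, L g) {f₀ : K} (hf₀ : f₀ ∈ s) (h0 : f₀ ≠ 0) :
    ∃ z : K, z ≠ 0 ∧ (∀ f ∈ s, z * f ∈ ⨆ g, L g) ∧
      ∀ y, (∀ f ∈ s, y * (z * f) ∈ ⨆ g, L g) → y ∈ ⨆ g, L g := by
  classical
  obtain ⟨D, hD, hsD⟩ := hL.exists_finset_mem_iSup s hs
  set G' := AddSubgroup.closure (D : Set G) with hG'
  have hG'S : G' ≤ hL.support := (AddSubgroup.closure_le _).2 hD
  have : Module.Finite ℤ G' := by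
    rw [Module.Finite.iff_addGroup_fg]
    exact (AddGroup.fg_iff_addSubgroup_fg _).2 ⟨D, rfl⟩
  let b := Module.finBasis ℤ G'
  have hT : ∀ g : hL.support, ∃ x ∈ L g, x ≠ 0 := fun g => g.2
  choose T hT hT0 using hT
  let e : Fin (Module.finrank ℤ G') → G := fun j => b j
  let t : Fin (Module.finrank ℤ G') → K := fun j => T ⟨e j, hG'S (b j).2⟩
  have ht : ∀ j, t j ∈ L (e j) := fun j => hT ⟨e j, hG'S (b j).2⟩
  have ht0 : ∀ j, t j ≠ 0 := fun j => hT0 _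
  have hcoord : ∀ g ∈ G', ∃ a : Fin (Module.finrank ℤ G') → ℤ, g = ∑ j, a j • e j := by
    intro g hg
    refine ⟨b.equivFun ⟨g, hg⟩, ?_⟩
    have := congrArg Subtype.val (b.sum_equivFun ⟨g, hg⟩)
    rw [AddSubgroup.val_finsetSum] at this
    exact this.symm
  -- Only cosets of G' containing the degree of a nonzero element matter; w_c is a nonzero
  -- homogeneous element of degree in c.
  let ι := {c : G ⧸ G' // ∃ g : hL.support, QuotientAddGroup.mk (g : G) = c}
  choose δ hδ using fun c : ι => c.2
  let w : ι → K := fun c => T (δ c)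
  have hw : ∀ c, w c ∈ L (δ c) := fun c => hT _
  have hw0 : ∀ c, w c ≠ 0 := fun c => hT0 _
  have hemem : ∀ d : Fin (Module.finrank ℤ G') →₀ ℕ, ∑ j, d j • e j ∈ G' := fun d =>
    sum_mem fun j _ => nsmul_mem (b j).2 _
  have hinj : Function.Injective fun i : ι × (Fin (Module.finrank ℤ G') →₀ ℕ) =>
      (δ i.1 : G) + ∑ j, i.2 j • e j := by
    rintro ⟨c, d⟩ ⟨c', d'⟩ h
    simp only at h
    have hc : c = c' := by
      apply Subtype.ext
      rw [← hδ c, ← hδ c', QuotientAddGroup.eq]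
      have := sub_mem (hemem d) (hemem d')
      convert this using 1
      rw [sub_eq_sub_iff_add_eq_add.2 (show (∑ j, d j • e j) + δ c = δ c' + ∑ j, d' j • e j by
        rw [add_comm]; exact h)]
      abel
    subst hc
    have h1 : ∑ j, (d j : ℤ) • b j = ∑ j, (d' j : ℤ) • b j := by
      apply Subtype.ext
      simpa [e] using h
    rw [← b.equivFun_symm_apply, ← b.equivFun_symm_apply] at h1
    have h2 := b.equivFun.symm.injective h1
    refine Prod.ext rfl (Finsupp.ext fun j => ?_)
    exact_mod_cast congrFun h2 j
  set M := ∏ j, t j with hM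
  have hM0 : M ≠ 0 := Finset.prod_ne_zero_iff.2 fun j _ => ht0 j
  have hMpow : ∀ n : ℕ, M ^ n ∈ L (n • ∑ j, e j) := fun n =>
    hL.pow_mem (hL.prod_mem Finset.univ ht) n
  -- ⨆ L g is a free module over A[1/M] with basis the w_c. Instead of localizing, membership is
  -- tested after multiplication by a large power of the unit M, which brings elements into the free
  -- A-module they span.
  let A := MvPolynomial (Fin (Module.finrank ℤ G')) hL.zeroSubfield
  let φ : A →ₐ[hL.zeroSubfield] K := MvPolynomial.aeval t
  let : Algebra A K := φ.toRingHom.toAlgebra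
  have hsmul : ∀ (p : A) (x : K), p • x = φ p * x := fun _ _ => rfl
  have hlin : LinearIndependent A w := by
    rw [linearIndependent_iff]
    intro l hl
    refine hL.eq_zero_of_sum_aeval_mul ht ht0 hw hw0 hinj l ?_
    rwa [Finsupp.linearCombination_apply] at hl
  have hspan : ∀ x ∈ Submodule.span A (Set.range w), x ∈ ⨆ g, L g := by
    intro x hx
    obtain ⟨l, rfl⟩ := (Finsupp.mem_span_range_iff_exists_finsupp).1 hx
    exact sum_mem fun c _ => hL.aeval_mul_mem_iSup ht (l c) (hw c)
  have hmemA : ∀ f ∈ s, ∃ N, ∀ n ≥ N, ∃ p : A, M ^ n * f = φ p := by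
    intro f hf
    have hf' : f ∈ ⨆ g : G', L g :=
      (iSup₂_le fun g hg => le_iSup (fun g : G' => L g) ⟨g, AddSubgroup.subset_closure hg⟩)
        (hsD f hf)
    refine AddSubgroup.iSup_induction (fun g : G' => L g)
      (C := fun f => ∃ N, ∀ n ≥ N, ∃ p : A, M ^ n * f = φ p) hf' (fun g x hx => ?_)
      ⟨0, fun n _ => ⟨0, by rw [mul_zero, map_zero]⟩⟩ fun x y hx hy => ?_
    · obtain ⟨a, ha⟩ := hcoord g g.2
      exact hL.exists_pow_mul_eq ht ht0 a (ha ▸ hx)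
    · obtain ⟨N, hN⟩ := hx
      obtain ⟨N', hN'⟩ := hy
      refine ⟨max N N', fun n hn => ?_⟩
      obtain ⟨p, hp⟩ := hN n (le_of_max_le_left hn)
      obtain ⟨p', hp'⟩ := hN' n (le_of_max_le_right hn)
      exact ⟨p + p', by rw [mul_add, hp, hp', map_add]⟩
  have hmemspan : ∀ x ∈ ⨆ g, L g, ∃ N, ∀ n ≥ N, M ^ n * x ∈ Submodule.span A (Set.range w) := by
    intro x hx
    refine AddSubgroup.iSup_induction L
      (C := fun x => ∃ N, ∀ n ≥ N, M ^ n * x ∈ Submodule.span A (Set.range w)) hx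
      (fun g x hx => ?_) ⟨0, fun n _ => by rw [mul_zero]; exact zero_mem _⟩ fun x y hx hy => ?_
    · by_cases hx0 : x = 0
      · exact ⟨0, fun n _ => by rw [hx0, mul_zero]; exact zero_mem _⟩
      let c : ι := ⟨QuotientAddGroup.mk g, ⟨g, x, hx, hx0⟩, rfl⟩
      have hg : -(δ c : G) + g ∈ G' := QuotientAddGroup.eq.1 (hδ c)
      obtain ⟨a, ha⟩ := hcoord _ hg
      obtain ⟨N, hN⟩ := hL.exists_pow_mul_eq ht ht0 a (x := (w c)⁻¹ * x)
        (ha ▸ hL.mul_mem (hL.inv_mem (hw c)) hx)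
      refine ⟨N, fun n hn => ?_⟩
      obtain ⟨p, hp⟩ := hN n hn
      have : M ^ n * x = p • w c := by
        rw [hsmul]
        change _ = MvPolynomial.aeval t p * w c
        rw [← hp]
        have := hw0 c
        rw [← hM]
        field_simp
      rw [this]
      exact Submodule.smul_mem _ _ (Submodule.subset_span ⟨c, rfl⟩)
    · obtain ⟨N, hN⟩ := hx
      obtain ⟨N', hN'⟩ := hy
      refine ⟨max N N', fun n hn => ?_⟩
      rw [mul_add]
      exact add_mem (hN n (le_of_max_le_left hn)) (hN' n (le_of_max_le_right hn))
  choose! N hN using hmemA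
  have hp : ∀ f ∈ s, ∃ p : A, M ^ (s.sup N) * f = φ p := fun f hf =>
    hN f hf _ (Finset.le_sup hf)
  choose! p hp using hp
  let : StrongNormalizationMonoid A := UniqueFactorizationMonoid.strongNormalizationMonoid
  let : NormalizedGCDMonoid A := UniqueFactorizationMonoid.toNormalizedGCDMonoid A
  -- A polynomial ring over a field has gcds. Dividing the polynomials M^N f by their gcd gives the
  -- scaling factor z = M^N / gcd and coprime quotients q(f) = zf.
  obtain ⟨q, hq, hq1⟩ := Finset.extract_gcd p ⟨f₀, hf₀⟩
  have hne : φ (s.gcd p) * φ (q f₀) ≠ 0 := by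
    rw [← map_mul, ← hq f₀ hf₀, ← hp f₀ hf₀]
    exact mul_ne_zero (pow_ne_zero _ hM0) h0
  have hd0 := left_ne_zero_of_mul hne
  have hzf : ∀ f ∈ s, M ^ (s.sup N) / φ (s.gcd p) * f = φ (q f) := by
    intro f hf
    rw [div_mul_eq_mul_div, hp f hf, hq f hf, map_mul, mul_div_cancel_left₀ _ hd0]
  refine ⟨M ^ (s.sup N) / φ (s.gcd p), div_ne_zero (pow_ne_zero _ hM0) hd0, fun f hf => ?_,
    fun y hy => ?_⟩
  · rw [hzf f hf]
    simpa using hL.aeval_mul_mem_iSup ht (q f) hL.one_mem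
  · have hy' : ∀ f ∈ s, ∃ N, ∀ n ≥ N,
        M ^ n * (y * φ (q f)) ∈ Submodule.span A (Set.range w) := fun f hf => by
      rw [← hzf f hf]
      exact hmemspan _ (hy f hf)
    choose! N' hN' using hy'
    set n := s.sup N'
    have h1 : M ^ n * y ∈ Submodule.span A (Set.range w) := by
      refine mem_span_of_dvd hlin (fun f : s => q f) (x₀ := ⟨f₀, hf₀⟩)
        (right_ne_zero_of_mul hne) (fun a ha => ?_) fun f => ?_
      · have h2 : q f₀ ∣ s.gcd fun f => a * q f := Finset.dvd_gcd fun f hf => ha ⟨f, hf⟩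
        have h3 := h2.trans (Finset.gcd_mul_left' s q a).dvd
        rwa [hq1, mul_one] at h3
      · rw [mul_assoc]
        exact hN' f f.2 n (Finset.le_sup f.2)
    have h2 := hL.mul_mem_iSup (hL.inv_mem (hMpow n)) (hspan _ h1)
    rwa [inv_mul_cancel_left₀ (pow_ne_zero _ hM0)] at h2

end IsGradedField

end GradedField

/-! ### `R_H` as a graded field over the quotient group of `Γ`. -/

section HomogeneousQuotientField

variable {Γ R : Type*} [AddCancelCommMonoid Γ] [DecidableEq Γ] [CommRing R]
  (𝒜 : Γ → AddSubgroup R) [GradedRing 𝒜] [IsDomain R] (K : Type*) [Field K] [Algebra R K]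
  [IsFractionRing R K]

instance isAddTorsionFree_grothendieckAddGroup [IsAddTorsionFree Γ] :
    IsAddTorsionFree (Algebra.GrothendieckAddGroup Γ) := by
  have hsurj : ∀ z : Algebra.GrothendieckAddGroup Γ, ∃ a b : Γ,
      z + Algebra.GrothendieckAddGroup.of b = Algebra.GrothendieckAddGroup.of a := fun z => by
    obtain ⟨⟨a, b⟩, h⟩ := (AddLocalization.addMonoidOf (⊤ : AddSubmonoid Γ)).surj z
    exact ⟨a, b, h⟩
  refine ⟨fun n hn x y h => ?_⟩
  obtain ⟨a, b, hx⟩ := hsurj x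
  obtain ⟨c, d, hy⟩ := hsurj y
  have h1 : Algebra.GrothendieckAddGroup.of (n • (a + d)) =
      Algebra.GrothendieckAddGroup.of (n • (c + b)) := by
    simp only [map_nsmul, map_add, ← hx, ← hy]
    have h' : n • x = n • y := h
    simp only [nsmul_add, h']
    abel
  have h2 := IsAddTorsionFree.nsmul_right_injective hn
    (Algebra.GrothendieckAddGroup.of_injective h1)
  have h3 := congrArg Algebra.GrothendieckAddGroup.of h2
  rw [map_add, map_add, ← hx, ← hy] at h3
  have h4 : x + (Algebra.GrothendieckAddGroup.of b + Algebra.GrothendieckAddGroup.of d) =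
      y + (Algebra.GrothendieckAddGroup.of b + Algebra.GrothendieckAddGroup.of d) := by
    rw [← add_assoc, h3]
    abel
  exact add_right_cancel h4

theorem exists_common_denominator (s : Finset (Algebra.GrothendieckAddGroup Γ))
    {v : Algebra.GrothendieckAddGroup Γ → K} (hv : ∀ g, v g ∈ homPiece 𝒜 K g) :
    ∃ (η : Γ) (h : R), h ∈ 𝒜 η ∧ h ≠ 0 ∧ ∀ g ∈ s, ∃ a : R,
      algebraMap R K h * v g = algebraMap R K a ∧ (a = 0 ∨ ∃ α, a ∈ 𝒜 α ∧
        Algebra.GrothendieckAddGroup.of α = g + Algebra.GrothendieckAddGroup.of η) := by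
  classical
  induction s using Finset.induction_on with
  | empty => exact ⟨0, 1, SetLike.GradedOne.one_mem, one_ne_zero, by simp⟩
  | insert g₀ s _ ih =>
    obtain ⟨η, h, hη, h0, hs⟩ := ih
    rcases (mem_homPiece_iff 𝒜 K).1 (hv g₀) with hz | ⟨α, β, a, ha, t, ht, ht0, hg, hvg⟩
    · refine ⟨η, h, hη, h0, fun g hg => ?_⟩
      rcases Finset.mem_insert.1 hg with rfl | hg
      · exact ⟨0, by rw [hz, mul_zero, map_zero], Or.inl rfl⟩
      · exact hs g hg
    · refine ⟨β + η, t * h, SetLike.mul_mem_graded ht hη, mul_ne_zero ht0 h0, fun g hg' => ?_⟩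
      rcases Finset.mem_insert.1 hg' with rfl | hg'
      · refine ⟨h * a, ?_, Or.inr ⟨η + α, SetLike.mul_mem_graded hη ha, ?_⟩⟩
        · have : algebraMap R K t ≠ 0 := by simpa using ht0
          rw [hvg, map_mul, map_mul]
          field_simp
        · rw [hg, map_add, map_add]
          abel
      · obtain ⟨b, hb, hb'⟩ := hs g hg'
        refine ⟨t * b, by rw [map_mul, map_mul, mul_assoc, hb], ?_⟩
        rcases hb' with rfl | ⟨γ, hγ, hγ'⟩
        · exact Or.inl (mul_zero t)
        · refine Or.inr ⟨β + γ, SetLike.mul_mem_graded ht hγ, ?_⟩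
          rw [map_add, map_add, hγ']
          abel

/-- Directness is inherited from R: a common homogeneous denominator turns a relation among
fractions of distinct degrees into one among elements of R of distinct degrees in Γ. -/
theorem isGradedField_homPiece : IsGradedField (homPiece 𝒜 K) where
  one_mem := one_mem_homPiece 𝒜 K
  mul_mem := mul_mem_homPiece 𝒜 K
  inv_mem := inv_mem_homPiece 𝒜 K
  eq_zero_of_sum_eq_zero s v hv hs g₀ hg₀ := by
    obtain ⟨η, h, -, h0, hd⟩ := exists_common_denominator 𝒜 K s hv
    choose! a ha ha' using hd
    have hh0 : algebraMap R K h ≠ 0 := by simpa using h0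
    have hsum : ∑ g ∈ s, a g = 0 := by
      apply IsFractionRing.injective R K
      rw [map_sum, map_zero, ← Finset.sum_congr rfl ha, ← Finset.mul_sum, hs, mul_zero]
    by_contra hne
    have ha0 : a g₀ ≠ 0 := fun h1 => mul_ne_zero hh0 hne (by rw [ha g₀ hg₀, h1, map_zero])
    obtain ⟨α, hα, hα'⟩ := (ha' g₀ hg₀).resolve_left ha0
    have h2 := congrArg (GradedRing.proj 𝒜 α) hsum
    rw [map_sum, map_zero, Finset.sum_eq_single_of_mem g₀ hg₀, GradedRing.proj_apply,
      DirectSum.decompose_of_mem_same 𝒜 hα] at h2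
    · exact ha0 h2
    · intro g hg hgg
      rcases ha' g hg with h3 | ⟨β, hβ, hβ'⟩
      · rw [h3, map_zero]
      · rw [GradedRing.proj_apply]
        refine DirectSum.decompose_of_mem_ne 𝒜 hβ fun hβα => hgg ?_
        rw [hβα, hα'] at hβ'
        exact (add_right_cancel hβ').symm

variable {K}

theorem mem_iSup_homPiece_iff {x : K} :
    x ∈ ⨆ γ, homPiece 𝒜 K γ ↔ x ∈ homQuotientField 𝒜 K := by
  constructor
  · intro hx
    have : ⨆ γ, homPiece 𝒜 K γ ≤
        (Subalgebra.toSubmodule (homQuotientField 𝒜 K)).toAddSubgroup :=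
      iSup_le fun γ y hy => IsHomFraction.mem_homQuotientField 𝒜 ⟨γ, hy⟩
    exact this hx
  · intro hx
    obtain ⟨a, s, hs, rfl⟩ := (mem_homQuotientField_iff 𝒜 K).1 hx
    obtain ⟨⟨β, hβ⟩, hs0⟩ := (mem_homSubmonoid_iff 𝒜).1 hs
    classical
    rw [← DirectSum.sum_support_decompose 𝒜 a, map_sum, Finset.sum_div]
    exact sum_mem fun α _ => AddSubgroup.mem_iSup_of_mem _
      (div_mem_homPiece 𝒜 K (SetLike.coe_mem _) hβ hs0)

end HomogeneousQuotientField

/-! ### From graded P`v`MD to P`v`MD. -/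

section Implications

variable {Γ R : Type*} [AddCancelCommMonoid Γ] [IsAddTorsionFree Γ] [DecidableEq Γ] [CommRing R]
  {𝒜 : Γ → AddSubgroup R} [GradedRing 𝒜] [IsDomain R] {K : Type*} [Field K] [Algebra R K]
  [IsFractionRing R K]

/-- After scaling by z, the generators lie in R_H and are coprime there. With G the sum of the
contents C(zx) and W ⊆ G⁻¹ such that GW contains a GV module, zW lies in I⁻¹, and I·zW is shown to
be a GV submodule of I I⁻¹. -/
theorem IsGradedPvMD.isPvMD (h : IsGradedPvMD 𝒜 K) : IsPvMD R K := by
  classical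
  rw [isPvMD_iff]
  intro I hI hI0
  obtain ⟨r, hr0, hr⟩ := exists_smul_le_one hI
  have hr0' : algebraMap R K r ≠ 0 := by simpa using hr0
  obtain ⟨X, rfl⟩ := hI
  obtain ⟨x₀, hx₀, hx₀0⟩ : ∃ x ∈ X, x ≠ 0 := by
    by_contra! hcon
    exact hI0 (le_bot_iff.1 (Submodule.span_le.2 fun x hx => hcon x hx))
  obtain ⟨z', hz'0, hz', hz'B⟩ := (isGradedField_homPiece 𝒜 K).exists_mul_mem_iSup
    (X.image (algebraMap R K r * ·)) (fun f hf => by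
      obtain ⟨x, hx, rfl⟩ := Finset.mem_image.1 hf
      exact (mem_iSup_homPiece_iff 𝒜).2 (one_le_homQuotientField (hr x (Submodule.subset_span hx))))
    (Finset.mem_image_of_mem _ hx₀) (mul_ne_zero hr0' hx₀0)
  simp only [mem_iSup_homPiece_iff, Finset.forall_mem_image, ← mul_assoc z'] at hz' hz'B
  set z := z' * algebraMap R K r with hz
  have hz0 : z ≠ 0 := mul_ne_zero hz'0 hr0'
  set G : Submodule R K := X.sup fun x => fracContent 𝒜 K (z * x) with hG
  have hGfg : G.FG ∧ IsGraded 𝒜 G := by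
    rw [hG]
    refine Finset.sup_induction (p := fun G : Submodule R K => G.FG ∧ IsGraded 𝒜 G)
      ⟨Submodule.fg_bot, ?_⟩ (fun a ha b hb => ⟨ha.1.sup hb.1, ha.2.sup hb.2⟩)
      fun x hx => ⟨fracContent_fg 𝒜 (hz' hx), isGraded_fracContent (hz' hx)⟩
    rw [← Submodule.span_empty]
    exact isGraded_span 𝒜 fun x hx => absurd hx (Set.notMem_empty x)
  have hleG : ∀ x ∈ X, fracContent 𝒜 K (z * x) ≤ G := fun x hx =>
    Finset.le_sup (f := fun x => fracContent 𝒜 K (z * x)) hx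
  have hG0 : G ≠ ⊥ := fun h0 =>
    fracContent_ne_bot 𝒜 (hz' hx₀) (mul_ne_zero hz0 hx₀0) (le_bot_iff.1 (h0 ▸ hleG x₀ hx₀))
  obtain ⟨F, hF, hFG⟩ := h.isTInvertible hGfg.2 hGfg.1 hG0
  obtain ⟨W₀, hW₀, hW₀G, hFW₀⟩ := exists_fg_le_mul hF.1 hFG
  obtain ⟨W, hW, hWgr, hW₀W, hWG⟩ := IsGraded.exists_fg hW₀ (hGfg.2.one_div hG0) hW₀G
  have hFW : F ≤ G * W := hFW₀.trans (mul_le_mul' le_rfl hW₀W)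
  have hGW : G * W ≤ 1 := le_one_div_iff.1 hWG
  have hW0 : W ≠ ⊥ := by
    rintro rfl
    rw [Submodule.mul_bot, le_bot_iff] at hFW
    exact hF.2.1 hFW
  obtain ⟨w₀, hw₀, hw₀W, hw₀0⟩ := hWgr.exists_ne_zero hW0
  set I := Submodule.span R (X : Set K) with hI
  have hJle : I * (Submodule.span R {z} * W) ≤ I * (1 / I) := by
    refine mul_le_mul' le_rfl (le_one_div_iff.2 ?_)
    rw [← mul_assoc, hI, Submodule.span_mul_span]
    refine (mul_le_mul' (Submodule.span_le.2 ?_) le_rfl).trans hGW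
    rintro _ ⟨x, hx, _, rfl, rfl⟩
    simp only [mul_comm x]
    exact hleG x hx (mem_fracContent 𝒜 (hz' hx))
  refine ⟨_, ⟨(Submodule.fg_span X.finite_toSet).mul ((Submodule.fg_span_singleton z).mul hW),
    mul_ne_bot hI0 (mul_ne_bot ?_ hW0), le_antisymm (fun y hy => ?_) ?_⟩, hJle⟩
  · rwa [Ne, Submodule.span_singleton_eq_bot]
  · have hyw : ∀ x ∈ X, ∀ w ∈ W, y * (z * x) * w ∈ (1 : Submodule R K) := by
      intro x hx w hw
      have := mem_one_div.1 hy _ (Submodule.mul_mem_mul (Submodule.subset_span hx)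
        (Submodule.mul_mem_mul (Submodule.mem_span_singleton_self z) hw))
      rwa [show y * (z * x) * w = y * (x * (z * w)) by ring]
    -- Dividing by the homogeneous w₀ puts every y(zx) in R_H; coprimality of the zx then forces y ∈
    -- R_H, so that y has a content.
    have hyR : y ∈ homQuotientField 𝒜 K := hz'B y fun x hx =>
      mem_homQuotientField_of_mul_mem hw₀ hw₀0 (one_le_homQuotientField (hyw x hx w₀ hw₀W))
    -- For homogeneous w ∈ W, the content formula gives w C(y) C(zx) ⊆ C(y w z x)^w ⊆ R. Summing
    -- over x yields C(y) G W ⊆ R, and the GV module inside GW gives y ∈ R.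
    have hle : ∀ x ∈ X, fracContent 𝒜 K y * fracContent 𝒜 K (z * x) * W ≤ 1 := by
      intro x hx
      rw [mul_comm, hWgr.eq_span, Submodule.span_eq_iSup_of_singleton_spans, Submodule.iSup_mul]
      refine iSup_le fun w => ?_
      rw [Submodule.iSup_mul]
      refine iSup_le fun hw => ?_
      rw [mul_left_comm, ← fracContent_homFraction_mul 𝒜 hw.1 (hz' hx)]
      refine (h.fracContent_mul_le hyR
        (mul_mem (IsHomFraction.mem_homQuotientField 𝒜 hw.1) (hz' hx))).trans ?_
      rw [← wOp_one]
      refine wOp_mono ((isGraded_one _ ?_).2)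
      have := hyw x hx w hw.2
      rwa [show y * (w * (z * x)) = y * (z * x) * w by ring]
    have hle' : fracContent 𝒜 K y * G * W ≤ 1 := by
      rw [mul_comm, ← mul_assoc, mul_comm, hG]
      refine Finset.sup_induction (p := fun G : Submodule R K => G * (W * fracContent 𝒜 K y) ≤ 1)
        (by simp) (fun a ha b hb => by rw [Submodule.sup_mul]; exact sup_le ha hb)
        fun x hx => ?_
      have := hle x hx
      rwa [mul_right_comm, mul_comm, mul_comm _ W] at this
    exact hF.le_one_of_mul_le ((mul_le_mul' le_rfl hFW).trans (by rwa [← mul_assoc]))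
      (mem_fracContent 𝒜 hyR)
  · exact one_div_one.symm.trans_le (one_div_anti (hJle.trans (mul_one_div_le_one I)))

end Implications

/-! ### Assembling the equivalences. -/

section Equivalences

variable {Γ R : Type*} [AddCancelCommMonoid Γ] [IsAddTorsionFree Γ] [DecidableEq Γ] [CommRing R]
  {𝒜 : Γ → AddSubgroup R} [GradedRing 𝒜] [IsDomain R] {K : Type*} [Field K] [Algebra R K]
  [IsFractionRing R K]

theorem IsPvMD.isGradedPvMD (h : IsPvMD R K) : IsGradedPvMD 𝒜 K := fun _ hI h0 _ =>
  h _ (coeSubmodule_fg hI) (mt (coeSubmodule_eq_bot (K := K)).1 h0)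

theorem flat_ofField {S : Submonoid R} (hS : S ≤ nonZeroDivisors R) :
    Module.Flat R (Localization.subalgebra.ofField K S hS) :=
  IsLocalization.flat _ S

end Equivalences

end GradedDomain

theorem mainTheorem11 {Γ R K : Type*} [AddCancelCommMonoid Γ] [IsAddTorsionFree Γ]
    [DecidableEq Γ] [CommRing R] [IsDomain R] (𝒜 : Γ → AddSubgroup R) [GradedRing 𝒜]
    [Field K] [Algebra R K] [IsFractionRing R K]
    (hunit : ∃ α : Γ, α ≠ 0 ∧ ∃ u ∈ 𝒜 α, IsUnit u) :
    [ -- (1) `R` is a PvMD, or, equivalently, a graded PvMD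
      GradedDomain.IsPvMD R K,
      GradedDomain.IsGradedPvMD 𝒜 K,
      -- (2) `R_{H \ P}` is a graded Prüfer domain for each `P ∈ h-QMax^t(R)`
      ∀ P ∈ GradedDomain.hQMaxT 𝒜 K, ∃ _ : P.IsPrime,
        GradedDomain.IsGradedPruferDomain 𝒜 K (GradedDomain.homLocalization 𝒜 K P),
      -- (3) `R_P` is a valuation domain for each `P ∈ h-QMax^t(R)`
      ∀ P ∈ GradedDomain.hQMaxT 𝒜 K, ∃ _ : P.IsPrime,
        ValuationRing (GradedDomain.localizationAt K P),
      -- (4) every ideal of `R_{N_v(H)}` is extended from a homogeneous ideal of `R`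
      ∀ A : Ideal (GradedDomain.nagataRing 𝒜 K), ∃ I : Ideal R, I.IsHomogeneous 𝒜 ∧
        A = I.map (algebraMap R (GradedDomain.nagataRing 𝒜 K)),
      -- (5) `R_{N_v(H)}` is a Prüfer domain
      GradedDomain.IsPruferDomain (GradedDomain.nagataRing 𝒜 K) K,
      -- (6) `R_{N_v(H)}` is a Bézout domain
      IsBezout (GradedDomain.nagataRing 𝒜 K),
      -- (7) `R_{N_v(H)} = Kr(R, w)`
      (GradedDomain.nagataRing 𝒜 K : Set K) = GradedDomain.Kr 𝒜 K,
      -- (8) `Kr(R, w)` is a ring of fractions of `R`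
      ∃ (S : Submonoid R) (hS : S ≤ nonZeroDivisors R),
        GradedDomain.Kr 𝒜 K = (Localization.subalgebra.ofField K S hS : Set K),
      -- (9) `Kr(R, w)` is a flat `R`-module
      ∃ T : Subalgebra R K, (T : Set K) = GradedDomain.Kr 𝒜 K ∧ Module.Flat R T,
      -- (10) each homogeneously `t`-linked overring of `R` is a PvMD
      ∀ T : Subalgebra R K, GradedDomain.IsHomogeneousOverring 𝒜 K T →
        GradedDomain.IsHomogeneouslyTLinked 𝒜 K T → GradedDomain.IsPvMD T K,
      -- (11) each homogeneously `t`-linked overring of `R` is integrally closed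
      ∀ T : Subalgebra R K, GradedDomain.IsHomogeneousOverring 𝒜 K T →
        GradedDomain.IsHomogeneouslyTLinked 𝒜 K T → IsIntegrallyClosed T,
      -- (12) `(C(f) C(g))^w = C(fg)^w` for all `f, g ∈ R_H`
      ∀ f ∈ GradedDomain.homQuotientField 𝒜 K, ∀ g ∈ GradedDomain.homQuotientField 𝒜 K,
        GradedDomain.wOp (GradedDomain.fracContent 𝒜 K f * GradedDomain.fracContent 𝒜 K g) =
          GradedDomain.wOp (GradedDomain.fracContent 𝒜 K (f * g)),
      -- (13) `I^w = I^{w_a}` for each nonzero finitely generated homogeneous ideal `I` of `R`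
      ∀ I : Ideal R, I ≠ ⊥ → I.FG → I.IsHomogeneous 𝒜 →
        (GradedDomain.wOp (IsLocalization.coeSubmodule K I) : Set K) =
          GradedDomain.eabOp GradedDomain.wOp (IsLocalization.coeSubmodule K I)
    ].TFAE := by
  open GradedDomain in
  -- The second entry, the graded P`v`MD property, is the hub. Full P`v`MD is needed only for the
  -- overrings and for `w_a`, where submodules that are not homogeneous occur.
  tfae_have 1 → 2 := IsPvMD.isGradedPvMD
  tfae_have 2 → 1 := IsGradedPvMD.isPvMD
  tfae_have 2 → 3 := fun h P hP => by
    obtain ⟨α, hα, u, hu, huu⟩ := hunit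
    have := isPrime_of_mem_hQMaxT hα hu huu hP
    exact ⟨this, h.isGradedPruferDomain hP⟩
  tfae_have 3 → 2 := IsGradedPvMD.of_isGradedPruferDomain
  tfae_have 5 → 4 := fun h P hP => by
    obtain ⟨α, hα, u, hu, huu⟩ := id hunit
    have := isPrime_of_mem_hQMaxT hα hu huu hP
    exact ⟨this, (ContentDivisibility.of_exists_ideal h).valuationRing hunit hP⟩
  tfae_have 4 → 2 := IsGradedPvMD.of_valuationRing
  tfae_have 2 → 5 := fun h => ContentDivisibility.exists_ideal (K := K) fun _ _ hg hfg =>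
    h.div_mem_nagataRing' hunit hg hfg
  tfae_have 5 → 7 := fun h => (ContentDivisibility.of_exists_ideal h).isBezout hunit
  tfae_have 7 → 6 := IsPruferDomain.of_isBezout
  tfae_have 6 → 2 := IsGradedPvMD.of_isPruferDomain_nagataRing
  tfae_have 2 → 8 := fun h => h.nagataRing_eq_Kr hunit
  tfae_have 8 → 9 := fun h => ⟨nagataSubmonoid 𝒜 K, _, h.symm⟩
  tfae_have 9 → 10 := fun ⟨S, hS, h⟩ => ⟨_, h.symm, flat_ofField hS⟩
  tfae_have 10 → 2 := fun ⟨T, hT, _⟩ => IsGradedPvMD.of_flat hunit T hT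
  tfae_have 1 → 11 := fun h _ hT hlink => h.of_isHomogeneouslyTLinked hT hlink
  tfae_have 11 → 12 := fun h T hT hlink => (h T hT hlink).isIntegrallyClosed
  tfae_have 12 → 2 := IsGradedPvMD.of_isIntegrallyClosed hunit
  tfae_have 2 → 13 := fun h _ hf _ hg => h.wOp_fracContent_mul hf hg
  tfae_have 13 → 2 := IsGradedPvMD.of_wOp_fracContent_mul hunit
  tfae_have 1 → 14 := fun h _ _ _ _ => h.wOp_eq_eabOp _
  tfae_have 14 → 2 := IsGradedPvMD.of_wOp_eq_eabOp
  tfae_finish
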